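/- Let $q=3$, let $\Xi=\{x\in[0,1]^3:\ x_1+x_2+x_3=1\}$, and for $\beta>0$, $J>0$ let $F_{\beta,J}:\Xi^2\to\mathbb R$ be the free energy of the two-component Curie--Weiss--Potts model, $$F_{\beta,J}(x,y)=-\frac12\sum_{i=1}^3(x_i^2+y_i^2)-J\sum_{i=1}^3x_iy_i+\frac{1+J}{\beta}\sum_{i=1}^3\big(x_i\log x_i+y_i\log y_i\big),\qquad 0\log 0=0 .$$ A *critical point* of $F_{\beta,J}$ is a point of the relative interior of $\Xi^2$ at which all derivatives tangent to $\Xi^2$ vanish. A *lowest saddle* is a critical point $p$ for which there are local minima $a,b$ of $F_{\beta,J}$ on $\Xi^2$ with $F_{\beta,J}(a),F_{\beta,J}(b)<F_{\beta,J}(p)$ such that the connected components of $a$ and of $b$ in $\{F_{\beta,J}<F_{\beta,J}(p)\}$ are different and $p$ lies in the closure of both. Let $\xi(x)=\frac{1}{1-3x}\log\frac{1-2x}{x}$ for $x\in(0,\frac12)$, with $\xi(\frac13)=3$ (its limit), let $\beta_1=\min_{(0,1/2)}\xi$ and $\beta_3=3$. For $\beta>\beta_1$ let $x_s(\beta)<x_l(\beta)$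 be the two solutions of $\xi(x)=\beta$, put $x_l(\beta_1)=\operatorname{argmin}\xi$, and let $$\mathfrak S^2=\{(x,x): x\text{ a permutation of }(x_s,x_s,1-2x_s)\},\qquad \mathfrak L^2=\{(x,x): x\text{ a permutation of }(x_l,x_l,1-2x_l)\};$$ for $\beta\le\beta_1$ let $\mathfrak S^2=\mathfrak L^2=\emptyset$. Let $\mathbf q_3=(\frac13,\frac13,\frac13,\frac13,\frac13,\frac13)$. The two components are called *synchronized* if every local minimum and every lowest saddle of $F_{\beta,J}$ belongs to $\mathfrak S^2\cup\mathfrak L^2\cup\{\mathbf q_3\}$, and *desynchronized* otherwise. Define $$\psi_1(\beta)=\frac{\beta-\frac1{x_l}}{\beta+\frac1{x_l}}\mathbf 1\{\beta\ge\beta_3\},\quad \psi_2(\beta)=\frac{\beta-\frac1{3x_l(1-2x_l)}}{\beta+\frac1{3x_l(1-2x_l)}}\mathbf 1\{\beta_1\le\beta\le\beta_3\},\quad \psi_3(\beta)=\frac{\beta-3+\sqrt{25\beta^2-50\beta+1}}{2(1+6\beta)},$$ let $J_c\approx0.2419$ be the unique root in $(0,1)$ of $(1+x)\big(\frac1{1-x}-\frac1{2+x}\big)-\log\frac{2+x}{1-x}$,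 and define $\psi_s(\beta)=0$ for $\beta\le\beta_1$, $\psi_s(\beta)=\max[\psi_1(\beta),\min\{J_c,\psi_3(\beta)\}]$ for $\beta>\beta_1$, and $\psi_d=\psi_1+\psi_2$. Then for all $\beta>0$ and $J>0$: if $J>\psi_s(\beta)$, the two components are synchronized; if $J<\psi_d(\beta)$, the two components are desynchronized. -/

import Mathlib

noncomputable section

namespace CWP

/-- The product `Ξ²` of two copies of the probability simplex on `q` spins; a point `(x, y)` is
the pair of empirical magnetizations of the two components. -/
def Xi2 (q : ℕ) : Set ((Fin q → ℝ) × (Fin q → ℝ)) :=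
  stdSimplex ℝ (Fin q) ×ˢ stdSimplex ℝ (Fin q)

/-- The energy part `H`. -/
def energy {q : ℕ} (J : ℝ) (p : (Fin q → ℝ) × (Fin q → ℝ)) : ℝ :=
  -(∑ i, (1 / 2) * p.1 i ^ 2 + ∑ i, (1 / 2) * p.2 i ^ 2) - J * ∑ i, p.1 i * p.2 i

/-- The entropy part `S` (with `0 log 0 = 0`). -/
def entropy {q : ℕ} (p : (Fin q → ℝ) × (Fin q → ℝ)) : ℝ :=
  ∑ i, p.1 i * Real.log (p.1 i) + ∑ i, p.2 i * Real.log (p.2 i)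

/-- The free energy `F_{β,J} = H + ((1 + J) / β) S`. -/
def F {q : ℕ} (β J : ℝ) (p : (Fin q → ℝ) × (Fin q → ℝ)) : ℝ :=
  energy J p + (1 + J) / β * entropy p

/-- Local minima of `F_{β,J}` on `Ξ²`. -/
def IsLocalMinimum {q : ℕ} (β J : ℝ) (p : (Fin q → ℝ) × (Fin q → ℝ)) : Prop :=
  p ∈ Xi2 q ∧ IsLocalMinOn (F β J) (Xi2 q) p

/-- Critical points of `F_{β,J}`: points of the relative interior of `Ξ²` at which every
derivative in a direction tangent to `Ξ²` vanishes. -/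
def IsCriticalPoint {q : ℕ} (β J : ℝ) (p : (Fin q → ℝ) × (Fin q → ℝ)) : Prop :=
  p ∈ Xi2 q ∧ (∀ i, 0 < p.1 i) ∧ (∀ i, 0 < p.2 i) ∧
    ∀ w : (Fin q → ℝ) × (Fin q → ℝ), ∑ i, w.1 i = 0 → ∑ i, w.2 i = 0 →
      HasDerivAt (fun t : ℝ => F β J (p + t • w)) 0 0

/-- The strict sublevel set `{F_{β,J} < c}` in `Ξ²`. -/
def sublevel (q : ℕ) (β J c : ℝ) : Set ((Fin q → ℝ) × (Fin q → ℝ)) :=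
  {p | p ∈ Xi2 q ∧ F β J p < c}

/-- The valley of `a` below the level `c`: the connected component of `a` in `{F_{β,J} < c}`. -/
def valley {q : ℕ} (β J c : ℝ) (a : (Fin q → ℝ) × (Fin q → ℝ)) :
    Set ((Fin q → ℝ) × (Fin q → ℝ)) :=
  connectedComponentIn (sublevel q β J c) a

/-- Lowest saddles of `F_{β,J}`: critical points `p` at which the valleys of two local minima
`a` and `b` meet, these valleys (below the level of `p`) being different.  Thus `a` and `b` are not
connected strictly below the level of `p`, but `p` connects them: it is a saddle of the lowest
possible level between `a` and `b`. -/
def IsLowestSaddle {q : ℕ} (β J : ℝ) (p : (Fin q → ℝ) × (Fin q → ℝ)) : Prop :=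
  IsCriticalPoint β J p ∧
    ∃ a b : (Fin q → ℝ) × (Fin q → ℝ),
      IsLocalMinimum β J a ∧ IsLocalMinimum β J b ∧ F β J a < F β J p ∧ F β J b < F β J p ∧
      valley β J (F β J p) a ≠ valley β J (F β J p) b ∧
      p ∈ closure (valley β J (F β J p) a) ∧ p ∈ closure (valley β J (F β J p) b)

/-- `ξ(x) = log((1 - 2x) / x) / (1 - 3x)` on `(0, 1/2)`, extended by its limit `3` at the
removable singularity `x = 1/3`. -/
def xi (x : ℝ) : ℝ :=
  if x = 1 / 3 then 3 else 1 / (1 - 3 * x) * Real.log ((1 - 2 * x) / x)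

/-- `β₁`, the global minimum of `ξ` on `(0, 1/2)`. -/
def beta1 : ℝ := sInf (xi '' Set.Ioo 0 (1 / 2))

/-- `β₃ = 3`. -/
def beta3 : ℝ := 3

/-- The solutions of `ξ(x) = β` in `(0, 1/2)`; there are exactly two of them if `β > β₁`. -/
def xiSolutions (β : ℝ) : Set ℝ := {x | x ∈ Set.Ioo (0 : ℝ) (1 / 2) ∧ xi x = β}

/-- The smaller solution of `ξ(x) = β`. -/
def xs (β : ℝ) : ℝ := sInf (xiSolutions β)

/-- The larger solution of `ξ(x) = β`. -/
def xl (β : ℝ) : ℝ := sSup (xiSolutions β)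

/-- The permutations of `(s, s, 1 - 2s)`. -/
def permutations (s : ℝ) : Set (Fin 3 → ℝ) :=
  {x | ∃ σ : Equiv.Perm (Fin 3), x = ![s, s, 1 - 2 * s] ∘ σ}

/-- `𝔖²(β)`, which is empty unless `β > β₁`. -/
def S2 (β : ℝ) : Set ((Fin 3 → ℝ) × (Fin 3 → ℝ)) :=
  {p | beta1 < β ∧ ∃ x ∈ permutations (xs β), p = (x, x)}

/-- `𝔏²(β)`, which is empty unless `β > β₁`. -/
def L2 (β : ℝ) : Set ((Fin 3 → ℝ) × (Fin 3 → ℝ)) :=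
  {p | beta1 < β ∧ ∃ x ∈ permutations (xl β), p = (x, x)}

/-- The uniform point `(1/3, 1/3, 1/3, 1/3, 1/3, 1/3)`. -/
def q3 : (Fin 3 → ℝ) × (Fin 3 → ℝ) := (fun _ => 1 / 3, fun _ => 1 / 3)

/-- The two components are synchronized: all local minima and all lowest saddles of `F_{β,J}`
(three spins) belong to `𝔖²` or `𝔏²`, or are the uniform point. -/
def Synchronized (β J : ℝ) : Prop :=
  ∀ p : (Fin 3 → ℝ) × (Fin 3 → ℝ),
    IsLocalMinimum β J p ∨ IsLowestSaddle β J p → p ∈ S2 β ∪ L2 β ∪ {q3}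

/-- The two components are desynchronized if they are not synchronized. -/
def Desynchronized (β J : ℝ) : Prop := ¬ Synchronized β J

def psi1 (β : ℝ) : ℝ :=
  if beta3 ≤ β then (β - 1 / xl β) / (β + 1 / xl β) else 0

def psi2 (β : ℝ) : ℝ :=
  if beta1 ≤ β ∧ β ≤ beta3 then
    (β - 1 / (3 * xl β * (1 - 2 * xl β))) / (β + 1 / (3 * xl β * (1 - 2 * xl β)))
  else 0

def psi3 (β : ℝ) : ℝ :=
  (β - 3 + Real.sqrt (25 * β ^ 2 - 50 * β + 1)) / (2 * (1 + 6 * β))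

/-- `J_c ≈ 0.2419`, the positive root of
`(1 + x) (1 / (1 - x) - 1 / (2 + x)) - log ((2 + x) / (1 - x))`.  For positive `x` this function is
defined only on `(0, 1)`, where it is strictly increasing and has exactly one root. -/
def Jc : ℝ :=
  sInf {x | x ∈ Set.Ioo (0 : ℝ) 1 ∧
    (1 + x) * (1 / (1 - x) - 1 / (2 + x)) - Real.log ((2 + x) / (1 - x)) = 0}

def psiS (β : ℝ) : ℝ :=
  if β ≤ beta1 then 0 else max (psi1 β) (min Jc (psi3 β))

def psiD (β : ℝ) : ℝ := psi1 β + psi2 β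

end CWP

end

/-! Synchronization. At a critical point, Lagrange multipliers give log xᵢ = β/(1+J)·(xᵢ + J yᵢ) +
c, and the same with x and y exchanged and another constant. Put m = β(1-J)/(1+J) and k =
(1+J)/(1-J), so km = β. Then log xᵢ - log yᵢ is affine in m(xᵢ - yᵢ), and log xᵢ + log yᵢ is affine
in km(xᵢ + yᵢ). For β > β₁ and J > ψ_s every critical point has x = y: if m ≤ 2, comparing
logarithmic and arithmetic means suffices (`eq_of_log_eq_of_le_two`); if m > 2, the hypothesis
places (k, m) in the region `Coupled`, where a sign analysis of the differences xᵢ - yᵢ applies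
(`Coupled.eq_zero`, with hard case `false_of_opposite_pair`). On the diagonal the equation is log xᵢ
= βxᵢ + c. Concavity of log makes two coordinates equal, so the point is uniform or comes from a
root of ξ = β, and strict convexity of ξ leaves only x_s and x_l. For β ≤ β₁ the inequality
`beta1_mul_sq_le` gives x = y instead; the uniform point is then the only local minimum, so no two
valleys exist to be separated.

Desynchronization. A critical point whose Hessian is negative on a plane can be bypassed below its
own level, so it is neither a local minimum nor a lowest saddle (`locJoined_of_index_two`).
Conversely, two local minima among finitely many force a lowest saddle to exist
(`exists_isLowestSaddle`). For J < ψ_d the points of 𝔏² carry such a plane, spanned by (w, w) and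
(w, -w). If β > 3 the uniform point carries one too, so synchronization would put all minima and
saddles in 𝔖², where F is constant, although a saddle lies strictly above its minima. If β₁ < β < 3
the uniform point and 𝔖² are local minima, so no candidate for the saddle remains. -/

namespace CWP

/-! ### Inequalities for hyperbolic functions. -/

open Real in
theorem sinh_lt_mul_cosh {r : ℝ} (hr : 0 < r) : sinh r < r * cosh r := by
  have hmono : StrictMonoOn (fun x : ℝ => x * cosh x - sinh x) (Set.Ici 0) := by
    apply strictMonoOn_of_deriv_pos (convex_Ici 0) (by fun_prop)
    intro x hx
    rw [interior_Ici] at hx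
    have h : HasDerivAt (fun x : ℝ => x * cosh x - sinh x) (1 * cosh x + x * sinh x - cosh x) x :=
      ((hasDerivAt_id x).mul (hasDerivAt_cosh x)).sub (hasDerivAt_sinh x)
    rw [h.deriv]
    have := mul_pos hx (sinh_pos_iff.2 hx)
    linarith
  have := hmono (Set.mem_Ici.2 le_rfl) (Set.mem_Ici.2 hr.le) hr
  simp at this
  linarith

-- The difference of the two sides has derivative (sinh² z - z²)/(z sinh² z) ≥ 0, and near 0 it is
-- bounded below by a quantity tending to 0.
open Real in
theorem log_sinh_div_self_le {z : ℝ} (hz : 0 < z) :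
    log (sinh z / z) ≤ z * cosh z / sinh z - 1 := by
  set h : ℝ → ℝ := fun z => z * cosh z / sinh z - 1 - (log (sinh z) - log z) with hh
  have hder : ∀ x : ℝ, 0 < x → HasDerivAt h
      (((1 * cosh x + x * sinh x) * sinh x - x * cosh x * cosh x) / sinh x ^ 2
        - (cosh x / sinh x - x⁻¹)) x := by
    intro x hx
    have hs : sinh x ≠ 0 := (sinh_pos_iff.2 hx).ne'
    exact ((((hasDerivAt_id x).mul (hasDerivAt_cosh x)).div (hasDerivAt_sinh x) hs).sub_const 1).sub
      (((hasDerivAt_sinh x).log hs).sub (hasDerivAt_log hx.ne'))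
  have hmono : MonotoneOn h (Set.Ioi 0) := by
    apply monotoneOn_of_deriv_nonneg (convex_Ioi 0)
    · exact fun x hx => (hder x hx).continuousAt.continuousWithinAt
    · rw [interior_Ioi]
      exact fun x hx => (hder x hx).differentiableAt.differentiableWithinAt
    · rw [interior_Ioi]
      intro x hx
      have hx : 0 < x := hx
      rw [(hder x hx).deriv]
      have hs : 0 < sinh x := sinh_pos_iff.2 hx
      have hxs : x < sinh x := self_lt_sinh_iff.2 hx
      have hc := cosh_sq x
      have : ((1 * cosh x + x * sinh x) * sinh x - x * cosh x * cosh x) / sinh x ^ 2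
        - (cosh x / sinh x - x⁻¹) = (sinh x ^ 2 - x ^ 2) / (x * sinh x ^ 2) := by
        field_simp
        linear_combination (-x ^ 2) * hc
      rw [this]
      have : 0 ≤ sinh x ^ 2 - x ^ 2 := by nlinarith
      positivity
  have hlow : ∀ a ∈ Set.Ioo 0 z, 1 - a⁻¹ * sinh a ≤ h z := by
    intro a ha
    refine le_trans ?_ (hmono ha.1 hz ha.2.le)
    have hs : 0 < sinh a := sinh_pos_iff.2 ha.1
    have h1 : 1 ≤ a * cosh a / sinh a := by
      rw [le_div_iff₀ hs]; linarith [sinh_lt_mul_cosh ha.1]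
    have h2 := log_le_sub_one_of_pos (div_pos hs ha.1)
    rw [log_div hs.ne' ha.1.ne'] at h2
    have : a⁻¹ * sinh a = sinh a / a := by ring
    simp only [hh, this]
    linarith
  have hlim : Filter.Tendsto (fun a : ℝ => 1 - a⁻¹ * sinh a) (nhdsWithin 0 (Set.Ioi 0))
      (nhds (1 - 1)) := by
    have h1 := (hasDerivAt_sinh 0).tendsto_slope_zero_right
    simp at h1
    exact h1.const_sub 1
  have h0 : 1 - 1 ≤ h z :=
    le_of_tendsto hlim (Filter.eventually_of_mem (Ioo_mem_nhdsGT hz) hlow)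
  rw [log_div (sinh_pos_iff.2 hz).ne' hz.ne']
  simp only [hh] at h0
  linarith

open Real in
/-- Widening the gap between two positive numbers with a fixed sum decreases the product of their
hyperbolic sines. -/
theorem sinh_mul_sinh_le {a b c d : ℝ} (hs : a + b = c + d) (hcd : c ≤ d)
    (hd : d ≤ b) : sinh a * sinh b ≤ sinh c * sinh d := by
  have h : ∀ x y : ℝ, 2 * (sinh x * sinh y) = cosh (x + y) - cosh (x - y) := by
    intro x y; rw [cosh_add, cosh_sub]; ring
  have h1 := h a b
  have h2 := h c d
  have h3 : cosh (c - d) ≤ cosh (a - b) := by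
    rw [cosh_le_cosh, abs_of_nonpos (by linarith), abs_of_nonpos (by linarith)]
    linarith
  rw [hs] at h1
  linarith

open Real in
theorem cosh_div_sinh_anti {a b : ℝ} (ha : 0 < a) (hab : a ≤ b) :
    cosh b / sinh b ≤ cosh a / sinh a := by
  have hsa := sinh_pos_iff.2 ha
  have hsb := sinh_pos_iff.2 (ha.trans_le hab)
  rw [div_le_div_iff₀ hsb hsa]
  have : 0 ≤ sinh (b - a) := sinh_nonneg_iff.2 (by linarith)
  rw [sinh_sub] at this
  linarith

open Real in
theorem coth_add_coth {a b : ℝ} (ha : 0 < a) (hb : 0 < b) :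
    cosh a / sinh a + cosh b / sinh b = sinh (a + b) / (sinh a * sinh b) := by
  have hsa := sinh_pos_iff.2 ha
  have hsb := sinh_pos_iff.2 hb
  rw [sinh_add]; field_simp; ring

/-! ### Exclusion estimates for solutions of the paired equations. -/

-- Here z₁, z₂ and -(z₁ + z₂) are the scaled differences and e ≥ z₁ is the offset. The arguments r₂
-- = z₂ + e and r₃ = z₁ + z₂ - e have the same sum as z₂, z₃ but a wider gap, so replacing rᵢ by zᵢ
-- lowers S₂ + S₃ and raises the product of the hyperbolic sines. With log(sinh z / z) ≤ z coth z -
-- 1 and T = S₂ + S₃ - 2 ≥ 0, the last two equations give γ ≥ -k - (k+1)T/2, while the first,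
-- linearized at S₁ = m - 2, gives the opposite strict inequality.
open Real in
theorem false_of_opposite_pair {k m γ e z1 z2 S1 S2 S3 : ℝ} (hk : 1 < k) (hm : 2 < m)
    (hw : m - 2 ≤ 2 / (3 * k + 1)) (hE : log (m - 2) + k * (3 - m) < 0)
    (hz1 : 0 ≤ z1) (hz1e : z1 ≤ e) (hz2 : 0 < z2) (he : e < z1 + z2) (hS1 : 0 < S1)
    (h2 : z2 * cosh (z2 + e) = S2 * sinh (z2 + e))
    (h3 : (z1 + z2) * cosh (z1 + z2 - e) = S3 * sinh (z1 + z2 - e))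
    (hsum : S1 + S2 + S3 = m) (W1 : γ ≤ log S1 - k * S1)
    (W2 : log (S2 / cosh (z2 + e)) - k * S2 = γ)
    (W3 : log (S3 / cosh (z1 + z2 - e)) - k * S3 = γ) : False := by
  have he0 : 0 ≤ e := hz1.trans hz1e
  set z3 := z1 + z2 with hz3
  set r2 := z2 + e with hr2
  set r3 := z3 - e with hr3
  have hz3p : 0 < z3 := by linarith
  have hr2p : 0 < r2 := by linarith
  have hr3p : 0 < r3 := by linarith
  have s2 := sinh_pos_iff.2 hr2p
  have s3 := sinh_pos_iff.2 hr3p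
  have t2 := sinh_pos_iff.2 hz2
  have t3 := sinh_pos_iff.2 hz3p
  have c2 := cosh_pos r2
  have c3 := cosh_pos r3
  have e2 : S2 = z2 * (cosh r2 / sinh r2) := by field_simp; linarith
  have e3 : S3 = z3 * (cosh r3 / sinh r3) := by field_simp; linarith
  have l2 : log (S2 / cosh r2) = log (z2 / sinh r2) := by
    congr 1; rw [e2]; field_simp
  have l3 : log (S3 / cosh r3) = log (z3 / sinh r3) := by
    congr 1; rw [e3]; field_simp
  -- comparison with the undisplaced points
  have hprod : sinh r3 * sinh r2 ≤ sinh z2 * sinh z3 :=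
    sinh_mul_sinh_le (by linarith) (by linarith) (by linarith)
  have hcoth_sum : cosh z2 / sinh z2 + cosh z3 / sinh z3 ≤
      cosh r2 / sinh r2 + cosh r3 / sinh r3 := by
    rw [coth_add_coth hz2 hz3p, coth_add_coth hr2p hr3p, show r2 + r3 = z2 + z3 by linarith,
      mul_comm (sinh r2)]
    exact div_le_div_of_nonneg_left (sinh_nonneg_iff.2 (by linarith)) (by positivity) hprod
  have hc32 : cosh z2 / sinh z2 ≤ cosh r3 / sinh r3 := cosh_div_sinh_anti hr3p (by linarith)
  have hc23 : cosh z3 / sinh z3 ≤ cosh z2 / sinh z2 := cosh_div_sinh_anti hz2 (by linarith)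
  have hSS : z2 * (cosh z2 / sinh z2) + z3 * (cosh z3 / sinh z3) ≤ S2 + S3 := by
    rw [e2, e3]
    nlinarith [mul_le_mul_of_nonneg_left hcoth_sum hz2.le,
      mul_le_mul_of_nonneg_left hc32 (show 0 ≤ z3 - z2 by linarith),
      mul_le_mul_of_nonneg_left hc23 (show 0 ≤ z3 - z2 by linarith)]
  have hl2 := log_sinh_div_self_le hz2
  have hl3 := log_sinh_div_self_le hz3p
  have hlog : log (sinh r2) + log (sinh r3) ≤ log (sinh z2) + log (sinh z3) := by
    rw [← log_mul s2.ne' s3.ne', ← log_mul t2.ne' t3.ne']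
    exact log_le_log (by positivity) (by linarith)
  rw [log_div t2.ne' hz2.ne', mul_div_assoc] at hl2
  rw [log_div t3.ne' hz3p.ne', mul_div_assoc] at hl3
  rw [l2, log_div hz2.ne' s2.ne'] at W2
  rw [l3, log_div hz3p.ne' s3.ne'] at W3
  -- lower bound on `S2 + S3`
  have hS2 : z2 / r2 ≤ S2 := by
    rw [e2, div_eq_mul_inv]
    refine mul_le_mul_of_nonneg_left ?_ hz2.le
    rw [inv_eq_one_div, div_le_div_iff₀ hr2p s2]
    linarith [sinh_lt_mul_cosh hr2p]
  have hS3 : z3 / r3 ≤ S3 := by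
    rw [e3, div_eq_mul_inv]
    refine mul_le_mul_of_nonneg_left ?_ hz3p.le
    rw [inv_eq_one_div, div_le_div_iff₀ hr3p s3]
    linarith [sinh_lt_mul_cosh hr3p]
  have hge2 : 2 ≤ S2 + S3 := by
    have : 2 ≤ z2 / r2 + z3 / r3 := by
      have h1 : z2 / r2 = 1 - e / r2 := by field_simp; linarith
      have h2 : z3 / r3 = 1 + e / r3 := by field_simp; linarith
      have h3 : e / r2 ≤ e / r3 := div_le_div_of_nonneg_left he0 hr3p (by linarith)
      linarith
    linarith
  -- tangent line at `m - 2`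
  set σ := m - 2 with hσ
  have hσp : 0 < σ := by linarith
  have htan : log S1 ≤ log σ + (S1 / σ - 1) := by
    have := log_le_sub_one_of_pos (div_pos hS1 hσp)
    rw [log_div hS1.ne' hσp.ne'] at this
    linarith
  have hinv : (3 * k + 1) / 2 ≤ 1 / σ := by
    rw [le_div_iff₀ hσp]
    rw [le_div_iff₀ (by linarith)] at hw
    linarith
  have hdiff : S1 / σ - 1 ≤ -(S2 + S3 - 2) * ((3 * k + 1) / 2) := by
    have : S1 / σ - 1 = -(S2 + S3 - 2) * (1 / σ) := by
      field_simp; linarith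
    rw [this]
    exact mul_le_mul_of_nonpos_left hinv (by linarith)
  have hkS : k * S1 = k * σ - k * S2 - k * S3 + 2 * k := by
    rw [show S1 = σ - (S2 + S3 - 2) by linarith]; ring
  have hE' : log σ < k * σ - k := by
    have : k * (3 - m) = k - k * σ := by rw [hσ]; ring
    linarith
  have hexp : -(S2 + S3 - 2) * ((3 * k + 1) / 2) =
      -(3 / 2) * (k * S2) - (3 / 2) * (k * S3) + 3 * k - S2 / 2 - S3 / 2 + 1 := by ring
  linarith

-- Two positive differences, both exceeding the offset e. The three lower bounds are 1 - e/(a+e), 1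
-- - e/(b+e) and 1 + e/(a+b-e); their total loss is at most 1/2, whereas `Coupled` forces m < 5/2.
open Real in
theorem sum_ge_of_two_pos {e a b S1 S2 S3 : ℝ} (he : 0 ≤ e) (hea : e < a) (hab : a ≤ b)
    (h1 : a / (a + e) ≤ S1) (h2 : b / (b + e) ≤ S2) (h3 : (a + b) / (a + b - e) ≤ S3) :
    5 / 2 ≤ S1 + S2 + S3 := by
  have ha : 0 < a := by linarith
  have hb : 0 < b := by linarith
  have hp : 0 < a + b - e := by linarith
  have e1 : a / (a + e) = 1 - e / (a + e) := by field_simp; ring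
  have e2 : b / (b + e) = 1 - e / (b + e) := by field_simp; ring
  have e3 : (a + b) / (a + b - e) = 1 + e / (a + b - e) := by field_simp; ring
  suffices e / (a + e) + e / (b + e) - e / (a + b - e) ≤ 1 / 2 by linarith
  have h4 : e / (b + e) - e / (a + b - e) = e * (a - 2 * e) / ((b + e) * (a + b - e)) := by
    field_simp; ring
  have h5 : 1 / 2 - e / (a + e) = (a - e) / (2 * (a + e)) := by field_simp; ring
  suffices e * (a - 2 * e) / ((b + e) * (a + b - e)) ≤ (a - e) / (2 * (a + e)) by linarith
  have hR : 0 ≤ (a - e) / (2 * (a + e)) := div_nonneg (by linarith) (by linarith)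
  rcases le_total a (2 * e) with h | h
  · exact le_trans (div_nonpos_of_nonpos_of_nonneg
      (mul_nonpos_of_nonneg_of_nonpos he (by linarith)) (by positivity)) hR
  · rw [div_le_div_iff₀ (by positivity) (by positivity)]
    have i1 : e * (2 * (a + e)) ≤ (b + e) * (a + b - e) := by nlinarith
    calc e * (a - 2 * e) * (2 * (a + e)) = (a - 2 * e) * (e * (2 * (a + e))) := by ring
      _ ≤ (a - e) * ((b + e) * (a + b - e)) := by
        apply mul_le_mul (by linarith) i1 (by positivity) (by linarith)

/-! ### The paired equations and the region where they force equality. -/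

open Real in
/-- The equation satisfied by the scaled half difference `D` and half sum `S` of a pair of
coordinates `(xᵢ, yᵢ)` of a critical point. -/
def IsPairing (k e γ D S : ℝ) : Prop :=
  0 < S ∧ D * cosh (D + e) = S * sinh (D + e) ∧ log (S / cosh (D + e)) - k * S = γ

namespace IsPairing

variable {k e γ D S : ℝ}

-- Exchanging the two components changes the signs of D and e, so e ≥ 0 may be assumed.
open Real in
theorem neg (h : IsPairing k e γ D S) : IsPairing k (-e) γ (-D) S := by
  obtain ⟨h1, h2, h3⟩ := h
  have : -D + -e = -(D + e) := by ring
  refine ⟨h1, ?_, ?_⟩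
  · rw [this, cosh_neg, sinh_neg]; linarith
  · rw [this, cosh_neg]; exact h3

open Real in
theorem div_le (h : IsPairing k e γ D S) (he : 0 ≤ e) (hD : 0 < D) : D / (D + e) ≤ S := by
  obtain ⟨h1, h2, -⟩ := h
  have hp : 0 < D + e := by linarith
  rw [div_le_iff₀ hp]
  have h3 := mul_lt_mul_of_pos_left (sinh_lt_mul_cosh hp) h1
  have h4 := cosh_pos (D + e)
  have : D * cosh (D + e) < S * (D + e) * cosh (D + e) := by rw [h2]; linarith
  exact (lt_of_mul_lt_mul_right this h4.le).le

-- The equation reads S = D coth(D + e), and coth r > 1/r for r > 0.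
open Real in
theorem add_neg (h : IsPairing k e γ D S) (hD : D < 0) : D + e < 0 := by
  obtain ⟨h1, h2, -⟩ := h
  by_contra hc
  have h3 : 0 ≤ S * sinh (D + e) := mul_nonneg h1.le (sinh_nonneg_iff.2 (not_lt.1 hc))
  have h4 := mul_neg_of_neg_of_pos hD (cosh_pos (D + e))
  linarith

open Real in
theorem div_le_of_neg (h : IsPairing k e γ D S) (hD : D < 0) : -D / (-D - e) ≤ S := by
  have hn := h.add_neg hD
  obtain ⟨h1, h2, -⟩ := h
  have hp : 0 < -D - e := by linarith
  rw [div_le_iff₀ hp]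
  have h3 := mul_lt_mul_of_pos_left (sinh_lt_mul_cosh hp) h1
  have h4 := cosh_pos (-D - e)
  have : -D * cosh (-D - e) = S * sinh (-D - e) := by
    rw [show -D - e = -(D + e) by ring, cosh_neg, sinh_neg]; linarith
  have : -D * cosh (-D - e) < S * (-D - e) * cosh (-D - e) := by rw [this]; linarith
  exact (lt_of_mul_lt_mul_right this h4.le).le

open Real in
theorem le_log (h : IsPairing k e γ D S) : γ ≤ log S - k * S := by
  obtain ⟨h1, -, h3⟩ := h
  rw [← h3]
  have : log (S / cosh (D + e)) ≤ log S :=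
    log_le_log (div_pos h1 (cosh_pos _)) (div_le_self h1.le (one_le_cosh _))
  linarith

end IsPairing

open Real in
/-- The parameter region in which the two components cannot be desynchronized. -/
structure Coupled (k m : ℝ) : Prop where
  one_lt : 1 < k
  two_lt : 2 < m
  sub_le : m - 2 ≤ 2 / (3 * k + 1)
  log_add_neg : log (m - 2) + k * (3 - m) < 0

namespace Coupled

variable {k m e γ D1 D2 D3 S1 S2 S3 : ℝ}

theorem lt_five_halves (h : Coupled k m) : m < 5 / 2 := by
  have h1 := h.one_lt
  have : 2 / (3 * k + 1) < 1 / 2 := by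
    rw [div_lt_div_iff₀ (by linarith) (by norm_num)]; linarith
  linarith [h.sub_le]

/-- Each negative difference contributes S ≥ 1, and since -D₂ ≤ D₁ the excess of S₂ over 1 makes up
for the deficit of S₁. The sum is at least 3, exceeding m. -/
theorem false_of_pos_neg_neg (h : Coupled k m) (he : 0 ≤ e) (h1 : IsPairing k e γ D1 S1)
    (h2 : IsPairing k e γ D2 S2) (h3 : IsPairing k e γ D3 S3) (hD : D1 + D2 + D3 = 0)
    (hS : S1 + S2 + S3 = m) (p1 : 0 < D1) (n2 : D2 < 0) (n3 : D3 < 0) : False := by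
  have a1 := h1.div_le he p1
  have a2 := h2.div_le_of_neg n2
  have a3 := h3.div_le_of_neg n3
  have q2 := h2.add_neg n2
  have q3 := h3.add_neg n3
  have e1 : D1 / (D1 + e) = 1 - e / (D1 + e) := by
    have : D1 + e ≠ 0 := by linarith
    field_simp; ring
  have e2 : -D2 / (-D2 - e) = 1 + e / (-D2 - e) := by
    have : -D2 - e ≠ 0 := by linarith
    field_simp; ring
  have e3 : -D3 / (-D3 - e) = 1 + e / (-D3 - e) := by
    have : -D3 - e ≠ 0 := by linarith
    field_simp; ring
  have b3 : 0 ≤ e / (-D3 - e) := div_nonneg he (by linarith)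
  have b2 : e / (D1 + e) ≤ e / (-D2 - e) :=
    div_le_div_of_nonneg_left he (by linarith) (by linarith)
  linarith [h.lt_five_halves]

-- The smaller nonnegative difference is compared with e: below it the widened-gap argument applies,
-- above it the bound 5/2.
open Real in
theorem false_of_le (h : Coupled k m) (he : 0 ≤ e) (h1 : IsPairing k e γ D1 S1)
    (h2 : IsPairing k e γ D2 S2) (h3 : IsPairing k e γ D3 S3) (hD : D1 + D2 + D3 = 0)
    (hS : S1 + S2 + S3 = m) (p1 : 0 ≤ D1) (p2 : 0 < D2) (n3 : D3 < 0) (hle : D1 ≤ D2) :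
    False := by
  have q3 := h3.add_neg n3
  rcases le_or_gt D1 e with hc | hc
  · have e3 : D3 = -(D1 + D2) := by linarith
    obtain ⟨-, h3b, h3c⟩ := h3
    obtain ⟨-, h2b, h2c⟩ := h2
    have e4 : D3 + e = -(D1 + D2 - e) := by linarith
    rw [e4, cosh_neg, sinh_neg, e3] at h3b
    rw [e4, cosh_neg] at h3c
    exact false_of_opposite_pair h.one_lt h.two_lt h.sub_le h.log_add_neg p1 hc p2 (by linarith)
      h1.1 h2b (by linarith) hS h1.le_log h2c h3c
  · have a1 := h1.div_le he (by linarith)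
    have a2 := h2.div_le he p2
    have a3 := h3.div_le_of_neg n3
    rw [show -D3 = D1 + D2 by linarith] at a3
    linarith [sum_ge_of_two_pos he hc hle a1 a2 a3, h.lt_five_halves]

theorem false_of_pos_pos_neg (h : Coupled k m) (he : 0 ≤ e) (h1 : IsPairing k e γ D1 S1)
    (h2 : IsPairing k e γ D2 S2) (h3 : IsPairing k e γ D3 S3) (hD : D1 + D2 + D3 = 0)
    (hS : S1 + S2 + S3 = m) (p1 : 0 < D1) (p2 : 0 < D2) (n3 : D3 < 0) : False := by
  rcases le_total D1 D2 with hle | hle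
  · exact h.false_of_le he h1 h2 h3 hD hS p1.le p2 n3 hle
  · exact h.false_of_le he h2 h1 h3 (by linarith) (by linarith) p2.le p1 n3 hle

theorem eq_zero_of_nonneg (h : Coupled k m) (he : 0 ≤ e) (h1 : IsPairing k e γ D1 S1)
    (h2 : IsPairing k e γ D2 S2) (h3 : IsPairing k e γ D3 S3) (hD : D1 + D2 + D3 = 0)
    (hS : S1 + S2 + S3 = m) : D1 = 0 ∧ D2 = 0 ∧ D3 = 0 := by
  have key : ∀ {A B S S' S'' : ℝ}, IsPairing k e γ 0 S → IsPairing k e γ A S' →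
      IsPairing k e γ B S'' → A + B = 0 → S + S' + S'' = m → A = 0 := by
    intro A B S S' S'' g1 g2 g3 gD gS
    rcases lt_trichotomy A 0 with hA | hA | hA
    · exact (h.false_of_le he g1 g3 g2 (by linarith) (by linarith) le_rfl (by linarith) hA
        (by linarith)).elim
    · exact hA
    · exact (h.false_of_le he g1 g2 g3 (by linarith) (by linarith) le_rfl hA (by linarith)
        hA.le).elim
  rcases lt_trichotomy D1 0 with a | a | a
  · rcases lt_trichotomy D2 0 with b | b | b
    · exact (h.false_of_pos_neg_neg he h3 h1 h2 (by linarith) (by linarith) (by linarith)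
        a b).elim
    · subst b
      exact absurd (key h2 h1 h3 (by linarith) (by linarith)) a.ne
    · rcases lt_trichotomy D3 0 with c | c | c
      · exact (h.false_of_pos_neg_neg he h2 h1 h3 (by linarith) (by linarith) b a c).elim
      · subst c
        exact absurd (key h3 h1 h2 (by linarith) (by linarith)) a.ne
      · exact (h.false_of_pos_pos_neg he h2 h3 h1 (by linarith) (by linarith) b c a).elim
  · subst a
    have := key h1 h2 h3 (by linarith) (by linarith)
    exact ⟨rfl, this, by linarith⟩
  · rcases lt_trichotomy D2 0 with b | b | b
    · rcases lt_trichotomy D3 0 with c | c | c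
      · exact (h.false_of_pos_neg_neg he h1 h2 h3 (by linarith) (by linarith) a b c).elim
      · subst c
        exact absurd (key h3 h1 h2 (by linarith) (by linarith)) a.ne'
      · exact (h.false_of_pos_pos_neg he h1 h3 h2 (by linarith) (by linarith) a c b).elim
    · subst b
      exact absurd (key h2 h1 h3 (by linarith) (by linarith)) a.ne'
    · exact (h.false_of_pos_pos_neg he h1 h2 h3 hD hS a b (by linarith)).elim

theorem eq_zero (h : Coupled k m) (h1 : IsPairing k e γ D1 S1)
    (h2 : IsPairing k e γ D2 S2) (h3 : IsPairing k e γ D3 S3) (hD : D1 + D2 + D3 = 0)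
    (hS : S1 + S2 + S3 = m) : D1 = 0 ∧ D2 = 0 ∧ D3 = 0 := by
  rcases le_total 0 e with he | he
  · exact h.eq_zero_of_nonneg he h1 h2 h3 hD hS
  · have := h.eq_zero_of_nonneg (neg_nonneg.2 he) h1.neg h2.neg h3.neg (by linarith) hS
    simpa using this

end Coupled

-- With r half of log x - log y, one has tanh r = (x - y)/(x + y) and √(xy) = (x + y)/(2 cosh r);
-- these turn the difference and sum equations into the pairing equations.
open Real in
theorem isPairing_of_log_eq {k m b c x y : ℝ} (hx : 0 < x) (hy : 0 < y) (hm : 0 < m)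
    (h1 : log x - log y = m * (x - y) + 2 * b)
    (h2 : log x + log y = k * m * (x + y) + 2 * c) :
    IsPairing k b (c + log m) (m * (x - y) / 2) (m * (x + y) / 2) := by
  have hr : m * (x - y) / 2 + b = (log x - log y) / 2 := by linarith
  set r := (log x - log y) / 2 with hrdef
  have hp : exp r * exp r = x / y := by
    rw [← exp_add, show r + r = log x - log y by rw [hrdef]; ring, exp_sub, exp_log hx, exp_log hy]
  have hn : exp (-r) = (exp r)⁻¹ := exp_neg r
  have hE := exp_pos r
  have hxy : exp r * exp r * y = x := by rw [hp]; field_simp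
  have hcosh : cosh r = (x + y) / (2 * (exp r * y)) := by
    rw [cosh_eq, hn]; field_simp; linear_combination hxy
  have hsinh : sinh r = (x - y) / (2 * (exp r * y)) := by
    rw [sinh_eq, hn]; field_simp; linear_combination hxy
  refine ⟨by positivity, ?_, ?_⟩
  · rw [hr, hcosh, hsinh]; field_simp
  · rw [hr, hcosh]
    have : m * (x + y) / 2 / ((x + y) / (2 * (exp r * y))) = m * (exp r * y) := by
      field_simp
    rw [this, log_mul hm.ne' (by positivity), log_mul hE.ne' hy.ne', log_exp, hrdef]
    linarith

open Real in
/-- A pair of probability vectors solving the critical equations of the coupled model in the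
coupled region is synchronized. -/
theorem eq_of_log_eq_of_coupled {k m b c : ℝ} {x y : Fin 3 → ℝ} (h : Coupled k m)
    (hx : ∀ i, 0 < x i) (hy : ∀ i, 0 < y i) (sx : ∑ i, x i = 1) (sy : ∑ i, y i = 1)
    (h1 : ∀ i, log (x i) - log (y i) = m * (x i - y i) + 2 * b)
    (h2 : ∀ i, log (x i) + log (y i) = k * m * (x i + y i) + 2 * c) : x = y := by
  have hm : 0 < m := by linarith [h.two_lt]
  have hp := fun i => isPairing_of_log_eq (hx i) (hy i) hm (h1 i) (h2 i)
  rw [Fin.sum_univ_three] at sx sy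
  obtain ⟨a0, a1, a2⟩ := h.eq_zero (hp 0) (hp 1) (hp 2)
    (by linear_combination (m / 2) * sx - (m / 2) * sy)
    (by linear_combination (m / 2) * sx + (m / 2) * sy)
  have hz : ∀ {u v : ℝ}, m * (u - v) / 2 = 0 → u = v := by
    intro u v huv
    have : u - v = 0 := by
      rcases mul_eq_zero.1 (show m * (u - v) = 0 by linarith) with h | h
      · linarith
      · exact h
    linarith
  funext i
  fin_cases i
  · exact hz a0
  · exact hz a1
  · exact hz a2

/-! ### The case m ≤ 2. -/

-- The logarithmic mean is smaller than the arithmetic mean: with r = (log u - log v)/2 this is sinh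
-- r < r cosh r.
open Real in
theorem two_mul_sq_lt_mul_log {u v : ℝ} (hu : 0 < u) (hv : 0 < v) (huv : u ≠ v) :
    2 * (u - v) ^ 2 < (u + v) * ((u - v) * (log u - log v)) := by
  have key : ∀ {u v : ℝ}, 0 < v → v < u → 2 * (u - v) < (u + v) * (log u - log v) := by
    intro u v hv huv
    have hu : 0 < u := hv.trans huv
    have hr : 0 < (log u - log v) / 2 := by
      have := log_lt_log hv huv
      linarith
    set r := (log u - log v) / 2 with hrdef
    have hp : exp r * exp r = u / v := by
      rw [← exp_add, show r + r = log u - log v by rw [hrdef]; ring, exp_sub, exp_log hu,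
        exp_log hv]
    have hn : exp (-r) = (exp r)⁻¹ := exp_neg r
    have hE := exp_pos r
    have hxy : exp r * exp r * v = u := by rw [hp]; field_simp
    have hcosh : cosh r = (u + v) / (2 * (exp r * v)) := by
      rw [cosh_eq, hn]; field_simp; linear_combination hxy
    have hsinh : sinh r = (u - v) / (2 * (exp r * v)) := by
      rw [sinh_eq, hn]; field_simp; linear_combination hxy
    have := sinh_lt_mul_cosh hr
    rw [hcosh, hsinh, mul_div_assoc', div_lt_div_iff_of_pos_right (by positivity)] at this
    rw [show log u - log v = 2 * r by rw [hrdef]; ring]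
    linarith
  rcases lt_trichotomy u v with h | h | h
  · nlinarith [key hu h]
  · exact absurd h huv
  · nlinarith [key hv h]

-- Pair the equation with x - y and let T = Σ|xᵢ - yᵢ|. The logarithmic side exceeds Σ
-- 2(xᵢ-yᵢ)²/(xᵢ+yᵢ) ≥ T². The other side is m Σ(xᵢ-yᵢ)² ≤ mT²/2, because a sum-zero vector has each
-- |xᵢ-yᵢ| ≤ T/2.
open Real in
theorem eq_of_log_eq_of_le_two {m δ : ℝ} {x y : Fin 3 → ℝ} (hm : m ≤ 2)
    (hx : ∀ i, 0 < x i) (hy : ∀ i, 0 < y i) (sx : ∑ i, x i = 1) (sy : ∑ i, y i = 1)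
    (h1 : ∀ i, log (x i) - log (y i) = m * (x i - y i) + δ) : x = y := by
  by_contra hne
  obtain ⟨j, hj⟩ := Function.ne_iff.1 hne
  set T := ∑ i, |x i - y i| with hT
  -- Cauchy–Schwarz in linearized form: these lower bounds sum to 2T² - T² = T².
  have hsq : ∀ i, 2 * T * |x i - y i| - T ^ 2 / 2 * (x i + y i) ≤
      2 * (x i - y i) ^ 2 / (x i + y i) := by
    intro i
    have hs : 0 < x i + y i := add_pos (hx i) (hy i)
    rw [le_div_iff₀ hs, ← sq_abs (x i - y i)]
    nlinarith [sq_nonneg (2 * |x i - y i| - T * (x i + y i))]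
  have hlt : ∀ i, x i ≠ y i → 2 * (x i - y i) ^ 2 / (x i + y i) <
      (x i - y i) * (log (x i) - log (y i)) := by
    intro i hi
    have hs : 0 < x i + y i := add_pos (hx i) (hy i)
    rw [div_lt_iff₀ hs]
    linarith [two_mul_sq_lt_mul_log (hx i) (hy i) hi]
  have hle : ∀ i, 2 * (x i - y i) ^ 2 / (x i + y i) ≤
      (x i - y i) * (log (x i) - log (y i)) := by
    intro i
    by_cases hi : x i = y i
    · simp [hi]
    · exact (hlt i hi).le
  have hsum : ∑ i, (2 * T * |x i - y i| - T ^ 2 / 2 * (x i + y i)) <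
      ∑ i, (x i - y i) * (log (x i) - log (y i)) :=
    Finset.sum_lt_sum (fun i _ => (hsq i).trans (hle i))
      ⟨j, Finset.mem_univ j, (hsq j).trans_lt (hlt j hj)⟩
  rw [Finset.sum_sub_distrib, ← Finset.mul_sum, ← Finset.mul_sum, Finset.sum_add_distrib, ← hT,
    sx, sy] at hsum
  have hR : ∑ i, (x i - y i) * (log (x i) - log (y i)) = m * ∑ i, |x i - y i| ^ 2 := by
    have : ∀ i, (x i - y i) * (log (x i) - log (y i)) =
        m * |x i - y i| ^ 2 + δ * (x i - y i) := by
      intro i; rw [h1 i, sq_abs]; ring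
    rw [Finset.sum_congr rfl fun i _ => this i, Finset.sum_add_distrib, ← Finset.mul_sum,
      ← Finset.mul_sum, Finset.sum_sub_distrib, sx, sy]
    ring
  have hmax : ∀ i, 2 * |x i - y i| ≤ T := by
    have hd : x 0 - y 0 + (x 1 - y 1) + (x 2 - y 2) = 0 := by
      rw [Fin.sum_univ_three] at sx sy; linarith
    have e0 : |x 0 - y 0| ≤ |x 1 - y 1| + |x 2 - y 2| := by
      rw [show x 0 - y 0 = -((x 1 - y 1) + (x 2 - y 2)) by linarith, abs_neg]
      exact abs_add_le _ _
    have e1 : |x 1 - y 1| ≤ |x 0 - y 0| + |x 2 - y 2| := by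
      rw [show x 1 - y 1 = -((x 0 - y 0) + (x 2 - y 2)) by linarith, abs_neg]
      exact abs_add_le _ _
    have e2 : |x 2 - y 2| ≤ |x 0 - y 0| + |x 1 - y 1| := by
      rw [show x 2 - y 2 = -((x 0 - y 0) + (x 1 - y 1)) by linarith, abs_neg]
      exact abs_add_le _ _
    rw [Fin.sum_univ_three] at hT
    intro i
    fin_cases i <;> simp only [Fin.zero_eta, Fin.mk_one, Fin.reduceFinMk] <;> linarith
  have hTT : 2 * ∑ i, |x i - y i| ^ 2 ≤ T * T := by
    rw [Finset.mul_sum]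
    nth_rw 2 [hT]
    rw [Finset.mul_sum]
    refine Finset.sum_le_sum fun i _ => ?_
    nlinarith [hmax i, abs_nonneg (x i - y i)]
  have hnn : 0 ≤ ∑ i, |x i - y i| ^ 2 := Finset.sum_nonneg fun i _ => sq_nonneg _
  rw [hR] at hsum
  nlinarith

/-! ### The reciprocal logarithmic mean and the convexity of ξ. -/

/-- The reciprocal of the logarithmic mean of two positive numbers. -/
noncomputable def ell (a b : ℝ) : ℝ := ∫ t in (0 : ℝ)..1, 1 / ((1 - t) * a + t * b)

theorem combo_pos {a b t : ℝ} (ha : 0 < a) (hb : 0 < b) (ht : t ∈ Set.Icc (0 : ℝ) 1) :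
    0 < (1 - t) * a + t * b := by
  rcases eq_or_lt_of_le ht.1 with h | h
  · simp [← h, ha]
  · have h1 := mul_nonneg (sub_nonneg.2 ht.2) ha.le
    have h2 := mul_pos h hb
    linarith

theorem continuousOn_ell_integrand {a b : ℝ} (ha : 0 < a) (hb : 0 < b) :
    ContinuousOn (fun t : ℝ => 1 / ((1 - t) * a + t * b)) (Set.Icc 0 1) :=
  ContinuousOn.div (by fun_prop) (by fun_prop) fun _ ht => (combo_pos ha hb ht).ne'

theorem intervalIntegrable_ell {a b : ℝ} (ha : 0 < a) (hb : 0 < b) :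
    IntervalIntegrable (fun t : ℝ => 1 / ((1 - t) * a + t * b)) MeasureTheory.volume 0 1 :=
  ContinuousOn.intervalIntegrable_of_Icc zero_le_one (continuousOn_ell_integrand ha hb)

theorem sub_mul_ell {a b : ℝ} (ha : 0 < a) (hb : 0 < b) :
    (b - a) * ell a b = Real.log b - Real.log a := by
  have h := intervalIntegral.integral_eq_sub_of_hasDerivAt
    (f := fun t : ℝ => Real.log ((1 - t) * a + t * b))
    (f' := fun t : ℝ => (b - a) * (1 / ((1 - t) * a + t * b))) (a := 0) (b := 1) ?_ ?_
  · rw [intervalIntegral.integral_const_mul] at h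
    rw [ell, h]
    simp
  · intro t ht
    rw [Set.uIcc_of_le zero_le_one] at ht
    have h1 : HasDerivAt (fun t : ℝ => (1 - t) * a + t * b) ((0 - 1) * a + 1 * b) t :=
      (((hasDerivAt_const t 1).sub (hasDerivAt_id t)).mul_const a).add
        ((hasDerivAt_id t).mul_const b)
    exact (h1.log (combo_pos ha hb ht).ne').congr_deriv (by ring)
  · exact (intervalIntegrable_ell ha hb).const_mul _

theorem ell_smul (a b c : ℝ) : ell (c * a) (c * b) = 1 / c * ell a b := by
  rw [ell, ell, ← intervalIntegral.integral_const_mul]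
  congr 1
  funext t
  rw [show (1 - t) * (c * a) + t * (c * b) = c * ((1 - t) * a + t * b) by ring, one_div_mul_one_div]

/-- Jensen's inequality for the reciprocal of the logarithmic mean. -/
theorem mul_ell_le_sum {w a b : Fin 3 → ℝ} {A B : ℝ} (hw : ∀ i, 0 ≤ w i) (ha : ∀ i, 0 < a i)
    (hb : ∀ i, 0 < b i) (hA : 0 < A) (hB : 0 < B) (hwA : ∑ i, w i * a i = (∑ i, w i) * A)
    (hwB : ∑ i, w i * b i = (∑ i, w i) * B) :
    (∑ i, w i) * ell A B ≤ ∑ i, w i * ell (a i) (b i) := by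
  have e : ∑ i, w i * ell (a i) (b i) =
      ∫ t in (0 : ℝ)..1, ∑ i, w i * (1 / ((1 - t) * a i + t * b i)) := by
    rw [intervalIntegral.integral_finsetSum fun i _ =>
      (intervalIntegrable_ell (ha i) (hb i)).const_mul _]
    exact Finset.sum_congr rfl fun i _ => (intervalIntegral.integral_const_mul _ _).symm
  rw [e, ell, ← intervalIntegral.integral_const_mul]
  refine intervalIntegral.integral_mono_on zero_le_one
    ((intervalIntegrable_ell hA hB).const_mul _) ?_ ?_
  · exact ContinuousOn.intervalIntegrable_of_Icc zero_le_one (continuousOn_finsetSum _ fun i _ =>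
      (continuousOn_ell_integrand (ha i) (hb i)).const_mul (w i))
  · intro t ht
    set c := (1 - t) * A + t * B with hc
    have hcp : 0 < c := combo_pos hA hB ht
    -- The tangent line of 1/u at the weighted average c lies below the graph.
    have h1 : ∀ i, w i * (2 / c - ((1 - t) * a i + t * b i) / c ^ 2) ≤
        w i * (1 / ((1 - t) * a i + t * b i)) := by
      intro i
      refine mul_le_mul_of_nonneg_left ?_ (hw i)
      have hu := combo_pos (ha i) (hb i) ht
      set u := (1 - t) * a i + t * b i
      rw [← sub_nonneg]
      have : 1 / u - (2 / c - u / c ^ 2) = (u - c) ^ 2 / (u * c ^ 2) := by field_simp; ring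
      rw [this]
      positivity
    refine le_trans (le_of_eq ?_) (Finset.sum_le_sum fun i _ => h1 i)
    have h2 : ∑ i, w i * (2 / c - ((1 - t) * a i + t * b i) / c ^ 2) =
        (∑ i, w i) * (2 / c) - ((1 - t) * ∑ i, w i * a i + t * ∑ i, w i * b i) / c ^ 2 := by
      simp only [Fin.sum_univ_three]
      field_simp
      ring
    rw [h2, hwA, hwB, show (1 - t) * ((∑ i, w i) * A) + t * ((∑ i, w i) * B) =
      (∑ i, w i) * c by rw [hc]; ring]
    field_simp
    ring

/-- The integral form absorbs the removable singularity at 1/3. -/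
theorem xi_eq_ell {x : ℝ} (hx : x ∈ Set.Ioo (0 : ℝ) (1 / 2)) : xi x = ell x (1 - 2 * x) := by
  have h2 : 0 < 1 - 2 * x := by linarith [hx.2]
  unfold xi
  split_ifs with h
  · subst h
    rw [ell]
    have : ∀ t : ℝ, 1 / ((1 - t) * (1 / 3) + t * (1 - 2 * (1 / 3))) = 3 := by
      intro t; rw [show (1 - t) * (1 / 3) + t * (1 - 2 * (1 / 3)) = (1 / 3 : ℝ) by ring]; norm_num
    simp only [this]
    simp
  · have h3 : 1 - 3 * x ≠ 0 := fun h4 => h (by linarith)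
    have := sub_mul_ell hx.1 h2
    rw [Real.log_div h2.ne' hx.1.ne', ← this]
    field_simp
    ring

/-- For each t the integrand is the reciprocal of a positive affine function of x, hence convex in
x. -/
theorem strictConvexOn_xi : StrictConvexOn ℝ (Set.Ioo (0 : ℝ) (1 / 2)) xi := by
  refine ⟨convex_Ioo _ _, ?_⟩
  intro x hx y hy hxy a b ha hb hab
  have hz : a • x + b • y ∈ Set.Ioo (0 : ℝ) (1 / 2) := convex_Ioo 0 (1 / 2) hx hy ha.le hb.le hab
  rw [xi_eq_ell hx, xi_eq_ell hy, xi_eq_ell hz]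
  have hx2 : 0 < 1 - 2 * x := by linarith [hx.2]
  have hy2 : 0 < 1 - 2 * y := by linarith [hy.2]
  have hz2 : 0 < 1 - 2 * (a • x + b • y) := by linarith [hz.2]
  have e : a • ell x (1 - 2 * x) + b • ell y (1 - 2 * y) = ∫ t in (0 : ℝ)..1,
      (a * (1 / ((1 - t) * x + t * (1 - 2 * x))) + b * (1 / ((1 - t) * y + t * (1 - 2 * y)))) := by
    rw [intervalIntegral.integral_add ((intervalIntegrable_ell hx.1 hx2).const_mul _)
      ((intervalIntegrable_ell hy.1 hy2).const_mul _), intervalIntegral.integral_const_mul,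
      intervalIntegral.integral_const_mul]
    rfl
  have key : ∀ t ∈ Set.Icc (0 : ℝ) 1, a * (1 / ((1 - t) * x + t * (1 - 2 * x))) +
      b * (1 / ((1 - t) * y + t * (1 - 2 * y))) -
      1 / ((1 - t) * (a • x + b • y) + t * (1 - 2 * (a • x + b • y))) =
      a * b * ((1 - 3 * t) * (x - y)) ^ 2 / (((1 - t) * x + t * (1 - 2 * x)) *
        ((1 - t) * y + t * (1 - 2 * y)) *
        ((1 - t) * (a • x + b • y) + t * (1 - 2 * (a • x + b • y)))) := by
    intro t ht
    have u1 := combo_pos hx.1 hx2 ht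
    have u2 := combo_pos hy.1 hy2 ht
    have u3 := combo_pos hz.1 hz2 ht
    have e3 : (1 - t) * (a • x + b • y) + t * (1 - 2 * (a • x + b • y)) =
        a * ((1 - t) * x + t * (1 - 2 * x)) + b * ((1 - t) * y + t * (1 - 2 * y)) := by
      simp only [smul_eq_mul]; linear_combination (-t) * hab
    rw [e3] at u3 ⊢
    have e4 : (1 - 3 * t) * (x - y) =
      ((1 - t) * x + t * (1 - 2 * x)) - ((1 - t) * y + t * (1 - 2 * y)) := by ring
    rw [e4]
    generalize (1 - t) * x + t * (1 - 2 * x) = u at *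
    generalize (1 - t) * y + t * (1 - 2 * y) = v at *
    have hb' : b = 1 - a := by linarith
    subst hb'
    field_simp
    ring
  rw [e, ell]
  refine intervalIntegral.integral_lt_integral_of_continuousOn_of_le_of_exists_lt zero_lt_one
    (continuousOn_ell_integrand hz.1 hz2)
    (((continuousOn_ell_integrand hx.1 hx2).const_mul _).add
      ((continuousOn_ell_integrand hy.1 hy2).const_mul _)) ?_ ?_
  · intro t ht
    have ht' : t ∈ Set.Icc (0 : ℝ) 1 := ⟨ht.1.le, ht.2⟩
    have := key t ht'
    have u1 := combo_pos hx.1 hx2 ht'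
    have u2 := combo_pos hy.1 hy2 ht'
    have u3 := combo_pos hz.1 hz2 ht'
    rw [← sub_nonneg, this]
    positivity
  -- At t = 1/3 the integrand does not depend on x, so strictness is checked at t = 0, where it is
  -- 1/x.
  · refine ⟨0, by simp, ?_⟩
    rw [← sub_pos, key 0 (by simp)]
    have hz1 := hz.1
    have : x - y ≠ 0 := sub_ne_zero.2 hxy
    have hx1 := hx.1
    have hy1 := hy.1
    simp only [mul_zero, sub_zero, one_mul, zero_mul, add_zero]
    positivity

/-! ### Shape of ξ, its minimum β₁ and the roots x_s, x_l. -/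

theorem continuousOn_xi : ContinuousOn xi (Set.Ioo 0 (1 / 2)) :=
  strictConvexOn_xi.convexOn.continuousOn isOpen_Ioo

theorem xi_one_third : xi (1 / 3) = 3 := by simp [xi]

theorem one_sub_mul_xi {x : ℝ} (hx : x ∈ Set.Ioo (0 : ℝ) (1 / 2)) :
    (1 - 3 * x) * xi x = Real.log (1 - 2 * x) - Real.log x := by
  rw [xi_eq_ell hx, ← sub_mul_ell hx.1 (by linarith [hx.2])]
  ring

theorem xi_pos {x : ℝ} (hx : x ∈ Set.Ioo (0 : ℝ) (1 / 2)) : 0 < xi x := by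
  have h2 : 0 < 1 - 2 * x := by linarith [hx.2]
  rw [xi_eq_ell hx, ell]
  exact intervalIntegral.intervalIntegral_pos_of_pos_on (intervalIntegrable_ell hx.1 h2)
    (fun t ht => one_div_pos.2 (combo_pos hx.1 h2 ⟨ht.1.le, ht.2.le⟩)) zero_lt_one

theorem bddBelow_xi : BddBelow (xi '' Set.Ioo 0 (1 / 2)) :=
  ⟨0, by rintro _ ⟨x, hx, rfl⟩; exact (xi_pos hx).le⟩

theorem beta1_le_xi {x : ℝ} (hx : x ∈ Set.Ioo (0 : ℝ) (1 / 2)) : beta1 ≤ xi x :=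
  csInf_le bddBelow_xi ⟨x, hx, rfl⟩

theorem beta1_lt_three : beta1 < 3 := by
  refine (beta1_le_xi (x := 1 / 4) (by constructor <;> norm_num)).trans_lt ?_
  have h := one_sub_mul_xi (x := 1 / 4) (by constructor <;> norm_num)
  rw [← Real.log_div (by norm_num) (by norm_num)] at h
  norm_num at h
  have := Real.log_two_lt_d9
  linarith

/-- The comparison of means for x and 1 - 2x gives ξ(x) > 2/(1-x), which exceeds 3 beyond 1/3. -/
theorem three_lt_xi {x : ℝ} (hx : x ∈ Set.Ioo (1 / 3 : ℝ) (1 / 2)) : 3 < xi x := by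
  have hx0 : 0 < x := by linarith [hx.1]
  have h2 : 0 < 1 - 2 * x := by linarith [hx.2]
  have h := one_sub_mul_xi (x := x) ⟨hx0, hx.2⟩
  have hl := two_mul_sq_lt_mul_log (u := x) (v := 1 - 2 * x) hx0 h2 (by linarith [hx.1])
  rw [show Real.log x - Real.log (1 - 2 * x) = (3 * x - 1) * xi x by linarith,
    show x - (1 - 2 * x) = 3 * x - 1 by ring, show x + (1 - 2 * x) = 1 - x by ring] at hl
  have hp : 0 < (3 * x - 1) ^ 2 := by have := hx.1; have : 0 < 3 * x - 1 := by linarith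
                                      positivity
  have : (3 * x - 1) ^ 2 * 2 < (3 * x - 1) ^ 2 * ((1 - x) * xi x) := by linarith
  have h3 := lt_of_mul_lt_mul_left this hp.le
  have := xi_pos (x := x) ⟨hx0, hx.2⟩
  nlinarith [hx.1]

theorem mul_xi_lt_one {x : ℝ} (hx : x ∈ Set.Ioo (0 : ℝ) (1 / 3)) : x * xi x < 1 := by
  have h2 : 0 < 1 - 2 * x := by linarith [hx.2]
  have h := one_sub_mul_xi (x := x) ⟨hx.1, by linarith [hx.2]⟩
  have h3 : 0 < 1 - 3 * x := by linarith [hx.2]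
  have hl := Real.log_lt_sub_one_of_pos (div_pos h2 hx.1)
    (by rw [Ne, div_eq_one_iff_eq hx.1.ne']; linarith)
  rw [Real.log_div h2.ne' hx.1.ne', ← h] at hl
  have : (1 - 3 * x) * (x * xi x) < (1 - 3 * x) * 1 := by
    have := mul_lt_mul_of_pos_left hl hx.1
    rw [mul_sub, mul_div_cancel₀ _ hx.1.ne'] at this
    linarith
  exact lt_of_mul_lt_mul_left this h3.le

theorem exists_le_xi_left (M : ℝ) : ∃ δ ∈ Set.Ioo (0 : ℝ) (1 / 3), ∀ x ∈ Set.Ioc 0 δ, M ≤ xi x := by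
  refine ⟨Real.exp (-|M|) / 6, ⟨by positivity, ?_⟩, ?_⟩
  · have : Real.exp (-|M|) ≤ 1 := Real.exp_le_one_iff.2 (by simp)
    linarith
  · intro x hx
    have hle : Real.exp (-|M|) ≤ 1 := Real.exp_le_one_iff.2 (by simp)
    have hx3 : x < 1 / 3 := by linarith [hx.2]
    have hx0 := hx.1
    have h := one_sub_mul_xi (x := x) ⟨hx.1, by linarith⟩
    have hl : |M| ≤ Real.log (1 - 2 * x) - Real.log x := by
      rw [← Real.log_div (by linarith) hx.1.ne', Real.le_log_iff_exp_le (div_pos (by linarith) hx.1),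
        le_div_iff₀ hx.1]
      have h1 : Real.exp |M| * x ≤ Real.exp |M| * (Real.exp (-|M|) / 6) :=
        mul_le_mul_of_nonneg_left hx.2 (Real.exp_pos _).le
      rw [mul_div_assoc', ← Real.exp_add, add_neg_cancel, Real.exp_zero] at h1
      linarith
    have := xi_pos (x := x) ⟨hx.1, by linarith⟩
    have := le_abs_self M
    nlinarith

theorem exists_le_xi_right {a : ℝ} (ha : a < 1 / 2) (M : ℝ) :
    ∃ x ∈ Set.Ioo a (1 / 2), x ∈ Set.Ioo (1 / 3 : ℝ) (1 / 2) ∧ M ≤ xi x := by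
  set c := min (Real.exp (-|M|) / 6) (1 / 4 - a / 2) with hc
  have hE := Real.exp_pos (-|M|)
  have hle : Real.exp (-|M|) ≤ 1 := Real.exp_le_one_iff.2 (by simp)
  have hcp : 0 < c := lt_min (by positivity) (by linarith)
  have hc1 : c ≤ Real.exp (-|M|) / 6 := min_le_left _ _
  have hc2 : c ≤ 1 / 4 - a / 2 := min_le_right _ _
  refine ⟨1 / 2 - c / 2, ⟨by linarith, by linarith⟩, ⟨by linarith, by linarith⟩, ?_⟩
  set x := 1 / 2 - c / 2 with hx
  have hxI : x ∈ Set.Ioo (0 : ℝ) (1 / 2) := ⟨by linarith, by linarith⟩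
  have h := one_sub_mul_xi hxI
  have e : 1 - 2 * x = c := by rw [hx]; ring
  rw [e] at h
  have hl : |M| ≤ Real.log x - Real.log c := by
    rw [← Real.log_div hxI.1.ne' hcp.ne', Real.le_log_iff_exp_le (div_pos hxI.1 hcp),
      le_div_iff₀ hcp]
    have h1 : Real.exp |M| * c ≤ Real.exp |M| * (Real.exp (-|M|) / 6) :=
      mul_le_mul_of_nonneg_left hc1 (Real.exp_pos _).le
    rw [mul_div_assoc', ← Real.exp_add, add_neg_cancel, Real.exp_zero] at h1
    linarith
  have := xi_pos hxI
  have := le_abs_self M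
  nlinarith [hxI.2]

theorem hasDerivAt_xi {x : ℝ} (hx : x ∈ Set.Ioo (0 : ℝ) (1 / 2)) (h3 : x ≠ 1 / 3) :
    HasDerivAt xi ((3 * xi x - 1 / (x * (1 - 2 * x))) / (1 - 3 * x)) x := by
  have h2 : 0 < 1 - 2 * x := by linarith [hx.2]
  have hx0 := hx.1
  have hne : 1 - 3 * x ≠ 0 := fun h4 => h3 (by linarith)
  have e : xi =ᶠ[nhds x] fun y => (Real.log (1 - 2 * y) - Real.log y) / (1 - 3 * y) := by
    filter_upwards [isOpen_Ioo.mem_nhds hx, isOpen_ne.mem_nhds h3] with y hy hy3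
    have : 1 - 3 * y ≠ 0 := fun h4 => hy3 (by linarith)
    rw [← one_sub_mul_xi hy]
    field_simp
  have d1 : HasDerivAt (fun y : ℝ => 1 - 2 * y) (-(2 * 1)) x :=
    ((hasDerivAt_id x).const_mul 2).const_sub 1
  have d2 : HasDerivAt (fun y : ℝ => 1 - 3 * y) (-(3 * 1)) x :=
    ((hasDerivAt_id x).const_mul 3).const_sub 1
  refine (((((d1.log h2.ne').sub (Real.hasDerivAt_log hx0.ne')).div d2 hne).congr_of_eventuallyEq
    e)).congr_deriv ?_
  simp only [Pi.sub_apply]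
  rw [← one_sub_mul_xi hx]
  field_simp
  ring

theorem exists_xi_eq_beta1 : ∃ x ∈ Set.Ioo (0 : ℝ) (1 / 3), xi x = beta1 := by
  obtain ⟨δ, hδ, hM⟩ := exists_le_xi_left 3
  have hsub : Set.Icc δ (1 / 3) ⊆ Set.Ioo (0 : ℝ) (1 / 2) :=
    fun x hx => ⟨hδ.1.trans_le hx.1, hx.2.trans_lt (by norm_num)⟩
  obtain ⟨x, hx, hmin⟩ := isCompact_Icc.exists_isMinOn (Set.nonempty_Icc.2 hδ.2.le)
    (continuousOn_xi.mono hsub)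
  have hx3 : xi x ≤ 3 := by
    have : xi x ≤ xi (1 / 3) := hmin (Set.right_mem_Icc.2 hδ.2.le)
    rwa [xi_one_third] at this
  have hall : ∀ y ∈ Set.Ioo (0 : ℝ) (1 / 2), xi x ≤ xi y := by
    intro y hy
    rcases le_or_gt y δ with h | h
    · exact hx3.trans (hM y ⟨hy.1, h⟩)
    · rcases le_or_gt y (1 / 3) with h' | h'
      · exact hmin ⟨h.le, h'⟩
      · exact hx3.trans (three_lt_xi ⟨h', hy.2⟩).le
  have heq : xi x = beta1 := le_antisymm
    (le_csInf ⟨_, ⟨1 / 3, by constructor <;> norm_num, rfl⟩⟩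
      (by rintro _ ⟨y, hy, rfl⟩; exact hall y hy)) (beta1_le_xi (hsub hx))
  refine ⟨x, ⟨(hsub hx).1, lt_of_le_of_ne hx.2 ?_⟩, heq⟩
  rintro rfl
  rw [xi_one_third] at heq
  linarith [beta1_lt_three]

theorem beta1_pos : 0 < beta1 := by
  obtain ⟨x, hx, h⟩ := exists_xi_eq_beta1
  rw [← h]
  exact xi_pos ⟨hx.1, by linarith [hx.2]⟩

theorem beta1_lt_xi {x y : ℝ} (hx : x ∈ Set.Ioo (0 : ℝ) (1 / 2)) (hy : y ∈ Set.Ioo (0 : ℝ) (1 / 2))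
    (hxy : x ≠ y) (h : xi x = beta1) : beta1 < xi y := by
  refine lt_of_le_of_ne (beta1_le_xi hy) fun he => ?_
  have h2 : (0 : ℝ) < 1 / 2 := by norm_num
  have hm := strictConvexOn_xi.2 hx hy hxy h2 h2 (by norm_num)
  have := beta1_le_xi (strictConvexOn_xi.1 hx hy h2.le h2.le (by norm_num))
  rw [h, ← he] at hm
  simp only [smul_eq_mul] at hm this
  linarith

/-- A root strictly between two others would have a strictly smaller value of ξ, by strict
convexity. -/
theorem eq_xs_or_eq_xl {β x : ℝ} (hx : x ∈ xiSolutions β) : x = xs β ∨ x = xl β := by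
  by_contra! hc
  have hb : BddBelow (xiSolutions β) := ⟨0, fun y hy => hy.1.1.le⟩
  have ha : BddAbove (xiSolutions β) := ⟨1 / 2, fun y hy => hy.1.2.le⟩
  have h1 : xs β < x := lt_of_le_of_ne (csInf_le hb hx) (Ne.symm hc.1)
  have h2 : x < xl β := lt_of_le_of_ne (le_csSup ha hx) hc.2
  obtain ⟨y, hy, hyx⟩ := exists_lt_of_csInf_lt ⟨x, hx⟩ h1
  obtain ⟨z, hz, hxz⟩ := exists_lt_of_lt_csSup ⟨x, hx⟩ h2
  have hseg : x ∈ openSegment ℝ y z := by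
    rw [openSegment_eq_Ioo (hyx.trans hxz)]; exact ⟨hyx, hxz⟩
  have := strictConvexOn_xi.lt_on_openSegment hy.1 hz.1 (hyx.trans hxz).ne hseg
  rw [hx.2, hy.2, hz.2, max_self] at this
  exact lt_irrefl _ this

theorem finite_xiSolutions (β : ℝ) : (xiSolutions β).Finite :=
  (Set.toFinite {xs β, xl β}).subset fun _ hx => eq_xs_or_eq_xl hx

theorem xs_mem {β : ℝ} (h : (xiSolutions β).Nonempty) : xs β ∈ xiSolutions β :=
  h.csInf_mem (finite_xiSolutions β)

theorem xl_mem {β : ℝ} (h : (xiSolutions β).Nonempty) : xl β ∈ xiSolutions β :=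
  h.csSup_mem (finite_xiSolutions β)

theorem le_xl {β x : ℝ} (hx : x ∈ xiSolutions β) : x ≤ xl β :=
  le_csSup ⟨1 / 2, fun _ hy => hy.1.2.le⟩ hx

theorem xs_le {β x : ℝ} (hx : x ∈ xiSolutions β) : xs β ≤ x :=
  csInf_le ⟨0, fun _ hy => hy.1.1.le⟩ hx

theorem exists_xi_eq_Icc {β a b : ℝ} (ha : 0 < a) (hab : a ≤ b) (hb : b < 1 / 2)
    (h : xi a ≤ β ∧ β ≤ xi b ∨ xi b ≤ β ∧ β ≤ xi a) : ∃ x ∈ Set.Icc a b, x ∈ xiSolutions β := by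
  have hsub : Set.Icc a b ⊆ Set.Ioo (0 : ℝ) (1 / 2) :=
    fun x hx => ⟨ha.trans_le hx.1, hx.2.trans_lt hb⟩
  have hc := continuousOn_xi.mono hsub
  rcases h with h | h
  · obtain ⟨x, hx, he⟩ := intermediate_value_Icc hab hc h
    exact ⟨x, hx, hsub hx, he⟩
  · obtain ⟨x, hx, he⟩ := intermediate_value_Icc' hab hc h
    exact ⟨x, hx, hsub hx, he⟩

theorem xiSolutions_nonempty {β : ℝ} (h : beta1 ≤ β) : (xiSolutions β).Nonempty := by
  obtain ⟨x0, hx0, he⟩ := exists_xi_eq_beta1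
  obtain ⟨δ, hδ, hM⟩ := exists_le_xi_left β
  set a := min δ x0
  have ha : 0 < a := lt_min hδ.1 hx0.1
  obtain ⟨x, -, hx⟩ := exists_xi_eq_Icc (β := β) ha (min_le_right _ _) (by linarith [hx0.2])
    (Or.inr ⟨by rw [he]; exact h, hM a ⟨ha, min_le_left _ _⟩⟩)
  exact ⟨x, hx⟩

theorem one_third_le_xl {β : ℝ} (h : 3 ≤ β) : 1 / 3 ≤ xl β := by
  obtain ⟨b, hb, hb2, hM⟩ := exists_le_xi_right (a := 1 / 3) (by norm_num) β
  obtain ⟨x, hx, hx2⟩ := exists_xi_eq_Icc (β := β) (a := 1 / 3) (by norm_num) hb.1.le hb.2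
    (Or.inl ⟨by rw [xi_one_third]; exact h, hM⟩)
  exact hx.1.trans (le_xl hx2)

theorem lt_xi_of_xl_lt {β x : ℝ} (h : xl β < x) (hx : x ∈ Set.Ioo (0 : ℝ) (1 / 2)) : β < xi x := by
  by_contra! hc
  obtain ⟨b, hb, -, hM⟩ := exists_le_xi_right hx.2 β
  obtain ⟨y, hy, hy2⟩ := exists_xi_eq_Icc hx.1 hb.1.le hb.2 (Or.inl ⟨hc, hM⟩)
  linarith [hy.1, le_xl hy2]

theorem xl_three : xl 3 = 1 / 3 := by
  refine le_antisymm (csSup_le (xiSolutions_nonempty beta1_lt_three.le) ?_)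
    (one_third_le_xl le_rfl)
  intro x hx
  by_contra! hc
  have := three_lt_xi ⟨hc, hx.1.2⟩
  rw [hx.2] at this
  exact lt_irrefl _ this

theorem lt_one_third_of_mem {β x : ℝ} (h : β < 3) (hx : x ∈ xiSolutions β) : x < 1 / 3 := by
  by_contra! hc
  rcases eq_or_lt_of_le hc with hc | hc
  · have := hx.2
    rw [← hc, xi_one_third] at this
    linarith
  · have := three_lt_xi ⟨hc, hx.1.2⟩
    rw [hx.2] at this
    linarith

theorem xs_lt_xl {β : ℝ} (h1 : beta1 < β) (h3 : β < 3) : xs β < xl β := by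
  obtain ⟨x0, hx0, he⟩ := exists_xi_eq_beta1
  obtain ⟨δ, hδ, hM⟩ := exists_le_xi_left β
  set a := min δ x0
  have ha : 0 < a := lt_min hδ.1 hx0.1
  obtain ⟨x, hx, hx2⟩ := exists_xi_eq_Icc (β := β) ha (min_le_right _ _) (by linarith [hx0.2])
    (Or.inr ⟨by rw [he]; exact h1.le, hM a ⟨ha, min_le_left _ _⟩⟩)
  obtain ⟨y, hy, hy2⟩ := exists_xi_eq_Icc (β := β) hx0.1 hx0.2.le (by norm_num)
    (Or.inl ⟨by rw [he]; exact h1.le, by rw [xi_one_third]; exact h3.le⟩)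
  have hne : x ≠ x0 := by
    rintro rfl
    rw [hx2.2] at he
    exact h1.ne' he
  have := lt_of_le_of_ne hx.2 hne
  linarith [xs_le hx2, le_xl hy2, hy.1]

/-- The chord of ξ from x_s to x_l is horizontal, so ξ' < 0 at x_s. This is one of the two
conditions for 𝔖² to consist of local minima. -/
theorem lt_one_div_xs {β : ℝ} (h1 : beta1 < β) (h3 : β < 3) :
    β < 1 / (3 * xs β * (1 - 2 * xs β)) := by
  have hne := xiSolutions_nonempty h1.le
  have hs := xs_mem hne
  have hl := xl_mem hne
  have hs3 := lt_one_third_of_mem h3 hs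
  have hd := strictConvexOn_xi.lt_slope_of_hasDerivAt hs.1 hl.1 (xs_lt_xl h1 h3)
    (hasDerivAt_xi hs.1 hs3.ne)
  rw [slope_def_field, hs.2, hl.2, sub_self, zero_div, div_neg_iff] at hd
  have hp : 0 < 1 - 3 * xs β := by linarith
  rcases hd with hd | hd
  · linarith
  · have : 1 / (3 * xs β * (1 - 2 * xs β)) = 1 / (xs β * (1 - 2 * xs β)) / 3 := by
      rw [div_div]; ring_nf
    rw [this]
    linarith

/-- At the minimum of ξ the derivative vanishes; consequently ψ₂(β₁) = 0. -/
theorem xi_xl_beta1 : xl beta1 ∈ Set.Ioo (0 : ℝ) (1 / 3) ∧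
    beta1 = 1 / (3 * xl beta1 * (1 - 2 * xl beta1)) := by
  have hl := xl_mem (xiSolutions_nonempty le_rfl)
  have hl3 := lt_one_third_of_mem beta1_lt_three hl
  refine ⟨⟨hl.1.1, hl3⟩, ?_⟩
  have hmin : IsLocalMin xi (xl beta1) := by
    filter_upwards [isOpen_Ioo.mem_nhds hl.1] with y hy
    rw [hl.2]
    exact beta1_le_xi hy
  have h0 := hmin.hasDerivAt_eq_zero (hasDerivAt_xi hl.1 hl3.ne)
  rw [hl.2, div_eq_zero_iff] at h0
  have : 1 / (3 * xl beta1 * (1 - 2 * xl beta1)) = 1 / (xl beta1 * (1 - 2 * xl beta1)) / 3 := by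
    rw [div_div]; ring_nf
  rw [this]
  rcases h0 with h0 | h0 <;> linarith

/-! ### A one-component gradient inequality governed by β₁. -/

/-- `ell` is homogeneous of degree -1; rescaling to 2A + B = 1 gives a value of ξ, and undoing the
scaling multiplies it by a factor at least 1. -/
theorem beta1_le_ell {A B : ℝ} (hA : 0 < A) (hB : 0 < B) (h : 2 * A + B ≤ 1) :
    beta1 ≤ ell A B := by
  have hc : 0 < 2 * A + B := by linarith
  have hx : A / (2 * A + B) ∈ Set.Ioo (0 : ℝ) (1 / 2) := by
    refine ⟨by positivity, ?_⟩
    rw [div_lt_div_iff₀ hc (by norm_num)]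
    linarith
  have h1 := beta1_le_xi hx
  have h2 := ell_smul (A / (2 * A + B)) (1 - 2 * (A / (2 * A + B))) (2 * A + B)
  rw [← xi_eq_ell hx] at h2
  have e1 : (2 * A + B) * (A / (2 * A + B)) = A := by field_simp
  have e2 : (2 * A + B) * (1 - 2 * (A / (2 * A + B))) = B := by field_simp; ring
  rw [e1, e2] at h2
  rw [h2]
  have h3 : 1 ≤ 1 / (2 * A + B) := by rw [le_div_iff₀ hc]; linarith
  nlinarith [beta1_pos]

/-- Both sides are sums over pairs: a third of Σ(xᵢ-xⱼ)² times β₁ or times `ell xᵢ xⱼ`. Jensen with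
the weights (xᵢ-xⱼ)² reduces the claim to `ell A B` ≥ β₁, with A and B the averages of the smaller
and larger members of the pairs. -/
theorem beta1_mul_sq_le_of_sorted {a b c : ℝ} (ha : 0 < a) (hab : a ≤ b) (hbc : b ≤ c)
    (hs : a + b + c = 1) :
    beta1 * ((a - 1 / 3) ^ 2 + (b - 1 / 3) ^ 2 + (c - 1 / 3) ^ 2) ≤
      (a - 1 / 3) * Real.log a + (b - 1 / 3) * Real.log b + (c - 1 / 3) * Real.log c := by
  have hb : 0 < b := by linarith
  have hc : 0 < c := by linarith
  set w : Fin 3 → ℝ := ![(b - a) ^ 2, (c - a) ^ 2, (c - b) ^ 2] with hw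
  set l : Fin 3 → ℝ := ![a, a, b] with hl
  set u : Fin 3 → ℝ := ![b, c, c] with hu
  set W := ∑ i, w i with hW
  have hWe : W = (b - a) ^ 2 + (c - a) ^ 2 + (c - b) ^ 2 := by
    simp [hW, hw, Fin.sum_univ_three]
  have hlhs : beta1 * ((a - 1 / 3) ^ 2 + (b - 1 / 3) ^ 2 + (c - 1 / 3) ^ 2) = W * beta1 / 3 := by
    rw [hWe]
    have : c = 1 - a - b := by linarith
    rw [this]; ring
  have hrhs : (a - 1 / 3) * Real.log a + (b - 1 / 3) * Real.log b + (c - 1 / 3) * Real.log c =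
      (∑ i, w i * ell (l i) (u i)) / 3 := by
    have i1 := sub_mul_ell ha hb
    have i2 := sub_mul_ell ha hc
    have i3 := sub_mul_ell hb hc
    have : ∑ i, w i * ell (l i) (u i) = (b - a) * (Real.log b - Real.log a) +
        (c - a) * (Real.log c - Real.log a) + (c - b) * (Real.log c - Real.log b) := by
      rw [← i1, ← i2, ← i3]
      simp [hw, hl, hu, Fin.sum_univ_three]
      ring
    rw [this]
    have : c = 1 - a - b := by linarith
    rw [this]; ring
  rw [hlhs, hrhs]
  suffices W * beta1 ≤ ∑ i, w i * ell (l i) (u i) by linarith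
  have hwn : ∀ i, 0 ≤ w i := by intro i; fin_cases i <;> simp [hw] <;> positivity
  have hln : ∀ i, 0 < l i := by intro i; fin_cases i <;> simp [hl] <;> assumption
  have hun : ∀ i, 0 < u i := by intro i; fin_cases i <;> simp [hu] <;> assumption
  rcases eq_or_lt_of_le (Finset.sum_nonneg fun i (_ : i ∈ Finset.univ) => hwn i) with h0 | h0
  · rw [hW, ← h0, zero_mul]
    refine Finset.sum_nonneg fun i _ => ?_
    rw [(Finset.sum_eq_zero_iff_of_nonneg fun i _ => hwn i).1 h0.symm i (Finset.mem_univ i),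
      zero_mul]
  · rw [← hW] at h0
    set A := (∑ i, w i * l i) / W with hA
    set B := (∑ i, w i * u i) / W with hB
    have hAl : a ≤ A := by
      rw [hA, le_div_iff₀ h0, hW, Finset.mul_sum]
      refine Finset.sum_le_sum fun i _ => ?_
      rw [mul_comm]
      refine mul_le_mul_of_nonneg_left ?_ (hwn i)
      fin_cases i <;> simp [hl, hab]
    have hBl : a ≤ B := by
      rw [hB, le_div_iff₀ h0, hW, Finset.mul_sum]
      refine Finset.sum_le_sum fun i _ => ?_
      rw [mul_comm]
      refine mul_le_mul_of_nonneg_left ?_ (hwn i)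
      fin_cases i <;> simp [hu] <;> linarith
    have hAp : 0 < A := ha.trans_le hAl
    have hBp : 0 < B := ha.trans_le hBl
    have hJ := mul_ell_le_sum hwn hln hun hAp hBp 
      (by rw [← hW, hA, mul_div_cancel₀ _ h0.ne']) (by rw [← hW, hB, mul_div_cancel₀ _ h0.ne'])
    refine le_trans (mul_le_mul_of_nonneg_left (beta1_le_ell hAp hBp ?_) h0.le) hJ
    rw [hA, hB, mul_div_assoc', ← add_div, div_le_one h0]
    have e1 : ∑ i, w i * l i = (b - a) ^ 2 * a + (c - a) ^ 2 * a + (c - b) ^ 2 * b := by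
      simp [hw, hl, Fin.sum_univ_three]
    have e2 : ∑ i, w i * u i = (b - a) ^ 2 * b + (c - a) ^ 2 * c + (c - b) ^ 2 * c := by
      simp [hw, hu, Fin.sum_univ_three]
    rw [e1, e2, hWe]
    have hp : 0 ≤ b - a := by linarith
    have hq : 0 ≤ c - b := by linarith
    -- The sorted order makes this difference nonnegative, which is 2A + B ≤ 1.
    have e3 : (b - a) ^ 2 + (c - a) ^ 2 + (c - b) ^ 2 -
        (2 * ((b - a) ^ 2 * a + (c - a) ^ 2 * a + (c - b) ^ 2 * b) +
          ((b - a) ^ 2 * b + (c - a) ^ 2 * c + (c - b) ^ 2 * c)) =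
        2 * (b - a) ^ 3 + 3 * (b - a) ^ 2 * (c - b) := by
      have : c = 1 - a - b := by linarith
      rw [this]; ring
    have : 0 ≤ 2 * (b - a) ^ 3 + 3 * (b - a) ^ 2 * (c - b) := by positivity
    linarith

/-- The one-component gradient at inverse temperature `β ≤ β₁` points away from the uniform
point. -/
theorem beta1_mul_sq_le {x : Fin 3 → ℝ} (hx : ∀ i, 0 < x i) (hs : ∑ i, x i = 1) :
    beta1 * ∑ i, (x i - 1 / 3) ^ 2 ≤ ∑ i, (x i - 1 / 3) * Real.log (x i) := by
  rw [Fin.sum_univ_three] at hs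
  simp only [Fin.sum_univ_three]
  have h := fun {a b c : ℝ} => @beta1_mul_sq_le_of_sorted a b c
  rcases le_total (x 0) (x 1) with h01 | h01 <;> rcases le_total (x 1) (x 2) with h12 | h12 <;>
    rcases le_total (x 0) (x 2) with h02 | h02
  · linarith [h (hx 0) h01 h12 (by linarith)]
  · linarith [h (hx 0) h01 h12 (by linarith)]
  · linarith [h (hx 0) h02 h12 (by linarith)]
  · linarith [h (hx 2) h02 h01 (by linarith)]
  · linarith [h (hx 1) h01 h02 (by linarith)]
  · linarith [h (hx 1) h12 h02 (by linarith)]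
  · linarith [h (hx 2) h12 h01 (by linarith)]
  · linarith [h (hx 2) h12 h01 (by linarith)]

/-! ### The function defining J_c. -/

/-- The function whose root in `(0, 1)` is `J_c`. -/
noncomputable def jcFun (x : ℝ) : ℝ :=
  (1 + x) * (1 / (1 - x) - 1 / (2 + x)) - Real.log ((2 + x) / (1 - x))

theorem hasDerivAt_jcFun {x : ℝ} (hx : x ∈ Set.Ico (0 : ℝ) 1) :
    HasDerivAt jcFun ((1 + x) * (1 / (1 - x) ^ 2 + 1 / (2 + x) ^ 2) - 2 / (2 + x)) x := by
  have h1 : 0 < 1 - x := by linarith [hx.2]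
  have h2 : 0 < 2 + x := by linarith [hx.1]
  have d1 : HasDerivAt (fun y : ℝ => 1 - y) (-1) x := (hasDerivAt_id x).const_sub 1
  have d2 : HasDerivAt (fun y : ℝ => 2 + y) 1 x := (hasDerivAt_id x).const_add 2
  have d3 : HasDerivAt (fun y : ℝ => 1 + y) 1 x := (hasDerivAt_id x).const_add 1
  have d4 := (d3.mul (((hasDerivAt_const x (1 : ℝ)).div d1 h1.ne').sub
    ((hasDerivAt_const x (1 : ℝ)).div d2 h2.ne'))).sub
      ((d2.div d1 h1.ne').log (div_pos h2 h1).ne')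
  refine d4.congr_deriv ?_
  simp only [Pi.sub_apply, Pi.div_apply]
  field_simp
  ring

theorem strictMonoOn_jcFun : StrictMonoOn jcFun (Set.Ico 0 1) := by
  apply strictMonoOn_of_deriv_pos (convex_Ico _ _)
  · exact fun x hx => (hasDerivAt_jcFun hx).continuousAt.continuousWithinAt
  · intro x hx
    rw [interior_Ico] at hx
    rw [(hasDerivAt_jcFun ⟨hx.1.le, hx.2⟩).deriv]
    have h1 : 0 < 1 - x := by linarith [hx.2]
    have h2 : 0 < 2 + x := by linarith [hx.1]
    have hx0 := hx.1
    have i1 : 1 ≤ 1 / (1 - x) ^ 2 := by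
      rw [le_div_iff₀ (by positivity)]; nlinarith
    have i2 : 0 < 1 / (2 + x) ^ 2 := by positivity
    have i3 : 2 / (2 + x) < 1 := by rw [div_lt_one h2]; linarith
    nlinarith

/-- A root exists in (0, 3/11), so J_c < 3/11. The value 3/11 is the threshold below which J > ψ₃
implies m ≤ 2. -/
theorem jcFun_pos_of_Jc_lt {x : ℝ} (hx : x ∈ Set.Ioo (0 : ℝ) 1) (h : Jc < x ∨ 3 / 11 < x) :
    0 < jcFun x := by
  have h0 : jcFun 0 < 0 := by
    have := Real.log_two_gt_d9
    norm_num [jcFun]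
    linarith
  have h3 : 0 < jcFun (3 / 11) := by
    -- At x = 3/11 the rational part of `jcFun` is exactly 119/100 and the logarithm is log(25/8).
    have : Real.log (25 / 8) < 119 / 100 := by
      rw [Real.log_lt_iff_lt_exp (by norm_num)]
      have h1 := Real.quadratic_le_exp_of_nonneg (x := 119 / 200) (by norm_num)
      have h2 : Real.exp (119 / 100) = Real.exp (119 / 200) * Real.exp (119 / 200) := by
        rw [← Real.exp_add]; norm_num
      rw [h2]
      nlinarith
    norm_num [jcFun]
    linarith
  have hc : ContinuousOn jcFun (Set.Icc 0 (3 / 11)) := fun y hy =>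
    (hasDerivAt_jcFun ⟨hy.1, hy.2.trans_lt (by norm_num)⟩).continuousAt.continuousWithinAt
  obtain ⟨y, hy, hy0⟩ := intermediate_value_Ioo (by norm_num) hc ⟨h0, h3⟩
  have hyI : y ∈ Set.Ioo (0 : ℝ) 1 := ⟨hy.1, hy.2.trans (by norm_num)⟩
  have hlt : Jc < x := by
    rcases h with h | h
    · exact h
    · have : Jc ≤ y := csInf_le ⟨0, fun z hz => hz.1.1.le⟩ ⟨hyI, hy0⟩
      linarith [hy.2]
  obtain ⟨z, hz, hzx⟩ := exists_lt_of_csInf_lt (s := {x | x ∈ Set.Ioo (0 : ℝ) 1 ∧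
    (1 + x) * (1 / (1 - x) - 1 / (2 + x)) - Real.log ((2 + x) / (1 - x)) = 0}) ⟨y, hyI, hy0⟩ hlt
  have := strictMonoOn_jcFun ⟨hz.1.1.le, hz.1.2⟩ ⟨hx.1.le, hx.2⟩ hzx
  have hz0 : jcFun z = 0 := hz.2
  rwa [hz0] at this

/-! ### Derivatives of the free energy along lines. -/

variable {q : ℕ}

/-- The derivative of the free energy at `p` in the direction `w`. -/
noncomputable def dF (β J : ℝ) (p w : (Fin q → ℝ) × (Fin q → ℝ)) : ℝ :=
  -(∑ i, p.1 i * w.1 i + ∑ i, p.2 i * w.2 i) - J * ∑ i, (w.1 i * p.2 i + p.1 i * w.2 i) +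
    (1 + J) / β * (∑ i, w.1 i * (Real.log (p.1 i) + 1) + ∑ i, w.2 i * (Real.log (p.2 i) + 1))

/-- The second derivative of the free energy at `p` in the direction `w`. -/
noncomputable def d2F (β J : ℝ) (p w : (Fin q → ℝ) × (Fin q → ℝ)) : ℝ :=
  -(∑ i, w.1 i ^ 2 + ∑ i, w.2 i ^ 2) - J * ∑ i, 2 * (w.1 i * w.2 i) +
    (1 + J) / β * (∑ i, w.1 i ^ 2 / p.1 i + ∑ i, w.2 i ^ 2 / p.2 i)

/-- Pairs of vectors with positive coordinates. -/
def Pos (p : (Fin q → ℝ) × (Fin q → ℝ)) : Prop := (∀ i, 0 < p.1 i) ∧ ∀ i, 0 < p.2 i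

/-- Pairs of vectors with coordinate sums zero, the directions tangent to `Ξ²`. -/
def Tangent (w : (Fin q → ℝ) × (Fin q → ℝ)) : Prop := ∑ i, w.1 i = 0 ∧ ∑ i, w.2 i = 0

theorem hasDerivAt_coord (a b t : ℝ) : HasDerivAt (fun t : ℝ => a + t * b) b t := by
  simpa using ((hasDerivAt_id t).mul_const b).const_add a

theorem hasDerivAt_F_line (β J : ℝ) {p w : (Fin q → ℝ) × (Fin q → ℝ)} {t : ℝ}
    (h : Pos (p + t • w)) :
    HasDerivAt (fun t : ℝ => F β J (p + t • w)) (dF β J (p + t • w) w) t := by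
  have e : ∀ a b t : ℝ, 0 < a + t * b →
      HasDerivAt (fun t : ℝ => (a + t * b) * Real.log (a + t * b))
        (b * (Real.log (a + t * b) + 1)) t := by
    intro a b t hpos
    have h1 := hasDerivAt_coord a b t
    refine (h1.mul (h1.log hpos.ne')).congr_deriv ?_
    rw [mul_div_cancel₀ _ hpos.ne']
    ring
  have sq : ∀ a b t : ℝ, HasDerivAt (fun t : ℝ => 1 / 2 * (a + t * b) ^ 2) ((a + t * b) * b) t := by
    intro a b t
    exact (((hasDerivAt_coord a b t).pow 2).const_mul (1 / 2)).congr_deriv (by push_cast; ring)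
  unfold F energy entropy dF
  simp only [Pos, Prod.fst_add, Prod.smul_fst, Pi.add_apply, Pi.smul_apply, smul_eq_mul, Prod.snd_add,
    Prod.smul_snd] at h ⊢
  exact ((((HasDerivAt.fun_sum fun i _ => sq _ _ t).add
    (HasDerivAt.fun_sum fun i _ => sq _ _ t)).neg).sub ((HasDerivAt.fun_sum fun i _ =>
      (hasDerivAt_coord _ _ t).mul (hasDerivAt_coord _ _ t)).const_mul J)).add
        (((HasDerivAt.fun_sum fun i _ => e _ _ t (h.1 i)).add
          (HasDerivAt.fun_sum fun i _ => e _ _ t (h.2 i))).const_mul ((1 + J) / β))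

theorem hasDerivAt_dF_line (β J : ℝ) {p w : (Fin q → ℝ) × (Fin q → ℝ)} {t : ℝ}
    (h : Pos (p + t • w)) :
    HasDerivAt (fun t : ℝ => dF β J (p + t • w) w) (d2F β J (p + t • w) w) t := by
  have e : ∀ a b t : ℝ, 0 < a + t * b →
      HasDerivAt (fun t : ℝ => b * (Real.log (a + t * b) + 1)) (b ^ 2 / (a + t * b)) t := by
    intro a b t hpos
    exact ((((hasDerivAt_coord a b t).log hpos.ne').add_const 1).const_mul b).congr_deriv
      (by ring)
  have sq : ∀ a b t : ℝ, HasDerivAt (fun t : ℝ => (a + t * b) * b) (b ^ 2) t := fun a b t =>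
    ((hasDerivAt_coord a b t).mul_const b).congr_deriv (by ring)
  have cr : ∀ a b c d t : ℝ, HasDerivAt (fun t : ℝ => b * (c + t * d) + (a + t * b) * d)
      (2 * (b * d)) t := fun a b c d t =>
    (((hasDerivAt_coord c d t).const_mul b).add
      ((hasDerivAt_coord a b t).mul_const d)).congr_deriv (by ring)
  unfold dF d2F
  simp only [Pos, Prod.fst_add, Prod.smul_fst, Pi.add_apply, Pi.smul_apply, smul_eq_mul,
    Prod.snd_add, Prod.smul_snd] at h ⊢
  exact ((((HasDerivAt.fun_sum fun i _ => sq _ _ t).add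
    (HasDerivAt.fun_sum fun i _ => sq _ _ t)).neg).sub ((HasDerivAt.fun_sum fun i _ =>
      cr _ _ _ _ t).const_mul J)).add
        (((HasDerivAt.fun_sum fun i _ => e _ _ t (h.1 i)).add
          (HasDerivAt.fun_sum fun i _ => e _ _ t (h.2 i))).const_mul ((1 + J) / β))

theorem continuous_F (β J : ℝ) : Continuous (F (q := q) β J) := by
  unfold F energy entropy
  have h1 : ∀ i, Continuous fun p : (Fin q → ℝ) × (Fin q → ℝ) => p.1 i * Real.log (p.1 i) :=
    fun i => Real.continuous_mul_log.comp (by fun_prop)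
  have h2 : ∀ i, Continuous fun p : (Fin q → ℝ) × (Fin q → ℝ) => p.2 i * Real.log (p.2 i) :=
    fun i => Real.continuous_mul_log.comp (by fun_prop)
  fun_prop

theorem isOpen_pos : IsOpen {p : (Fin q → ℝ) × (Fin q → ℝ) | Pos p} := by
  have : {p : (Fin q → ℝ) × (Fin q → ℝ) | Pos p} =
      (⋂ i, {p | 0 < p.1 i}) ∩ ⋂ i, {p | 0 < p.2 i} := by
    ext p; simp [Pos]
  rw [this]
  exact (isOpen_iInter_of_finite fun i => isOpen_lt continuous_const (by fun_prop)).inter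
    (isOpen_iInter_of_finite fun i => isOpen_lt continuous_const (by fun_prop))

theorem continuousAt_d2F (β J : ℝ) {p w : (Fin q → ℝ) × (Fin q → ℝ)} (hp : Pos p) :
    ContinuousAt (fun z : ((Fin q → ℝ) × (Fin q → ℝ)) × ((Fin q → ℝ) × (Fin q → ℝ)) =>
      d2F β J z.1 z.2) (p, w) := by
  unfold d2F
  have h1 : ∀ i, ContinuousAt (fun z : ((Fin q → ℝ) × (Fin q → ℝ)) × ((Fin q → ℝ) × (Fin q → ℝ)) =>
      z.2.1 i ^ 2 / z.1.1 i) (p, w) := fun i =>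
    ContinuousAt.div (by fun_prop) (by fun_prop) (hp.1 i).ne'
  have h2 : ∀ i, ContinuousAt (fun z : ((Fin q → ℝ) × (Fin q → ℝ)) × ((Fin q → ℝ) × (Fin q → ℝ)) =>
      z.2.2 i ^ 2 / z.1.2 i) (p, w) := fun i =>
    ContinuousAt.div (by fun_prop) (by fun_prop) (hp.2 i).ne'
  fun_prop

theorem mem_Xi2_iff {p : (Fin q → ℝ) × (Fin q → ℝ)} : p ∈ Xi2 q ↔
    (∀ i, 0 ≤ p.1 i) ∧ (∀ i, 0 ≤ p.2 i) ∧ ∑ i, p.1 i = 1 ∧ ∑ i, p.2 i = 1 := by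
  simp only [Xi2, stdSimplex, Set.mem_prod]
  constructor
  · rintro ⟨⟨h1, h2⟩, h3, h4⟩; exact ⟨h1, h3, h2, h4⟩
  · rintro ⟨h1, h3, h2, h4⟩; exact ⟨⟨h1, h2⟩, h3, h4⟩

theorem convex_Xi2 : Convex ℝ (Xi2 q) := (convex_stdSimplex ℝ _).prod (convex_stdSimplex ℝ _)

theorem isCompact_Xi2 : IsCompact (Xi2 q) :=
  (isCompact_stdSimplex ℝ _).prod (isCompact_stdSimplex ℝ _)

theorem add_smul_mem_Xi2 {p w : (Fin q → ℝ) × (Fin q → ℝ)} (hp : p ∈ Xi2 q) (hw : Tangent w)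
    {t : ℝ} (h : Pos (p + t • w)) : p + t • w ∈ Xi2 q := by
  rw [mem_Xi2_iff] at hp ⊢
  refine ⟨fun i => (h.1 i).le, fun i => (h.2 i).le, ?_, ?_⟩
  · simp [Finset.sum_add_distrib, ← Finset.mul_sum, hp.2.2.1, hw.1]
  · simp [Finset.sum_add_distrib, ← Finset.mul_sum, hp.2.2.2, hw.2]

theorem isCriticalPoint_iff {β J : ℝ} {p : (Fin q → ℝ) × (Fin q → ℝ)} :
    IsCriticalPoint β J p ↔ p ∈ Xi2 q ∧ Pos p ∧ ∀ w, Tangent w → dF β J p w = 0 := by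
  have key : Pos p → ∀ w, HasDerivAt (fun t : ℝ => F β J (p + t • w)) (dF β J p w) 0 := by
    intro hp w
    have := hasDerivAt_F_line β J (p := p) (w := w) (t := 0) (by simpa using hp)
    simpa using this
  constructor
  · rintro ⟨h1, h2, h3, h4⟩
    exact ⟨h1, ⟨h2, h3⟩, fun w hw => (key ⟨h2, h3⟩ w).unique (h4 w hw.1 hw.2)⟩
  · rintro ⟨h1, h2, h3⟩
    refine ⟨h1, h2.1, h2.2, fun w hw1 hw2 => ?_⟩
    exact (key h2 w).congr_deriv (h3 w ⟨hw1, hw2⟩)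

/-- The Lagrange multiplier form of the critical equations. -/
theorem exists_log_eq_of_isCriticalPoint {β J : ℝ} (hβ : 0 < β) (hJ : 0 < J)
    {p : (Fin 3 → ℝ) × (Fin 3 → ℝ)} (h : IsCriticalPoint β J p) :
    (∃ c, ∀ i, Real.log (p.1 i) = β / (1 + J) * (p.1 i + J * p.2 i) + c) ∧
      ∃ c, ∀ i, Real.log (p.2 i) = β / (1 + J) * (p.2 i + J * p.1 i) + c := by
  obtain ⟨-, -, hc⟩ := isCriticalPoint_iff.1 h
  have key : ∀ {A B : ℝ}, -A + (1 + J) / β * B = 0 → B = β / (1 + J) * A := by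
    intro A B hAB
    have : 0 < 1 + J := by linarith
    field_simp at hAB ⊢
    linarith
  constructor
  · have h1 := hc (![1, -1, 0], 0) (by simp [Tangent, Fin.sum_univ_three])
    have h2 := hc (![1, 0, -1], 0) (by simp [Tangent, Fin.sum_univ_three])
    simp [dF, Fin.sum_univ_three] at h1 h2
    have k1 := key (A := (p.1 0 + J * p.2 0) - (p.1 1 + J * p.2 1))
      (B := Real.log (p.1 0) - Real.log (p.1 1)) (by linarith)
    have k2 := key (A := (p.1 0 + J * p.2 0) - (p.1 2 + J * p.2 2))
      (B := Real.log (p.1 0) - Real.log (p.1 2)) (by linarith)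
    refine ⟨Real.log (p.1 0) - β / (1 + J) * (p.1 0 + J * p.2 0), fun i => ?_⟩
    fin_cases i <;> simp only [Fin.zero_eta, Fin.mk_one, Fin.reduceFinMk] <;> linarith
  · have h1 := hc (0, ![1, -1, 0]) (by simp [Tangent, Fin.sum_univ_three])
    have h2 := hc (0, ![1, 0, -1]) (by simp [Tangent, Fin.sum_univ_three])
    simp [dF, Fin.sum_univ_three] at h1 h2
    have k1 := key (A := (p.2 0 + J * p.1 0) - (p.2 1 + J * p.1 1))
      (B := Real.log (p.2 0) - Real.log (p.2 1)) (by linarith)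
    have k2 := key (A := (p.2 0 + J * p.1 0) - (p.2 2 + J * p.1 2))
      (B := Real.log (p.2 0) - Real.log (p.2 2)) (by linarith)
    refine ⟨Real.log (p.2 0) - β / (1 + J) * (p.2 0 + J * p.1 0), fun i => ?_⟩
    fin_cases i <;> simp only [Fin.zero_eta, Fin.mk_one, Fin.reduceFinMk] <;> linarith

/-! ### Local connectedness of sublevel sets. -/

/-- Near `p`, any two points of the sublevel set `{F < c}` can be joined inside it. -/
def LocJoined (β J c : ℝ) (p : (Fin q → ℝ) × (Fin q → ℝ)) : Prop :=
  ∃ N ∈ nhds p, ∀ z₁ ∈ N ∩ sublevel q β J c, ∀ z₂ ∈ N ∩ sublevel q β J c,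
    ∃ C ⊆ sublevel q β J c, IsPreconnected C ∧ z₁ ∈ C ∧ z₂ ∈ C

theorem valley_eq_of_isPreconnected {β J c : ℝ} {a b : (Fin q → ℝ) × (Fin q → ℝ)}
    {C : Set ((Fin q → ℝ) × (Fin q → ℝ))} (hC : IsPreconnected C) (hs : C ⊆ sublevel q β J c)
    (ha : a ∈ C) (hb : b ∈ C) : valley β J c a = valley β J c b :=
  connectedComponentIn_eq (hC.subset_connectedComponentIn ha hs hb)

theorem valley_subset {β J c : ℝ} (a : (Fin q → ℝ) × (Fin q → ℝ)) :
    valley β J c a ⊆ sublevel q β J c := connectedComponentIn_subset _ _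

/-- Only one valley can then reach p, so p separates nothing; this is how lowest saddles are ruled
out. -/
theorem LocJoined.valley_eq {β J c : ℝ} {p a b : (Fin q → ℝ) × (Fin q → ℝ)}
    (h : LocJoined β J c p) (ha : p ∈ closure (valley β J c a))
    (hb : p ∈ closure (valley β J c b)) : valley β J c a = valley β J c b := by
  obtain ⟨N, hN, hj⟩ := h
  obtain ⟨z₁, h1, h1'⟩ := mem_closure_iff_nhds.1 ha N hN
  obtain ⟨z₂, h2, h2'⟩ := mem_closure_iff_nhds.1 hb N hN
  obtain ⟨C, hCs, hC, hz1, hz2⟩ := hj z₁ ⟨h1, valley_subset _ h1'⟩ z₂ ⟨h2, valley_subset _ h2'⟩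
  have e1 : valley β J c a = valley β J c z₁ := connectedComponentIn_eq h1'
  have e2 : valley β J c b = valley β J c z₂ := connectedComponentIn_eq h2'
  rw [e1, e2]
  exact valley_eq_of_isPreconnected hC hCs hz1 hz2

theorem locJoined_of_hub {β J c : ℝ} {p : (Fin q → ℝ) × (Fin q → ℝ)}
    {N A : Set ((Fin q → ℝ) × (Fin q → ℝ))} (hN : N ∈ nhds p) (hA : IsPreconnected A)
    (hAs : A ⊆ sublevel q β J c) (h : ∀ z ∈ N ∩ sublevel q β J c,
      ∃ C ⊆ sublevel q β J c, IsPreconnected C ∧ z ∈ C ∧ (C ∩ A).Nonempty) :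
    LocJoined β J c p := by
  refine ⟨N, hN, fun z₁ hz₁ z₂ hz₂ => ?_⟩
  obtain ⟨C, hCs, hC, hz1, x, hx, hx'⟩ := h z₁ hz₁
  obtain ⟨D, hDs, hD, hz2, y, hy, hy'⟩ := h z₂ hz₂
  refine ⟨(C ∪ A) ∪ D, Set.union_subset (Set.union_subset hCs hAs) hDs,
    (hC.union x hx hx' hA).union y (Or.inr hy') hy hD, Or.inl (Or.inl hz1), Or.inr hz2⟩

theorem locJoined_of_lt {β J c : ℝ} {p : (Fin q → ℝ) × (Fin q → ℝ)} (h : F β J p < c) :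
    LocJoined β J c p := by
  obtain ⟨r, hr, hb⟩ := Metric.mem_nhds_iff.1
    ((continuous_F β J).continuousAt.eventually_lt_const h)
  refine ⟨Metric.ball p r, Metric.ball_mem_nhds p hr, fun z₁ hz₁ z₂ hz₂ => ?_⟩
  exact ⟨Metric.ball p r ∩ Xi2 q, fun z hz => ⟨hz.2, hb hz.1⟩,
    ((convex_ball p r).inter convex_Xi2).isPreconnected, ⟨hz₁.1, hz₁.2.1⟩, ⟨hz₂.1, hz₂.2.1⟩⟩

/-! ### Points with a descent direction -/

/-- `dF` with the logarithms truncated from below. -/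
noncomputable def dFTrunc (β J ε : ℝ) (p w : (Fin q → ℝ) × (Fin q → ℝ)) : ℝ :=
  -(∑ i, p.1 i * w.1 i + ∑ i, p.2 i * w.2 i) - J * ∑ i, (w.1 i * p.2 i + p.1 i * w.2 i) +
    (1 + J) / β * (∑ i, w.1 i * (Real.log (max ε (p.1 i)) + 1) +
      ∑ i, w.2 i * (Real.log (max ε (p.2 i)) + 1))

theorem continuous_dFTrunc (β J : ℝ) {ε : ℝ} (hε : 0 < ε) :
    Continuous fun z : ((Fin q → ℝ) × (Fin q → ℝ)) × ((Fin q → ℝ) × (Fin q → ℝ)) =>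
      dFTrunc β J ε z.1 z.2 := by
  have h1 : ∀ i, Continuous fun z : ((Fin q → ℝ) × (Fin q → ℝ)) × ((Fin q → ℝ) × (Fin q → ℝ)) =>
      Real.log (max ε (z.1.1 i)) := fun i =>
    Continuous.log (by fun_prop) fun z => (lt_max_of_lt_left hε).ne'
  have h2 : ∀ i, Continuous fun z : ((Fin q → ℝ) × (Fin q → ℝ)) × ((Fin q → ℝ) × (Fin q → ℝ)) =>
      Real.log (max ε (z.1.2 i)) := fun i =>
    Continuous.log (by fun_prop) fun z => (lt_max_of_lt_left hε).ne'
  unfold dFTrunc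
  fun_prop

/-- Near a face of Ξ² the entropy derivative is unbounded, so `dF` has no continuous extension
there. The truncation is continuous, and it dominates `dF` when decreasing coordinates stay above ε.
-/
theorem dF_le_dFTrunc {β J ε : ℝ} (hθ : 0 ≤ (1 + J) / β)
    {p w : (Fin q → ℝ) × (Fin q → ℝ)} (hp : Pos p) (h1 : ∀ i, 0 ≤ w.1 i ∨ ε ≤ p.1 i)
    (h2 : ∀ i, 0 ≤ w.2 i ∨ ε ≤ p.2 i) : dF β J p w ≤ dFTrunc β J ε p w := by
  have key : ∀ {a b : ℝ}, 0 < a → (0 ≤ b ∨ ε ≤ a) →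
      b * (Real.log a + 1) ≤ b * (Real.log (max ε a) + 1) := by
    intro a b ha hab
    rcases hab with hb | hb
    · exact mul_le_mul_of_nonneg_left
        (by linarith [Real.log_le_log ha (le_max_right ε a)]) hb
    · rw [max_eq_right hb]
  unfold dF dFTrunc
  have s1 := Finset.sum_le_sum fun i (_ : i ∈ Finset.univ) => key (hp.1 i) (h1 i)
  have s2 := Finset.sum_le_sum fun i (_ : i ∈ Finset.univ) => key (hp.2 i) (h2 i)
  have := mul_le_mul_of_nonneg_left (add_le_add s1 s2) hθ
  linarith

/-- `p` admits a uniform descent direction in `Ξ²`: moving towards a fixed point of `Ξ²` strictly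
decreases the free energy near `p`. -/
def HasDescent (β J : ℝ) (p : (Fin q → ℝ) × (Fin q → ℝ)) : Prop :=
  ∃ c ∈ Xi2 q, ∃ δ ∈ Set.Ioc (0 : ℝ) 1, ∀ᶠ z in nhds p, z ∈ Xi2 q →
    StrictAntiOn (fun t : ℝ => F β J (z + t • (c - z))) (Set.Icc 0 δ)

theorem line_mem_Xi2 {z c : (Fin q → ℝ) × (Fin q → ℝ)} (hz : z ∈ Xi2 q) (hc : c ∈ Xi2 q) {t : ℝ}
    (ht : t ∈ Set.Icc (0 : ℝ) 1) : z + t • (c - z) ∈ Xi2 q :=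
  convex_Xi2.add_smul_sub_mem hz hc ht

theorem pos_line {z c : (Fin q → ℝ) × (Fin q → ℝ)} (hz : z ∈ Xi2 q) (hc : Pos c) {t : ℝ}
    (ht : t ∈ Set.Ioc (0 : ℝ) 1) : Pos (z + t • (c - z)) := by
  obtain ⟨h1, h2, -, -⟩ := mem_Xi2_iff.1 hz
  have key : ∀ {a b : ℝ}, 0 ≤ a → 0 < b → 0 < a + t * (b - a) := by
    intro a b ha hb
    have := mul_nonneg (sub_nonneg.2 ht.2) ha
    have := mul_pos ht.1 hb
    linarith
  exact ⟨fun i => key (h1 i) (hc.1 i), fun i => key (h2 i) (hc.2 i)⟩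

theorem hasDescent_of_dFTrunc_neg {β J ε : ℝ} (hθ : 0 ≤ (1 + J) / β) (hε : 0 < ε)
    {p c : (Fin q → ℝ) × (Fin q → ℝ)} (hc : c ∈ Xi2 q) (hcp : Pos c)
    (h1 : ∀ i, p.1 i = 0 ∨ ε < p.1 i) (h2 : ∀ i, p.2 i = 0 ∨ ε < p.2 i)
    (hneg : dFTrunc β J ε p (c - p) < 0) : HasDescent β J p := by
  have hev : ∀ᶠ z : ((Fin q → ℝ) × (Fin q → ℝ)) × ℝ in nhds p ×ˢ nhds (0 : ℝ),
      dFTrunc β J ε (z.1 + z.2 • (c - z.1)) (c - z.1) < 0 ∧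
      (∀ i, 0 ≤ (c - z.1).1 i ∨ ε ≤ (z.1 + z.2 • (c - z.1)).1 i) ∧
      ∀ i, 0 ≤ (c - z.1).2 i ∨ ε ≤ (z.1 + z.2 • (c - z.1)).2 i := by
    rw [← nhds_prod_eq]
    refine Filter.Eventually.and ?_ (Filter.Eventually.and ?_ ?_)
    · have hcont : Continuous fun z : ((Fin q → ℝ) × (Fin q → ℝ)) × ℝ =>
          dFTrunc β J ε (z.1 + z.2 • (c - z.1)) (c - z.1) :=
        (continuous_dFTrunc β J hε).comp
          (f := fun z : ((Fin q → ℝ) × (Fin q → ℝ)) × ℝ => (z.1 + z.2 • (c - z.1), c - z.1))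
          (by fun_prop)
      refine hcont.continuousAt.eventually_lt_const ?_
      simpa using hneg
    · rw [Filter.eventually_all]
      intro i
      rcases h1 i with h | h
      · have hcont : Continuous fun z : ((Fin q → ℝ) × (Fin q → ℝ)) × ℝ => (c - z.1).1 i := by
          simp only [Prod.fst_sub, Pi.sub_apply]; fun_prop
        filter_upwards [hcont.continuousAt.eventually_const_lt (u := 0)
          (by simpa [h] using hcp.1 i)] with z hz
        exact Or.inl hz.le
      · have hcont : Continuous fun z : ((Fin q → ℝ) × (Fin q → ℝ)) × ℝ =>
            (z.1 + z.2 • (c - z.1)).1 i := by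
          simp only [Prod.fst_add, Prod.smul_fst, Prod.fst_sub, Pi.add_apply, Pi.smul_apply,
            Pi.sub_apply]
          fun_prop
        filter_upwards [hcont.continuousAt.eventually_const_lt (u := ε) (by simpa using h)]
          with z hz
        exact Or.inr hz.le
    · rw [Filter.eventually_all]
      intro i
      rcases h2 i with h | h
      · have hcont : Continuous fun z : ((Fin q → ℝ) × (Fin q → ℝ)) × ℝ => (c - z.1).2 i := by
          simp only [Prod.snd_sub, Pi.sub_apply]; fun_prop
        filter_upwards [hcont.continuousAt.eventually_const_lt (u := 0)
          (by simpa [h] using hcp.2 i)] with z hz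
        exact Or.inl hz.le
      · have hcont : Continuous fun z : ((Fin q → ℝ) × (Fin q → ℝ)) × ℝ =>
            (z.1 + z.2 • (c - z.1)).2 i := by
          simp only [Prod.snd_add, Prod.smul_snd, Prod.snd_sub, Pi.add_apply, Pi.smul_apply,
            Pi.sub_apply]
          fun_prop
        filter_upwards [hcont.continuousAt.eventually_const_lt (u := ε) (by simpa using h)]
          with z hz
        exact Or.inr hz.le
  obtain ⟨P, hP, Q, hQ, hPQ⟩ := Filter.eventually_prod_iff.1 hev
  obtain ⟨δ, hδ, hδQ⟩ := Metric.eventually_nhds_iff.1 hQ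
  refine ⟨c, hc, min (δ / 2) 1, ⟨lt_min (by linarith) one_pos, min_le_right _ _⟩, ?_⟩
  filter_upwards [hP] with z hz hzX
  apply strictAntiOn_of_deriv_neg (convex_Icc _ _)
  · exact ((continuous_F β J).comp (by fun_prop)).continuousOn
  · intro t ht
    rw [interior_Icc] at ht
    have ht1 : t ∈ Set.Ioc (0 : ℝ) 1 := ⟨ht.1, ht.2.le.trans (min_le_right _ _)⟩
    have hpos := pos_line hzX hcp ht1
    rw [(hasDerivAt_F_line β J hpos).deriv]
    have htQ : Q t := hδQ (by
      rw [Real.dist_eq, sub_zero, abs_of_pos ht.1]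
      linarith [ht.2.trans_le (min_le_left (δ / 2) 1)])
    obtain ⟨k1, k2, k3⟩ := hPQ hz htQ
    exact (dF_le_dFTrunc hθ hpos k2 k3).trans_lt k1

theorem HasDescent.locJoined {β J : ℝ} {p : (Fin q → ℝ) × (Fin q → ℝ)} (hp : p ∈ Xi2 q)
    (h : HasDescent β J p) : LocJoined β J (F β J p) p := by
  obtain ⟨c, hc, δ, hδ, hev⟩ := h
  have hδI : δ ∈ Set.Icc (0 : ℝ) δ := ⟨hδ.1.le, le_rfl⟩
  have h0I : (0 : ℝ) ∈ Set.Icc (0 : ℝ) δ := ⟨le_rfl, hδ.1.le⟩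
  have hlt : F β J (p + δ • (c - p)) < F β J p := by
    simpa using (hev.self_of_nhds hp) h0I hδI hδ.1
  have hev2 : ∀ᶠ z in nhds p, F β J (z + δ • (c - z)) < F β J p := by
    have hcont : Continuous fun z : (Fin q → ℝ) × (Fin q → ℝ) => F β J (z + δ • (c - z)) :=
      (continuous_F β J).comp (by fun_prop)
    exact hcont.continuousAt.eventually_lt_const hlt
  obtain ⟨r, hr, hb⟩ := Metric.mem_nhds_iff.1 (hev.and hev2)
  refine locJoined_of_hub (Metric.ball_mem_nhds p hr)
    -- The hub is the image of a convex neighbourhood pushed by δ towards c; every nearby sublevel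
    -- point descends to it along its own segment.
    (A := (fun z => z + δ • (c - z)) '' (Metric.ball p r ∩ Xi2 q)) ?_ ?_ ?_
  · exact ((convex_ball p r).inter convex_Xi2).isPreconnected.image _ (by fun_prop)
  · rintro _ ⟨z, hz, rfl⟩
    exact ⟨line_mem_Xi2 hz.2 hc ⟨hδ.1.le, hδ.2⟩, (hb hz.1).2⟩
  · rintro z ⟨hzb, hzs⟩
    refine ⟨(fun t : ℝ => z + t • (c - z)) '' Set.Icc 0 δ, ?_, ?_, ⟨0, h0I, by simp⟩,
      ⟨z + δ • (c - z), ⟨δ, hδI, rfl⟩, ⟨z, ⟨hzb, hzs.1⟩, rfl⟩⟩⟩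
    · rintro _ ⟨t, ht, rfl⟩
      refine ⟨line_mem_Xi2 hzs.1 hc ⟨ht.1, ht.2.trans hδ.2⟩, lt_of_le_of_lt ?_ hzs.2⟩
      simpa using ((hb hzb).1 hzs.1).antitoneOn h0I ht ht.1
    · exact isPreconnected_Icc.image _ (by fun_prop)

theorem HasDescent.not_isLocalMinimum {β J : ℝ} {p : (Fin q → ℝ) × (Fin q → ℝ)}
    (h : HasDescent β J p) : ¬ IsLocalMinimum β J p := by
  rintro ⟨hp, hmin⟩
  obtain ⟨c, hc, δ, hδ, hev⟩ := h
  have hanti := hev.self_of_nhds hp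
  have h0I : (0 : ℝ) ∈ Set.Icc (0 : ℝ) δ := ⟨le_rfl, hδ.1.le⟩
  have ht : Filter.Tendsto (fun t : ℝ => p + t • (c - p)) (nhdsWithin 0 (Set.Ioc 0 δ))
      (nhdsWithin p (Xi2 q)) := by
    apply tendsto_nhdsWithin_iff.2
    constructor
    · have : Continuous fun t : ℝ => p + t • (c - p) := by fun_prop
      have := this.tendsto 0
      simp only [zero_smul, add_zero] at this
      exact this.mono_left nhdsWithin_le_nhds
    · filter_upwards [self_mem_nhdsWithin] with t ht
      exact line_mem_Xi2 hp hc ⟨ht.1.le, ht.2.trans hδ.2⟩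
  have hne : (nhdsWithin (0 : ℝ) (Set.Ioc 0 δ)).NeBot := by
    rw [nhdsWithin_Ioc_eq_nhdsGT hδ.1]; infer_instance
  obtain ⟨t, hFt, htI⟩ := ((ht.eventually hmin).and self_mem_nhdsWithin).exists
  have := hanti h0I ⟨htI.1.le, htI.2⟩ htI.1
  simp only [zero_smul, add_zero] at this
  linarith

section Noncritical

theorem q3_mem_Xi2 : q3 ∈ Xi2 3 := by
  rw [mem_Xi2_iff]
  refine ⟨fun i => ?_, fun i => ?_, ?_, ?_⟩ <;> simp [q3]

theorem pos_q3 : Pos q3 := ⟨fun i => by simp [q3], fun i => by simp [q3]⟩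

/-- The bound is uniform in ε, and a vanishing coordinate adds (log ε)/3, which tends to -∞. Moving
from a boundary point towards the uniform point is therefore a descent. -/
theorem eventually_sum_log_max_le {p : Fin 3 → ℝ} (hp : ∀ i, 0 ≤ p i) :
    ∃ C : ℝ, ∀ᶠ ε in nhdsWithin (0 : ℝ) (Set.Ioi 0), (∀ i, p i = 0 ∨ ε < p i) ∧
      ∑ i, (1 / 3 - p i) * (Real.log (max ε (p i)) + 1) ≤ C ∧
      ((∃ i, p i = 0) → ∑ i, (1 / 3 - p i) * (Real.log (max ε (p i)) + 1) ≤
        C + 1 / 3 * Real.log ε) := by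
  set K : Fin 3 → ℝ := fun i => |(1 / 3 - p i) * (Real.log (p i) + 1)| with hK
  refine ⟨∑ i, K i, ?_⟩
  have hsep : ∀ᶠ ε in nhdsWithin (0 : ℝ) (Set.Ioi 0), ∀ i, p i = 0 ∨ ε < p i := by
    rw [Filter.eventually_all]
    intro i
    rcases eq_or_lt_of_le (hp i) with h | h
    · exact Filter.Eventually.of_forall fun _ => Or.inl h.symm
    · filter_upwards [nhdsWithin_le_nhds (Iio_mem_nhds h)] with ε hε
      exact Or.inr hε
  filter_upwards [hsep, Ioo_mem_nhdsGT (one_pos : (0 : ℝ) < 1)] with ε hε hI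
  have hlog : Real.log ε ≤ 0 := Real.log_nonpos hI.1.le hI.2.le
  have hzero : ∀ i, p i = 0 → (1 / 3 - p i) * (Real.log (max ε (p i)) + 1) ≤
      K i + 1 / 3 * Real.log ε := by
    intro i hi
    -- Uses the convention `Real.log 0 = 0`.
    have : K i = 1 / 3 := by simp [hK, hi]
    rw [this, hi, max_eq_left hI.1.le]
    linarith
  have hterm : ∀ i, (1 / 3 - p i) * (Real.log (max ε (p i)) + 1) ≤ K i := by
    intro i
    rcases hε i with h | h
    · linarith [hzero i h]
    · rw [max_eq_right h.le]
      exact le_abs_self _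
  refine ⟨hε, Finset.sum_le_sum fun i _ => hterm i, ?_⟩
  rintro ⟨i, hi⟩
  rw [← Finset.add_sum_erase _ _ (Finset.mem_univ i),
    ← Finset.add_sum_erase Finset.univ K (Finset.mem_univ i)]
  have := Finset.sum_le_sum fun j (_ : j ∈ Finset.univ.erase i) => hterm j
  linarith [hzero i hi]

theorem hasDescent_of_not_pos {β J : ℝ} (hβ : 0 < β) (hJ : 0 < J) {p : (Fin 3 → ℝ) × (Fin 3 → ℝ)}
    (hp : p ∈ Xi2 3) (hn : ¬ Pos p) : HasDescent β J p := by
  have hθ : 0 < (1 + J) / β := by positivity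
  obtain ⟨h1, h2, -, -⟩ := mem_Xi2_iff.1 hp
  obtain ⟨C₁, hC₁⟩ := eventually_sum_log_max_le h1
  obtain ⟨C₂, hC₂⟩ := eventually_sum_log_max_le h2
  set E := -(∑ i, p.1 i * (q3 - p).1 i + ∑ i, p.2 i * (q3 - p).2 i) -
    J * ∑ i, ((q3 - p).1 i * p.2 i + p.1 i * (q3 - p).2 i) with hE
  have hz : (∃ i, p.1 i = 0) ∨ ∃ i, p.2 i = 0 := by
    by_contra! hc
    exact hn ⟨fun i => lt_of_le_of_ne (h1 i) (hc.1 i).symm,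
      fun i => lt_of_le_of_ne (h2 i) (hc.2 i).symm⟩
  have hlog : ∀ᶠ ε in nhdsWithin (0 : ℝ) (Set.Ioi 0),
      Real.log ε < 3 * (-(E / ((1 + J) / β)) - C₁ - C₂) :=
    Real.tendsto_log_nhdsGT_zero.eventually_lt_atBot _
  obtain ⟨ε, ⟨⟨hc1, hc2⟩, hl⟩, hε⟩ :=
    (((hC₁.and hC₂).and hlog).and self_mem_nhdsWithin).exists
  refine hasDescent_of_dFTrunc_neg hθ.le hε q3_mem_Xi2 pos_q3 hc1.1 hc2.1 ?_
  have hsum : ∑ i, (1 / 3 - p.1 i) * (Real.log (max ε (p.1 i)) + 1) +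
      ∑ i, (1 / 3 - p.2 i) * (Real.log (max ε (p.2 i)) + 1) < -(E / ((1 + J) / β)) := by
    rcases hz with hz | hz
    · linarith [hc1.2.2 hz, hc2.2.1]
    · linarith [hc2.2.2 hz, hc1.2.1]
  have e : dFTrunc β J ε p (q3 - p) = E + (1 + J) / β *
      (∑ i, (1 / 3 - p.1 i) * (Real.log (max ε (p.1 i)) + 1) +
        ∑ i, (1 / 3 - p.2 i) * (Real.log (max ε (p.2 i)) + 1)) := rfl
  rw [e]
  have := mul_lt_mul_of_pos_left hsum hθ
  rw [mul_neg, mul_div_cancel₀ _ hθ.ne'] at this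
  linarith

theorem dF_smul {q : ℕ} (β J s : ℝ) (p w : (Fin q → ℝ) × (Fin q → ℝ)) :
    dF β J p (s • w) = s * dF β J p w := by
  simp only [dF, Prod.smul_fst, Prod.smul_snd, Pi.smul_apply, smul_eq_mul, mul_add, mul_neg,
    mul_sub, Finset.mul_sum]
  simp only [← Finset.sum_add_distrib, ← Finset.sum_neg_distrib, ← Finset.sum_sub_distrib]
  exact Finset.sum_congr rfl fun i _ => by ring

theorem hasDescent_of_pos {q : ℕ} {β J : ℝ} (hβ : 0 < β) (hJ : 0 < J)
    {p w : (Fin q → ℝ) × (Fin q → ℝ)} (hp : p ∈ Xi2 q) (hpp : Pos p) (hw : Tangent w)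
    (hd : dF β J p w < 0) : HasDescent β J p := by
  have hθ : 0 < (1 + J) / β := by positivity
  have hev1 : ∀ᶠ s in nhdsWithin (0 : ℝ) (Set.Ioi 0), Pos (p + s • w) := by
    have hc : Continuous fun s : ℝ => p + s • w := by fun_prop
    exact nhdsWithin_le_nhds (hc.continuousAt.eventually (isOpen_pos.mem_nhds (by simpa using hpp)))
  have hev2 : ∀ᶠ s in nhdsWithin (0 : ℝ) (Set.Ioi 0), (∀ i, s < p.1 i) ∧ ∀ i, s < p.2 i := by
    refine nhdsWithin_le_nhds ((Filter.eventually_all.2 fun i => ?_).and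
      (Filter.eventually_all.2 fun i => ?_))
    · exact Iio_mem_nhds (hpp.1 i)
    · exact Iio_mem_nhds (hpp.2 i)
  obtain ⟨s, ⟨h1, h2⟩, hs⟩ := ((hev1.and hev2).and self_mem_nhdsWithin).exists
  -- The same small s serves as step towards the target p + s w and as truncation level below all
  -- coordinates.
  refine hasDescent_of_dFTrunc_neg hθ.le hs (add_smul_mem_Xi2 hp hw h1) h1
    (fun i => Or.inr (h2.1 i)) (fun i => Or.inr (h2.2 i)) ?_
  have e : dFTrunc β J s p (p + s • w - p) = dF β J p (s • w) := by
    simp only [dFTrunc, dF, add_sub_cancel_left, max_eq_right (h2.1 _).le,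
      max_eq_right (h2.2 _).le]
  rw [e, dF_smul]
  exact mul_neg_of_pos_of_neg hs hd

theorem hasDescent_of_not_isCriticalPoint {β J : ℝ} (hβ : 0 < β) (hJ : 0 < J)
    {p : (Fin 3 → ℝ) × (Fin 3 → ℝ)} (hp : p ∈ Xi2 3) (hn : ¬ IsCriticalPoint β J p) :
    HasDescent β J p := by
  by_cases hpp : Pos p
  · rw [isCriticalPoint_iff] at hn
    push Not at hn
    obtain ⟨w, hw, hd⟩ := hn hp hpp
    rcases lt_or_gt_of_ne hd with h | h
    · exact hasDescent_of_pos hβ hJ hp hpp hw h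
    · refine hasDescent_of_pos hβ hJ hp hpp (w := (-1 : ℝ) • w) ?_ ?_
      · simpa [Tangent, Finset.sum_neg_distrib] using hw
      · rw [dF_smul]; linarith
  · exact hasDescent_of_not_pos hβ hJ hp hpp

theorem IsLocalMinimum.isCriticalPoint {β J : ℝ} (hβ : 0 < β) (hJ : 0 < J)
    {p : (Fin 3 → ℝ) × (Fin 3 → ℝ)} (h : IsLocalMinimum β J p) : IsCriticalPoint β J p := by
  by_contra hn
  exact (hasDescent_of_not_isCriticalPoint hβ hJ h.1 hn).not_isLocalMinimum h

end Noncritical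

/-! ### Critical points with negative directions -/

theorem strictAntiOn_line {β J δ : ℝ} {z v : (Fin q → ℝ) × (Fin q → ℝ)}
    (hδ : 0 < δ) (hpos : ∀ t ∈ Set.Icc 0 δ, Pos (z + t • v))
    (h2 : ∀ t ∈ Set.Icc 0 δ, d2F β J (z + t • v) v < 0) (h1 : dF β J z v ≤ 0) :
    StrictAntiOn (fun t : ℝ => F β J (z + t • v)) (Set.Icc 0 δ) := by
  have hd : StrictAntiOn (fun t : ℝ => dF β J (z + t • v) v) (Set.Icc 0 δ) := by
    apply strictAntiOn_of_deriv_neg (convex_Icc _ _)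
    · exact fun t ht => (hasDerivAt_dF_line β J (hpos t ht)).continuousAt.continuousWithinAt
    · intro t ht
      have ht := interior_subset ht
      rw [(hasDerivAt_dF_line β J (hpos t ht)).deriv]
      exact h2 t ht
  apply strictAntiOn_of_deriv_neg (convex_Icc _ _)
  · exact fun t ht => (hasDerivAt_F_line β J (hpos t ht)).continuousAt.continuousWithinAt
  · intro t ht
    have ht' := interior_subset ht
    rw [interior_Icc] at ht
    rw [(hasDerivAt_F_line β J (hpos t ht')).deriv]
    have := hd ⟨le_rfl, hδ.le⟩ ht' ht.1
    simp only [zero_smul, add_zero] at this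
    linarith

theorem eventually_pos_and_d2F_neg {β J : ℝ} {p w : (Fin q → ℝ) × (Fin q → ℝ)} (hp : Pos p)
    (h2 : d2F β J p w < 0) :
    ∀ᶠ z : ((Fin q → ℝ) × (Fin q → ℝ)) × ((Fin q → ℝ) × (Fin q → ℝ)) in nhds (p, w),
      Pos z.1 ∧ d2F β J z.1 z.2 < 0 :=
  ((continuousAt_fst (p := (p, w))).eventually (p := Pos) (isOpen_pos.mem_nhds (x := p) hp)).and
    ((continuousAt_d2F β J hp).eventually_lt_const h2)

theorem not_isLocalMinimum_of_d2F_neg {β J : ℝ} {p w : (Fin q → ℝ) × (Fin q → ℝ)}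
    (hp : IsCriticalPoint β J p) (hw : Tangent w) (h2 : d2F β J p w < 0) :
    ¬ IsLocalMinimum β J p := by
  obtain ⟨hX, hpos, hc⟩ := isCriticalPoint_iff.1 hp
  rintro ⟨-, hmin⟩
  have hcont : Continuous fun t : ℝ => p + t • w := by fun_prop
  have hev : ∀ᶠ t : ℝ in nhds 0, Pos (p + t • w) ∧ d2F β J (p + t • w) w < 0 := by
    have hc2 : Continuous fun t : ℝ => (p + t • w, w) := by fun_prop
    exact hc2.continuousAt.eventually (eventually_pos_and_d2F_neg (by simpa using hpos)
      (by simpa using h2))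
  obtain ⟨r, hr, hb⟩ := Metric.eventually_nhds_iff.1 hev
  have hmem : ∀ t ∈ Set.Icc 0 (r / 2), Pos (p + t • w) ∧ d2F β J (p + t • w) w < 0 := by
    intro t ht
    exact hb (by rw [Real.dist_eq, sub_zero, abs_of_nonneg ht.1]; linarith [ht.2])
  have hanti := strictAntiOn_line (by linarith) (fun t ht => (hmem t ht).1)
    (fun t ht => (hmem t ht).2) (hc w hw).le
  have htend : Filter.Tendsto (fun t : ℝ => p + t • w) (nhdsWithin 0 (Set.Ioc 0 (r / 2)))
      (nhdsWithin p (Xi2 q)) := by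
    refine tendsto_nhdsWithin_iff.2 ⟨?_, ?_⟩
    · have := hcont.tendsto 0
      simp only [zero_smul, add_zero] at this
      exact this.mono_left nhdsWithin_le_nhds
    · filter_upwards [self_mem_nhdsWithin] with t ht
      exact add_smul_mem_Xi2 hX hw (hmem t ⟨ht.1.le, ht.2⟩).1
  have hr2 : 0 < r / 2 := by linarith
  have hne : (nhdsWithin (0 : ℝ) (Set.Ioc 0 (r / 2))).NeBot := by
    rw [nhdsWithin_Ioc_eq_nhdsGT hr2]; infer_instance
  obtain ⟨t, hFt, htI⟩ := ((htend.eventually hmin).and self_mem_nhdsWithin).exists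
  have := hanti ⟨le_rfl, hr2.le⟩ ⟨htI.1.le, htI.2⟩ htI.1
  simp only [zero_smul, add_zero] at this
  linarith

/-- A negative plane contains a circle of downhill directions. The circle is connected, so the
points reached from near p by a step δ along it form a connected hub below the level of p. -/
theorem locJoined_of_index_two {β J : ℝ} {p v₁ v₂ : (Fin q → ℝ) × (Fin q → ℝ)}
    (hp : IsCriticalPoint β J p) (h1 : Tangent v₁) (h2 : Tangent v₂)
    (hneg : ∀ φ : ℝ, d2F β J p (Real.cos φ • v₁ + Real.sin φ • v₂) < 0) :
    LocJoined β J (F β J p) p := by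
  obtain ⟨hX, hpos, hc⟩ := isCriticalPoint_iff.1 hp
  set v : ℝ → (Fin q → ℝ) × (Fin q → ℝ) := fun φ => Real.cos φ • v₁ + Real.sin φ • v₂ with hv
  have hvc : Continuous v := by fun_prop
  have hvt : ∀ φ, Tangent (v φ) := by
    intro φ
    constructor
    · simp [hv, Finset.sum_add_distrib, ← Finset.mul_sum, h1.1, h2.1]
    · simp [hv, Finset.sum_add_distrib, ← Finset.mul_sum, h1.2, h2.2]
  set K := Set.Icc (0 : ℝ) (2 * Real.pi) with hKdef
  have hK : IsCompact K := isCompact_Icc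
  have hev : ∀ᶠ z : ((Fin q → ℝ) × (Fin q → ℝ)) × ℝ in nhds (p, 0), ∀ φ ∈ K,
      Pos (z.1 + z.2 • v φ) ∧ d2F β J (z.1 + z.2 • v φ) (v φ) < 0 := by
    refine hK.eventually_forall_of_forall_eventually fun φ _ => ?_
    have hcont : Continuous fun y : (((Fin q → ℝ) × (Fin q → ℝ)) × ℝ) × ℝ =>
        (y.1.1 + y.1.2 • v y.2, v y.2) := by fun_prop
    exact hcont.continuousAt.eventually (eventually_pos_and_d2F_neg (by simpa using hpos)
      (by simpa using hneg φ))
  rw [nhds_prod_eq] at hev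
  obtain ⟨P, hP, Q, hQ, hPQ⟩ := Filter.eventually_prod_iff.1 hev
  obtain ⟨r, hr, hrQ⟩ := Metric.eventually_nhds_iff.1 hQ
  set δ := r / 2 with hδ
  have hδp : 0 < δ := by linarith
  have hPQ' : ∀ {z}, P z → ∀ t ∈ Set.Icc 0 δ, ∀ φ ∈ K,
      Pos (z + t • v φ) ∧ d2F β J (z + t • v φ) (v φ) < 0 := fun hz t ht φ hφ =>
    hPQ hz (hrQ (by rw [Real.dist_eq, sub_zero, abs_of_nonneg ht.1]; linarith [ht.2])) φ hφ
  have hanti : ∀ {z}, P z → ∀ φ ∈ K, dF β J z (v φ) ≤ 0 →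
      StrictAntiOn (fun t : ℝ => F β J (z + t • v φ)) (Set.Icc 0 δ) := fun hz φ hφ hd =>
    strictAntiOn_line hδp (fun t ht => (hPQ' hz t ht φ hφ).1)
      (fun t ht => (hPQ' hz t ht φ hφ).2) hd
  have h0I : (0 : ℝ) ∈ Set.Icc 0 δ := ⟨le_rfl, hδp.le⟩
  have hδI : δ ∈ Set.Icc 0 δ := ⟨hδp.le, le_rfl⟩
  have hev2 : ∀ᶠ z in nhds p, ∀ φ ∈ K, F β J (z + δ • v φ) < F β J p := by
    refine hK.eventually_forall_of_forall_eventually fun φ hφ => ?_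
    have hcont : Continuous fun y : ((Fin q → ℝ) × (Fin q → ℝ)) × ℝ =>
        F β J (y.1 + δ • v y.2) := (continuous_F β J).comp (by fun_prop)
    refine hcont.continuousAt.eventually_lt_const ?_
    simpa using hanti hP.self_of_nhds φ hφ (hc _ (hvt φ)).le h0I hδI hδp
  obtain ⟨s, hs, hb⟩ := Metric.mem_nhds_iff.1 (hP.and hev2)
  refine locJoined_of_hub (Metric.ball_mem_nhds p hs)
    (A := (fun y : ((Fin q → ℝ) × (Fin q → ℝ)) × ℝ => y.1 + δ • v y.2) ''
      ((Metric.ball p s ∩ Xi2 q) ×ˢ K)) ?_ ?_ ?_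
  · exact (((convex_ball p s).inter convex_Xi2).isPreconnected.prod isPreconnected_Icc).image _
      (by fun_prop)
  · rintro _ ⟨⟨z, φ⟩, ⟨hz, hφ⟩, rfl⟩
    exact ⟨add_smul_mem_Xi2 hz.2 (hvt φ) (hPQ' (hb hz.1).1 δ hδI φ hφ).1, (hb hz.1).2 φ hφ⟩
  · rintro z ⟨hzb, hzs⟩
    -- One of v₁ and -v₁ has nonpositive slope at z, and negative curvature then keeps F decreasing
    -- along it.
    obtain ⟨φ, hφ, hd⟩ : ∃ φ ∈ K, dF β J z (v φ) ≤ 0 := by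
      rcases le_total (dF β J z v₁) 0 with h | h
      · exact ⟨0, ⟨le_rfl, by positivity⟩, by simpa [hv] using h⟩
      · refine ⟨Real.pi, ⟨Real.pi_pos.le, by linarith [Real.pi_pos]⟩, ?_⟩
        have : v Real.pi = (-1 : ℝ) • v₁ := by simp [hv]
        rw [this, dF_smul]
        linarith
    have ha := hanti (hb hzb).1 φ hφ hd
    refine ⟨(fun t : ℝ => z + t • v φ) '' Set.Icc 0 δ, ?_, ?_, ⟨0, h0I, by simp⟩,
      ⟨z + δ • v φ, ⟨δ, hδI, rfl⟩, ⟨(z, φ), ⟨⟨hzb, hzs.1⟩, hφ⟩, rfl⟩⟩⟩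
    · rintro _ ⟨t, ht, rfl⟩
      refine ⟨add_smul_mem_Xi2 hzs.1 (hvt φ) (hPQ' (hb hzb).1 t ht φ hφ).1,
        lt_of_le_of_lt ?_ hzs.2⟩
      simpa using ha.antitoneOn h0I ht ht.1
    · exact isPreconnected_Icc.image _ (by fun_prop)

theorem not_isLowestSaddle_of_locJoined {β J : ℝ} {p : (Fin q → ℝ) × (Fin q → ℝ)}
    (h : LocJoined β J (F β J p) p) : ¬ IsLowestSaddle β J p := by
  rintro ⟨-, a, b, -, -, -, -, hne, ha, hb⟩
  exact hne (h.valley_eq ha hb)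

theorem IsLocalMinimum.not_mem_closure {β J : ℝ} {p a : (Fin q → ℝ) × (Fin q → ℝ)}
    (h : IsLocalMinimum β J p) : p ∉ closure (valley β J (F β J p) a) := by
  intro hp
  obtain ⟨U, hU, hmin⟩ := mem_nhdsWithin_iff_exists_mem_nhds_inter.1 h.2
  obtain ⟨z, hz, hzv⟩ := mem_closure_iff_nhds.1 hp U hU
  have hzs := valley_subset _ hzv
  have h3 : F β J p ≤ F β J z := hmin ⟨hz, hzs.1⟩
  exact absurd hzs.2 (not_lt.2 h3)

/-! ### Compact joins and the mountain pass. -/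

variable {β J c : ℝ}

theorem isClosed_Xi2 : IsClosed (Xi2 q) := isCompact_Xi2.isClosed

/-- The points `a` and `b` lie in a compact connected subset of `{F < c}`. -/
def CompactJoined (β J c : ℝ) (a b : (Fin q → ℝ) × (Fin q → ℝ)) : Prop :=
  ∃ C ⊆ sublevel q β J c, IsPreconnected C ∧ IsCompact C ∧ a ∈ C ∧ b ∈ C

theorem CompactJoined.mono {c' : ℝ} {a b : (Fin q → ℝ) × (Fin q → ℝ)} (h : CompactJoined β J c a b)
    (hc : c ≤ c') : CompactJoined β J c' a b := by
  obtain ⟨C, h1, h2⟩ := h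
  exact ⟨C, fun x hx => ⟨(h1 hx).1, (h1 hx).2.trans_le hc⟩, h2⟩

theorem exists_ball_subset_sublevel {p : (Fin q → ℝ) × (Fin q → ℝ)} (h : F β J p < c) :
    ∃ r > 0, Metric.ball p r ∩ Xi2 q ⊆ sublevel q β J c := by
  obtain ⟨r, hr, hb⟩ := Metric.mem_nhds_iff.1
    ((continuous_F β J).continuousAt.eventually_lt_const h)
  exact ⟨r, hr, fun z hz => ⟨hz.2, hb hz.1⟩⟩

/-- Locally, points of the valley are joined by segments; connectedness chains these. Compactness of
the joining set gives room to lower its level. -/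
theorem compactJoined_of_valley_eq {a b : (Fin q → ℝ) × (Fin q → ℝ)} (ha : a ∈ sublevel q β J c)
    (hb : b ∈ sublevel q β J c) (h : valley β J c a = valley β J c b) :
    CompactJoined β J c a b := by
  have hpre : IsPreconnected (valley β J c a) := isPreconnected_connectedComponentIn
  refine hpre.induction₂ (fun x y => CompactJoined β J c x y) ?_ ?_ ?_
    (mem_connectedComponentIn ha) (h ▸ mem_connectedComponentIn hb)
  · intro x hx
    have hxs := valley_subset _ hx
    obtain ⟨r, hr, hball⟩ := exists_ball_subset_sublevel hxs.2
    filter_upwards [mem_nhdsWithin_of_mem_nhds (Metric.ball_mem_nhds x hr),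
      self_mem_nhdsWithin] with y hy hyv
    have hys := valley_subset _ hyv
    have hconv := (convex_ball x r).inter (convex_Xi2 (q := q))
    refine ⟨segment ℝ x y, (hconv.segment_subset ⟨Metric.mem_ball_self hr, hxs.1⟩
      ⟨hy, hys.1⟩).trans hball, (convex_segment x y).isPreconnected, ?_,
      left_mem_segment ℝ x y, right_mem_segment ℝ x y⟩
    rw [segment_eq_image_lineMap]
    exact isCompact_Icc.image AffineMap.lineMap_continuous
  · rintro x y z - - - ⟨C, h1, h2, h3, h4, h5⟩ ⟨D, g1, g2, g3, g4, g5⟩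
    exact ⟨C ∪ D, Set.union_subset h1 g1, h2.union y h5 g4 g2, h3.union g3, Or.inl h4, Or.inr g5⟩
  · rintro x y - - ⟨C, h1, h2, h3, h4, h5⟩
    exact ⟨C, h1, h2, h3, h5, h4⟩

theorem closure_valley_subset (a : (Fin q → ℝ) × (Fin q → ℝ)) :
    closure (valley β J c a) ⊆ {z | z ∈ Xi2 q ∧ F β J z ≤ c} := by
  have hcl : IsClosed {z | z ∈ Xi2 q ∧ F β J z ≤ c} :=
    isClosed_Xi2.inter (isClosed_le (continuous_F β J) continuous_const)
  exact closure_minimal (fun z hz => ⟨(valley_subset _ hz).1, (valley_subset _ hz).2.le⟩) hcl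

/-- Every valley contains a local minimum. -/
theorem exists_isLocalMinimum_valley_eq {z : (Fin q → ℝ) × (Fin q → ℝ)}
    (hz : z ∈ sublevel q β J c) : ∃ l, IsLocalMinimum β J l ∧ F β J l < c ∧
      valley β J c l = valley β J c z := by
  have hcomp : IsCompact (closure (valley β J c z)) :=
    isCompact_Xi2.of_isClosed_subset isClosed_closure fun x hx => (closure_valley_subset z hx).1
  have hzv : z ∈ valley β J c z := mem_connectedComponentIn hz
  obtain ⟨w, hw, hmin⟩ := hcomp.exists_isMinOn ⟨z, subset_closure hzv⟩
    (continuous_F β J).continuousOn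
  have hwz : F β J w ≤ F β J z := hmin (subset_closure hzv)
  have hwc : F β J w < c := hwz.trans_lt hz.2
  have hwX := (closure_valley_subset z hw).1
  obtain ⟨r, hr, hball⟩ := exists_ball_subset_sublevel hwc
  have hpre : IsPreconnected (Metric.ball w r ∩ Xi2 q) :=
    ((convex_ball w r).inter convex_Xi2).isPreconnected
  have hwB : w ∈ Metric.ball w r ∩ Xi2 q := ⟨Metric.mem_ball_self hr, hwX⟩
  obtain ⟨y, hy, hyv⟩ := mem_closure_iff_nhds.1 hw _ (Metric.ball_mem_nhds w hr)
  have hyB : y ∈ Metric.ball w r ∩ Xi2 q := ⟨hy, (valley_subset _ hyv).1⟩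
  have hyz : valley β J c z = valley β J c y := connectedComponentIn_eq hyv
  have heq : ∀ x ∈ Metric.ball w r ∩ Xi2 q, valley β J c x = valley β J c z := fun x hx => by
    rw [hyz]; exact valley_eq_of_isPreconnected hpre hball hx hyB
  refine ⟨w, ⟨hwX, ?_⟩, hwc, heq w hwB⟩
  filter_upwards [mem_nhdsWithin_of_mem_nhds (Metric.ball_mem_nhds w hr),
    self_mem_nhdsWithin] with x hx hxX
  refine hmin (subset_closure ?_)
  rw [← heq x ⟨hx, hxX⟩]
  exact mem_connectedComponentIn (hball ⟨hx, hxX⟩)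

theorem mem_closure_sublevel_of_not_isLocalMinimum {z : (Fin q → ℝ) × (Fin q → ℝ)}
    (hz : z ∈ Xi2 q) (h : ¬ IsLocalMinimum β J z) : z ∈ closure (sublevel q β J (F β J z)) := by
  rw [mem_closure_iff_nhds]
  intro U hU
  by_contra hc
  refine h ⟨hz, ?_⟩
  filter_upwards [mem_nhdsWithin_of_mem_nhds hU, self_mem_nhdsWithin] with x hx hxX
  by_contra hlt
  exact hc ⟨x, hx, hxX, not_le.1 hlt⟩

/-- A mountain pass theorem: if there are only finitely many local minima, two different ones
force a lowest saddle. -/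
theorem exists_isLowestSaddle (hβ : 0 < β) (hJ : 0 < J)
    (hfin : {l : (Fin 3 → ℝ) × (Fin 3 → ℝ) | IsLocalMinimum β J l}.Finite)
    {a b : (Fin 3 → ℝ) × (Fin 3 → ℝ)} (ha : IsLocalMinimum β J a) (hb : IsLocalMinimum β J b)
    (hab : a ≠ b) : ∃ p : (Fin 3 → ℝ) × (Fin 3 → ℝ), IsLowestSaddle β J p := by
  by_contra! hno
  set T := {t : ℝ | CompactJoined β J t a b} with hT
  have hTne : T.Nonempty := by
    obtain ⟨x, -, hmax⟩ := isCompact_Xi2.exists_isMaxOn ⟨a, ha.1⟩ (continuous_F β J).continuousOn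
    refine ⟨F β J x + 1, Xi2 3, fun z hz => ⟨hz, ?_⟩, convex_Xi2.isPreconnected, isCompact_Xi2,
      ha.1, hb.1⟩
    have : F β J z ≤ F β J x := hmax hz
    linarith
  have hTb : BddBelow T := ⟨F β J a, fun t ⟨C, h1, _, _, h4, _⟩ => (h1 h4).2.le⟩
  set c := sInf T with hc
  have hFa : F β J a ≤ c := le_csInf hTne fun t ⟨C, h1, _, _, h4, _⟩ => (h1 h4).2.le
  have hFb : F β J b ≤ c := le_csInf hTne fun t ⟨C, h1, _, _, _, h5⟩ => (h1 h5).2.le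
  have hgt : ∀ t, c < t → CompactJoined β J t a b := by
    intro t ht
    obtain ⟨t', ht', hlt⟩ := exists_lt_of_csInf_lt hTne ht
    exact CompactJoined.mono ht' hlt.le
  -- The infimum is not attained: F has a maximum below c on a compact join, so a smaller level
  -- would do.
  have hnot : ¬ CompactJoined β J c a b := by
    rintro ⟨C, h1, h2, h3, h4, h5⟩
    obtain ⟨x, hx, hmax⟩ := h3.exists_isMaxOn ⟨a, h4⟩ (continuous_F β J).continuousOn
    have hxc := (h1 hx).2
    have : (F β J x + c) / 2 ∈ T := by
      refine ⟨C, fun z hz => ⟨(h1 hz).1, ?_⟩, h2, h3, h4, h5⟩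
      have : F β J z ≤ F β J x := hmax hz
      linarith
    have := csInf_le hTb this
    linarith
  set M := {l : (Fin 3 → ℝ) × (Fin 3 → ℝ) | IsLocalMinimum β J l ∧ F β J l ≤ c} with hM
  have hMfin : M.Finite := hfin.subset fun l hl => hl.1
  classical
  -- A minimum at level exactly c has an empty valley below c, so it is represented by itself. These
  -- finitely many closed pieces cover {F ≤ c}.
  set Q : (Fin 3 → ℝ) × (Fin 3 → ℝ) → Set ((Fin 3 → ℝ) × (Fin 3 → ℝ)) := fun l =>
    if F β J l < c then closure (valley β J c l) else {l} with hQ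
  have hQlt : ∀ {l}, F β J l < c → Q l = closure (valley β J c l) := fun h => if_pos h
  have hQeq : ∀ {l}, ¬ F β J l < c → Q l = {l} := fun h => if_neg h
  have hQc : ∀ l, IsCompact (Q l) := by
    intro l
    by_cases h : F β J l < c
    · rw [hQlt h]
      exact isCompact_Xi2.of_isClosed_subset isClosed_closure
        fun x hx => (closure_valley_subset l hx).1
    · rw [hQeq h]; exact isCompact_singleton
  have hself : ∀ {l}, l ∈ M → l ∈ Q l := by
    intro l hl
    by_cases h : F β J l < c
    · rw [hQlt h]; exact subset_closure (mem_connectedComponentIn ⟨hl.1.1, h⟩)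
    · rw [hQeq h]; rfl
  have hcover : ∀ z ∈ Xi2 3, F β J z ≤ c → ∃ l ∈ M, z ∈ Q l := by
    intro z hz hzc
    rcases lt_or_eq_of_le hzc with hlt | heq
    · obtain ⟨l, hl, hlc, hv⟩ := exists_isLocalMinimum_valley_eq ⟨hz, hlt⟩
      refine ⟨l, ⟨hl, hlc.le⟩, ?_⟩
      rw [hQlt hlc, hv]
      exact subset_closure (mem_connectedComponentIn ⟨hz, hlt⟩)
    · by_cases hzm : IsLocalMinimum β J z
      · exact ⟨z, ⟨hzm, hzc⟩, hself ⟨hzm, hzc⟩⟩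
      · have hcl := mem_closure_sublevel_of_not_isLocalMinimum hz hzm
        rw [heq] at hcl
        have hsub : sublevel 3 β J c ⊆ ⋃ l ∈ M, Q l := by
          intro y hy
          obtain ⟨l, hl, hlc, hv⟩ := exists_isLocalMinimum_valley_eq hy
          refine Set.mem_biUnion (x := l) ⟨hl, hlc.le⟩ ?_
          rw [hQlt hlc, hv]
          exact subset_closure (mem_connectedComponentIn hy)
        have hcl2 : z ∈ ⋃ l ∈ M, Q l :=
          closure_minimal hsub (hMfin.isCompact_biUnion fun l _ => hQc l).isClosed hcl
        simpa using hcl2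
  -- The minima whose piece belongs with a.
  set R : (Fin 3 → ℝ) × (Fin 3 → ℝ) → Prop := fun l =>
    l = a ∨ (F β J l < c ∧ F β J a < c ∧ valley β J c l = valley β J c a) with hR
  have hRb : ¬ R b := by
    rintro (h | ⟨h1, h2, h3⟩)
    · exact hab h.symm
    · exact hnot (compactJoined_of_valley_eq ⟨ha.1, h2⟩ ⟨hb.1, h1⟩ h3.symm)
  -- A common point of the closures of two different valleys lies at level c and is critical, hence
  -- a lowest saddle; a minimum at level c lies in no such closure.
  have hdisj : ∀ l ∈ M, ∀ l' ∈ M, R l → ¬ R l' → Disjoint (Q l) (Q l') := by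
    intro l hl l' hl' hRl hRl'
    rw [Set.disjoint_left]
    intro x hx hx'
    by_cases h : F β J l < c <;> by_cases h' : F β J l' < c
    · rw [hQlt h] at hx
      rw [hQlt h'] at hx'
      have hv : valley β J c l ≠ valley β J c l' := by
        intro he
        refine hRl' (Or.inr ⟨h', ?_⟩)
        rcases hRl with rfl | ⟨-, h2, h3⟩
        · exact ⟨h, he.symm⟩
        · exact ⟨h2, he.symm.trans h3⟩
      obtain ⟨hxX, hxc⟩ := closure_valley_subset l hx
      have hFx : F β J x = c := by
        by_contra hne
        exact hv ((locJoined_of_lt (lt_of_le_of_ne hxc hne)).valley_eq hx hx')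
      refine hno x ⟨?_, l, l', hl.1, hl'.1, ?_⟩
      · by_contra hcrit
        have := (hasDescent_of_not_isCriticalPoint hβ hJ hxX hcrit).locJoined hxX
        rw [hFx] at this
        exact hv (this.valley_eq hx hx')
      · rw [hFx]
        exact ⟨h, h', hv, hx, hx'⟩
    · rw [hQlt h] at hx
      rw [hQeq h', Set.mem_singleton_iff] at hx'
      have hFl : F β J l' = c := le_antisymm hl'.2 (not_lt.1 h')
      subst hx'
      rw [← hFl] at hx
      exact hl'.1.not_mem_closure hx
    · rw [hQlt h'] at hx'
      rw [hQeq h, Set.mem_singleton_iff] at hx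
      have hFl : F β J l = c := le_antisymm hl.2 (not_lt.1 h)
      subst hx
      rw [← hFl] at hx'
      exact hl.1.not_mem_closure hx'
    · rw [hQeq h, Set.mem_singleton_iff] at hx
      rw [hQeq h', Set.mem_singleton_iff] at hx'
      exact hRl' (hx' ▸ hx ▸ hRl)
  set P₁ := ⋃ l ∈ {l | l ∈ M ∧ R l}, Q l with hP₁
  set P₂ := ⋃ l ∈ {l | l ∈ M ∧ ¬ R l}, Q l with hP₂
  have hc1 : IsCompact P₁ := (hMfin.subset fun l hl => hl.1).isCompact_biUnion fun l _ => hQc l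
  have hc2 : IsCompact P₂ := (hMfin.subset fun l hl => hl.1).isCompact_biUnion fun l _ => hQc l
  have hd12 : Disjoint P₁ P₂ := by
    rw [Set.disjoint_left]
    intro x hx hx'
    simp only [hP₁, hP₂, Set.mem_iUnion] at hx hx'
    obtain ⟨l, hl, hxl⟩ := hx
    obtain ⟨l', hl', hxl'⟩ := hx'
    exact Set.disjoint_left.1 (hdisj l hl.1 l' hl'.1 hl.2 hl'.2) hxl hxl'
  obtain ⟨U, V, hU, hV, hPU, hPV, hUV⟩ := SeparatedNhds.of_isCompact_isCompact hc1 hc2 hd12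
  -- On the compact set outside U ∪ V the minimum of F exceeds c, so a and b remain separated
  -- slightly above c, against the definition of c.
  obtain ⟨t, ht, hsub⟩ : ∃ t, c < t ∧ sublevel 3 β J t ⊆ U ∪ V := by
    have hK : IsCompact (Xi2 3 \ (U ∪ V)) := isCompact_Xi2.diff (hU.union hV)
    rcases (Xi2 3 \ (U ∪ V)).eq_empty_or_nonempty with he | hne
    · refine ⟨c + 1, by linarith, fun z hz => ?_⟩
      by_contra hzn
      exact Set.notMem_empty z (he ▸ ⟨hz.1, hzn⟩)
    · obtain ⟨x, hx, hmin⟩ := hK.exists_isMinOn hne (continuous_F β J).continuousOn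
      refine ⟨F β J x, ?_, fun z hz => ?_⟩
      · by_contra hle
        obtain ⟨l, hl, hxl⟩ := hcover x hx.1 (not_lt.1 hle)
        by_cases hRl : R l
        · exact hx.2 (Or.inl (hPU (Set.mem_biUnion (x := l) ⟨hl, hRl⟩ hxl)))
        · exact hx.2 (Or.inr (hPV (Set.mem_biUnion (x := l) ⟨hl, hRl⟩ hxl)))
      · by_contra hzn
        have : F β J x ≤ F β J z := hmin ⟨hz.1, hzn⟩
        linarith [hz.2]
  obtain ⟨C, h1, h2, -, h4, h5⟩ := hgt t ht
  have haM : a ∈ M := ⟨ha, hFa⟩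
  have hbM : b ∈ M := ⟨hb, hFb⟩
  have haU : a ∈ U := hPU (Set.mem_biUnion (x := a) ⟨haM, Or.inl rfl⟩ (hself haM))
  have hbV : b ∈ V := hPV (Set.mem_biUnion (x := b) ⟨hbM, hRb⟩ (hself hbM))
  obtain ⟨x, -, hxU, hxV⟩ := h2 U V hU hV (h1.trans hsub) ⟨a, h4, haU⟩ ⟨b, h5, hbV⟩
  exact Set.disjoint_left.1 hUV hxU hxV

/-! ### Symmetry -/

/-- Relabelling the spins. -/
def permute (σ : Equiv.Perm (Fin 3)) (p : (Fin 3 → ℝ) × (Fin 3 → ℝ)) :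
    (Fin 3 → ℝ) × (Fin 3 → ℝ) := (p.1 ∘ σ, p.2 ∘ σ)

theorem F_permute (β J : ℝ) (σ : Equiv.Perm (Fin 3)) (p : (Fin 3 → ℝ) × (Fin 3 → ℝ)) :
    F β J (permute σ p) = F β J p := by
  simp only [F, energy, entropy, permute, Function.comp_apply]
  rw [Equiv.sum_comp σ fun i => 1 / 2 * p.1 i ^ 2, Equiv.sum_comp σ fun i => 1 / 2 * p.2 i ^ 2,
    Equiv.sum_comp σ fun i => p.1 i * p.2 i, Equiv.sum_comp σ fun i => p.1 i * Real.log (p.1 i),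
    Equiv.sum_comp σ fun i => p.2 i * Real.log (p.2 i)]

theorem d2F_permute (β J : ℝ) (σ : Equiv.Perm (Fin 3)) (p w : (Fin 3 → ℝ) × (Fin 3 → ℝ)) :
    d2F β J (permute σ p) (permute σ w) = d2F β J p w := by
  simp only [d2F, permute, Function.comp_apply]
  rw [Equiv.sum_comp σ fun i => w.1 i ^ 2, Equiv.sum_comp σ fun i => w.2 i ^ 2,
    Equiv.sum_comp σ fun i => 2 * (w.1 i * w.2 i), Equiv.sum_comp σ fun i => w.1 i ^ 2 / p.1 i,
    Equiv.sum_comp σ fun i => w.2 i ^ 2 / p.2 i]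

theorem Tangent.permute {w : (Fin 3 → ℝ) × (Fin 3 → ℝ)} (h : Tangent w)
    (σ : Equiv.Perm (Fin 3)) : Tangent (permute σ w) := by
  simp only [Tangent, CWP.permute, Function.comp_apply]
  rw [Equiv.sum_comp σ w.1, Equiv.sum_comp σ w.2]
  exact h

theorem permute_mem_Xi2 {p : (Fin 3 → ℝ) × (Fin 3 → ℝ)} (hp : p ∈ Xi2 3)
    (σ : Equiv.Perm (Fin 3)) : permute σ p ∈ Xi2 3 := by
  rw [mem_Xi2_iff] at hp ⊢
  simp only [permute, Function.comp_apply]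
  rw [Equiv.sum_comp σ p.1, Equiv.sum_comp σ p.2]
  exact ⟨fun i => hp.1 _, fun i => hp.2.1 _, hp.2.2⟩

theorem permute_inv_permute (σ : Equiv.Perm (Fin 3)) (p : (Fin 3 → ℝ) × (Fin 3 → ℝ)) :
    permute σ⁻¹ (permute σ p) = p := by
  refine Prod.ext ?_ ?_ <;> funext i <;> simp [permute]

theorem continuous_permute (σ : Equiv.Perm (Fin 3)) : Continuous (permute σ) := by
  unfold permute Function.comp
  fun_prop

theorem IsLocalMinimum.permute {β J : ℝ} {p : (Fin 3 → ℝ) × (Fin 3 → ℝ)}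
    (h : IsLocalMinimum β J p) (σ : Equiv.Perm (Fin 3)) :
    IsLocalMinimum β J (permute σ p) := by
  refine ⟨permute_mem_Xi2 h.1 σ, ?_⟩
  have ht : Filter.Tendsto (CWP.permute σ⁻¹) (nhdsWithin (CWP.permute σ p) (Xi2 3))
      (nhdsWithin p (Xi2 3)) := by
    refine tendsto_nhdsWithin_iff.2 ⟨?_, ?_⟩
    · have := (continuous_permute σ⁻¹).tendsto (CWP.permute σ p)
      rw [permute_inv_permute] at this
      exact this.mono_left nhdsWithin_le_nhds
    · filter_upwards [self_mem_nhdsWithin] with z hz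
      exact permute_mem_Xi2 hz σ⁻¹
  filter_upwards [ht.eventually h.2] with z hz
  rw [F_permute] at hz ⊢
  exact hz

/-! ### Synchronized critical points -/

/-- The synchronized pair with magnetization `(s, s, 1 - 2s)`. -/
noncomputable def syncPoint (s : ℝ) : (Fin 3 → ℝ) × (Fin 3 → ℝ) :=
  (![s, s, 1 - 2 * s], ![s, s, 1 - 2 * s])

theorem permute_syncPoint (σ : Equiv.Perm (Fin 3)) (s : ℝ) :
    permute σ (syncPoint s) = (![s, s, 1 - 2 * s] ∘ σ, ![s, s, 1 - 2 * s] ∘ σ) := rfl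

theorem mem_S2_iff {β : ℝ} {p : (Fin 3 → ℝ) × (Fin 3 → ℝ)} :
    p ∈ S2 β ↔ beta1 < β ∧ ∃ σ, p = permute σ (syncPoint (xs β)) := by
  constructor
  · rintro ⟨h, _, ⟨σ, rfl⟩, rfl⟩; exact ⟨h, σ, rfl⟩
  · rintro ⟨h, σ, rfl⟩; exact ⟨h, _, ⟨σ, rfl⟩, rfl⟩

theorem mem_L2_iff {β : ℝ} {p : (Fin 3 → ℝ) × (Fin 3 → ℝ)} :
    p ∈ L2 β ↔ beta1 < β ∧ ∃ σ, p = permute σ (syncPoint (xl β)) := by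
  constructor
  · rintro ⟨h, _, ⟨σ, rfl⟩, rfl⟩; exact ⟨h, σ, rfl⟩
  · rintro ⟨h, σ, rfl⟩; exact ⟨h, _, ⟨σ, rfl⟩, rfl⟩

theorem syncPoint_one_third : syncPoint (1 / 3) = q3 := by
  refine Prod.ext ?_ ?_ <;> funext i <;> fin_cases i <;> simp [syncPoint, q3] <;> norm_num

theorem permute_q3 (σ : Equiv.Perm (Fin 3)) : permute σ q3 = q3 := rfl

/-- A line meets the strictly concave graph of log at most twice. -/
theorem eq_or_eq_or_eq_of_log_eq {β c x y z : ℝ} (hx : 0 < x) (hy : 0 < y) (hz : 0 < z)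
    (h1 : Real.log x = β * x + c) (h2 : Real.log y = β * y + c) (h3 : Real.log z = β * z + c) :
    x = y ∨ x = z ∨ y = z := by
  have key : ∀ {a b d : ℝ}, 0 < a → a < b → b < d → Real.log a = β * a + c →
      Real.log b = β * b + c → Real.log d = β * d + c → False := by
    intro a b d ha hab hbd e1 e2 e3
    have := strictConcaveOn_log_Ioi.slope_anti_adjacent (Set.mem_Ioi.2 ha)
      (Set.mem_Ioi.2 (ha.trans (hab.trans hbd))) hab hbd
    rw [e1, e2, e3, div_lt_div_iff₀ (by linarith) (by linarith)] at this
    nlinarith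
  by_contra! hc
  obtain ⟨h12, h13, h23⟩ := hc
  rcases lt_or_gt_of_ne h12 with a | a <;> rcases lt_or_gt_of_ne h13 with b | b <;>
    rcases lt_or_gt_of_ne h23 with d | d
  · exact key hx a d h1 h2 h3
  · exact key hx b d h1 h3 h2
  · linarith
  · exact key hz b a h3 h1 h2
  · exact key hy a b h2 h1 h3
  · linarith
  · exact key hy d b h2 h3 h1
  · exact key hz d a h3 h2 h1

theorem eq_permute_syncPoint_of_isCriticalPoint {β J : ℝ} (hβ : 0 < β) (hJ : 0 < J)
    {p : (Fin 3 → ℝ) × (Fin 3 → ℝ)} (h : IsCriticalPoint β J p) (hs : p.1 = p.2) :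
    p = q3 ∨ ∃ s ∈ xiSolutions β, ∃ σ, p = permute σ (syncPoint s) := by
  obtain ⟨⟨c, hc⟩, -⟩ := exists_log_eq_of_isCriticalPoint hβ hJ h
  obtain ⟨hX, hpos, -⟩ := isCriticalPoint_iff.1 h
  obtain ⟨-, -, hsum, -⟩ := mem_Xi2_iff.1 hX
  obtain ⟨x, y⟩ := p
  simp only at hs
  subst hs
  simp only at hc hsum
  have hpos : ∀ i, 0 < x i := hpos.1
  have hc' : ∀ i, Real.log (x i) = β * x i + c := by
    intro i
    rw [hc i]
    field_simp
  rw [Fin.sum_univ_three] at hsum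
  have main : ∀ {s u : ℝ} (σ : Equiv.Perm (Fin 3)), 0 < s → 0 < u → 2 * s + u = 1 →
      Real.log s = β * s + c → Real.log u = β * u + c → x = ![s, s, 1 - 2 * s] ∘ σ →
      (x, x) = q3 ∨ ∃ s ∈ xiSolutions β, ∃ σ, (x, x) = permute σ (syncPoint s) := by
    intro s u σ hs0 hu0 hsu l1 l2 hx
    have hx' : (x, x) = permute σ (syncPoint s) := by rw [permute_syncPoint, ← hx]
    by_cases h3 : s = 1 / 3
    · left
      rw [hx', h3, syncPoint_one_third, permute_q3]
    · right
      refine ⟨s, ⟨⟨hs0, by linarith⟩, ?_⟩, σ, hx'⟩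
      have e := one_sub_mul_xi (x := s) ⟨hs0, by linarith⟩
      rw [show 1 - 2 * s = u by linarith, l1, l2] at e
      have h4 : 1 - 3 * s ≠ 0 := fun h4 => h3 (by linarith)
      have : (1 - 3 * s) * xi s = (1 - 3 * s) * β := by
        rw [e, show u = 1 - 2 * s by linarith]; ring
      exact mul_left_cancel₀ h4 this
  rcases eq_or_eq_or_eq_of_log_eq (hpos 0) (hpos 1) (hpos 2) (hc' 0) (hc' 1) (hc' 2) with e | e | e
  · refine main (s := x 0) 1 (hpos 0) (hpos 2) (by linarith) (hc' 0) (hc' 2) ?_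
    funext i
    fin_cases i <;> simp <;> linarith
  · refine main (s := x 0) (Equiv.swap 1 2) (hpos 0) (hpos 1) (by linarith) (hc' 0) (hc' 1) ?_
    funext i
    fin_cases i
    · simp [Equiv.swap_apply_of_ne_of_ne]
    · simp; linarith
    · simp; linarith
  · refine main (s := x 1) (Equiv.swap 0 2) (hpos 1) (hpos 0) (by linarith) (hc' 1) (hc' 0) ?_
    funext i
    fin_cases i
    · simp; linarith
    · simp [Equiv.swap_apply_of_ne_of_ne]
    · simp; linarith

/-! ### Negative directions at synchronized points -/

theorem d2F_sync (β J a b : ℝ) (x w : Fin 3 → ℝ) :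
    d2F β J (x, x) (a • w, b • w) = (a ^ 2 + b ^ 2) *
      ((1 + J) / β * ∑ i, w i ^ 2 / x i - ∑ i, w i ^ 2) - 2 * J * a * b * ∑ i, w i ^ 2 := by
  simp only [d2F, Fin.sum_univ_three, Pi.smul_apply, smul_eq_mul]
  ring

/-- The Hessian is diagonal in (w, w) and (w, -w). The hypothesis is negativity on (w, -w); on (w,
w) the form is smaller still because J > 0. -/
theorem locJoined_of_neg {β J s : ℝ} {σ : Equiv.Perm (Fin 3)} {w : Fin 3 → ℝ} (hJ : 0 < J)
    (hp : IsCriticalPoint β J (permute σ (syncPoint s))) (hw : ∑ i, w i = 0)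
    (hneg : (1 + J) / β * ∑ i, w i ^ 2 / (syncPoint s).1 i < (1 - J) * ∑ i, w i ^ 2) :
    LocJoined β J (F β J (permute σ (syncPoint s))) (permute σ (syncPoint s)) ∧
      ¬ IsLocalMinimum β J (permute σ (syncPoint s)) := by
  have hd : ∀ φ : ℝ, d2F β J (permute σ (syncPoint s)) (Real.cos φ • permute σ (w, w) +
      Real.sin φ • permute σ (w, -w)) < 0 := by
    intro φ
    have e : Real.cos φ • permute σ (w, w) + Real.sin φ • permute σ (w, -w) =
        permute σ ((Real.cos φ + Real.sin φ) • w, (Real.cos φ - Real.sin φ) • w) := by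
      refine Prod.ext ?_ ?_ <;> funext i <;> simp [permute] <;> ring
    rw [e, d2F_permute]
    have := d2F_sync β J (Real.cos φ + Real.sin φ) (Real.cos φ - Real.sin φ) (syncPoint s).1 w
    rw [show syncPoint s = ((syncPoint s).1, (syncPoint s).1) from rfl, this]
    set W := ∑ i, w i ^ 2 / (syncPoint s).1 i
    set V := ∑ i, w i ^ 2
    have hV : 0 ≤ V := Finset.sum_nonneg fun i _ => sq_nonneg _
    have hcs := Real.cos_sq_add_sin_sq φ
    have h1 : ((Real.cos φ + Real.sin φ) ^ 2 + (Real.cos φ - Real.sin φ) ^ 2) *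
        ((1 + J) / β * W - V) - 2 * J * (Real.cos φ + Real.sin φ) *
        (Real.cos φ - Real.sin φ) * V =
        2 * (Real.cos φ ^ 2 + Real.sin φ ^ 2) * ((1 + J) / β * W - (1 - J) * V) -
          4 * J * V * Real.cos φ ^ 2 := by ring
    rw [h1, hcs]
    have : 0 ≤ J * V * Real.cos φ ^ 2 := by positivity
    linarith
  have ht1 : Tangent (permute σ (w, w)) := Tangent.permute (w := (w, w)) ⟨hw, hw⟩ σ
  have ht2 : Tangent (permute σ (w, -w)) :=
    Tangent.permute (w := (w, -w)) ⟨hw, by simp [hw]⟩ σ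
  refine ⟨locJoined_of_index_two hp ht1 ht2 hd, not_isLocalMinimum_of_d2F_neg hp ht1 ?_⟩
  simpa using hd 0

theorem locJoined_q3 {β J : ℝ} (hJ : 0 < J) (h3 : 3 < β) (hp : IsCriticalPoint β J q3) :
    LocJoined β J (F β J q3) q3 ∧ ¬ IsLocalMinimum β J q3 := by
  have hd : ∀ φ : ℝ, d2F β J q3 (Real.cos φ • (![1, -1, 0], ![1, -1, 0]) +
      Real.sin φ • (![1, 1, -2], ![1, 1, -2])) < 0 := by
    intro φ
    have hlt : 3 * ((1 + J) / β) < 1 + J := by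
      rw [mul_div_assoc', div_lt_iff₀ (by linarith)]
      nlinarith
    have e : d2F β J q3 (Real.cos φ • (![1, -1, 0], ![1, -1, 0]) +
        Real.sin φ • (![1, 1, -2], ![1, 1, -2])) =
        (4 * Real.cos φ ^ 2 + 12 * Real.sin φ ^ 2) *
          (3 * ((1 + J) / β) - (1 + J)) := by
      simp [d2F, q3, Fin.sum_univ_three]
      ring
    rw [e]
    refine mul_neg_of_pos_of_neg ?_ (by linarith)
    linarith [Real.cos_sq_add_sin_sq φ, sq_nonneg (Real.sin φ)]
  have ht1 : Tangent ((![1, -1, 0], ![1, -1, 0]) : (Fin 3 → ℝ) × (Fin 3 → ℝ)) := by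
    simp [Tangent, Fin.sum_univ_three]
  have ht2 : Tangent ((![1, 1, -2], ![1, 1, -2]) : (Fin 3 → ℝ) × (Fin 3 → ℝ)) := by
    constructor <;> simp [Fin.sum_univ_three] <;> norm_num
  refine ⟨locJoined_of_index_two hp ht1 ht2 hd, not_isLocalMinimum_of_d2F_neg hp ht1 ?_⟩
  simpa using hd 0

/-! ### Local minima at synchronized points -/

/-- The second derivative 1/t of t log t is at least 1/(ηp) for t ≤ ηp, so the parabola of that
curvature tangent at p stays below. -/
theorem mul_log_ge {η p t : ℝ} (hη : 1 < η) (hp : 0 < p) (ht : 0 ≤ t) (htp : t ≤ η * p) :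
    p * Real.log p + (1 + Real.log p) * (t - p) + (t - p) ^ 2 / (2 * η * p) ≤ t * Real.log t := by
  set h : ℝ → ℝ := fun u => u * Real.log u - u + 1 - (u - 1) ^ 2 / (2 * η) with hh
  have hcont : Continuous h := by
    have := Real.continuous_mul_log
    fun_prop
  have hder : ∀ u : ℝ, 0 < u → HasDerivAt h (Real.log u - (u - 1) / η) u := by
    intro u hu
    have h1 := Real.hasDerivAt_mul_log hu.ne'
    have h2 := (((hasDerivAt_id u).sub_const 1).pow 2).div_const (2 * η)
    refine (((h1.sub (hasDerivAt_id u)).add_const 1).sub h2).congr_deriv ?_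
    simp only [id]
    field_simp
    ring
  have h1 : h 1 = 0 := by simp [hh]
  have key : ∀ u ∈ Set.Icc 0 η, 0 ≤ h u := by
    intro u hu
    rw [← h1]
    rcases le_total u 1 with hu1 | hu1
    · have : AntitoneOn h (Set.Icc 0 1) := by
        apply antitoneOn_of_deriv_nonpos (convex_Icc _ _) hcont.continuousOn
        · rw [interior_Icc]
          exact fun x hx => (hder x hx.1).differentiableAt.differentiableWithinAt
        · rw [interior_Icc]
          intro x hx
          rw [(hder x hx.1).deriv]
          have a1 := Real.log_le_sub_one_of_pos hx.1
          have a2 : x - 1 ≤ (x - 1) / η := by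
            rw [le_div_iff₀ (by linarith)]
            nlinarith [hx.2]
          linarith
      exact this ⟨hu.1, hu1⟩ ⟨zero_le_one, le_rfl⟩ hu1
    · have : MonotoneOn h (Set.Icc 1 η) := by
        apply monotoneOn_of_deriv_nonneg (convex_Icc _ _) hcont.continuousOn
        · rw [interior_Icc]
          exact fun x hx => (hder x (by linarith [hx.1])).differentiableAt.differentiableWithinAt
        · rw [interior_Icc]
          intro x hx
          have hx0 : 0 < x := by linarith [hx.1]
          rw [(hder x hx0).deriv]
          have a1 := Real.one_sub_inv_le_log_of_pos hx0
          have a2 : (x - 1) / η ≤ (x - 1) / x :=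
            div_le_div_of_nonneg_left (by linarith [hx.1]) hx0 hx.2.le
          have a3 : (x - 1) / x = 1 - x⁻¹ := by field_simp
          linarith
      exact this ⟨le_rfl, hη.le⟩ ⟨hu1, hu.2⟩ hu1
  have hu := key (t / p) ⟨by positivity, by rw [div_le_iff₀ hp]; exact htp⟩
  have hlog : t * Real.log t = t * Real.log (t / p) + t * Real.log p := by
    rcases eq_or_lt_of_le ht with h0 | h0
    · simp [← h0]
    · rw [Real.log_div h0.ne' hp.ne']; ring
  have hu2 : 0 ≤ p * h (t / p) := mul_nonneg hp.le hu
  have e : p * h (t / p) = t * Real.log (t / p) - t + p - (t - p) ^ 2 / (2 * η * p) := by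
    simp only [hh]
    field_simp
  rw [e] at hu2
  rw [hlog]
  linarith

/-- The free energy of a single component. -/
noncomputable def oneF (β : ℝ) (x : Fin 3 → ℝ) : ℝ :=
  ∑ i, (-(x i ^ 2 / 2) + 1 / β * (x i * Real.log (x i)))

theorem F_eq_oneF (β J : ℝ) (p : (Fin 3 → ℝ) × (Fin 3 → ℝ)) :
    F β J p = (1 + J) * (oneF β p.1 + oneF β p.2) + J / 2 * ∑ i, (p.1 i - p.2 i) ^ 2 := by
  simp only [F, energy, entropy, oneF, Fin.sum_univ_three]
  ring

/-- By `F_eq_oneF` the coupling only adds a multiple of |x - y|², so a local minimum of the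
one-component energy suffices. The two strict inequalities express positivity of its Hessian along
(1, -1, 0) and (1, 1, -2). -/
theorem isLocalMinimum_syncPoint {β J s : ℝ} (hβ : 0 < β) (hJ : 0 < J)
    (hs : s ∈ Set.Ioo (0 : ℝ) (1 / 2))
    (hc : Real.log (1 - 2 * s) - Real.log s = β * (1 - 3 * s)) (h1 : s * β < 1)
    (h2 : β < 1 / (3 * s * (1 - 2 * s))) : IsLocalMinimum β J (syncPoint s) := by
  have hs0 := hs.1
  have hu : 0 < 1 - 2 * s := by linarith [hs.2]
  -- The slack in the two strict inequalities is spent on η > 1, the size of the neighbourhood where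
  -- the quadratic bound holds.
  set η := min (1 / (s * β)) (1 / (3 * s * (1 - 2 * s)) / β) with hη
  have hη1 : 1 < η := by
    refine lt_min ?_ ?_
    · rw [lt_div_iff₀ (by positivity)]; linarith
    · rw [lt_div_iff₀ hβ]; linarith
  have hηa : η * (s * β) ≤ 1 := by
    rw [← le_div_iff₀ (by positivity)]; exact min_le_left _ _
  have hηb : η * (3 * s * (1 - 2 * s) * β) ≤ 1 := by
    rw [← le_div_iff₀ (by positivity)]
    refine (min_le_right _ _).trans (le_of_eq ?_)
    rw [div_div]
  set x : Fin 3 → ℝ := ![s, s, 1 - 2 * s] with hx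
  have hxp : ∀ i, 0 < x i := by intro i; fin_cases i <;> simp [hx, hs0, hu]
  have hone : ∀ z : Fin 3 → ℝ, (∀ i, 0 ≤ z i) → ∑ i, z i = 1 → (∀ i, z i ≤ η * x i) →
      oneF β x ≤ oneF β z := by
    intro z hz hzs hzη
    have hterm : ∀ i, -(x i ^ 2 / 2) + 1 / β * (x i * Real.log (x i)) +
        (z i - x i) * (1 / β * (1 + Real.log (x i)) - x i) +
        (z i - x i) ^ 2 / 2 * (1 / (β * η * x i) - 1) ≤
        -(z i ^ 2 / 2) + 1 / β * (z i * Real.log (z i)) := by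
      intro i
      have := mul_le_mul_of_nonneg_left (mul_log_ge hη1 (hxp i) (hz i) (hzη i))
        (show 0 ≤ 1 / β by positivity)
      have hxi := hxp i
      have e : (z i - x i) ^ 2 / 2 * (1 / (β * η * x i) - 1) =
          1 / β * ((z i - x i) ^ 2 / (2 * η * x i)) - (z i - x i) ^ 2 / 2 := by
        field_simp
      rw [e]
      linarith
    refine le_trans ?_ (Finset.sum_le_sum fun i _ => hterm i)
    rw [Finset.sum_add_distrib, Finset.sum_add_distrib]
    rw [Fin.sum_univ_three] at hzs
    have hlin : ∑ i, (z i - x i) * (1 / β * (1 + Real.log (x i)) - x i) = 0 := by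
      have hlog : Real.log (1 - 2 * s) = Real.log s + β * (1 - 3 * s) := by linarith
      simp only [Fin.sum_univ_three, hx, Matrix.cons_val_zero, Matrix.cons_val_one,
        Matrix.cons_val]
      rw [hlog, show z 2 = 1 - z 0 - z 1 by linarith]
      field_simp
      ring
    have hA : 0 ≤ 1 / (β * η * s) - 1 := by
      rw [sub_nonneg, le_div_iff₀ (by positivity)]; linarith
    have hAC : 0 ≤ (1 / (β * η * s) - 1) / 2 + (1 / (β * η * (1 - 2 * s)) - 1) := by
      have key : ∀ u : ℝ, 0 < u → (1 / (β * η * s) - 1) / 2 + (1 / (β * η * u) - 1) =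
          (u + 2 * s - η * (3 * s * u * β)) / (2 * (β * η * s * u)) := by
        intro u hu
        field_simp
        ring
      rw [key _ hu]
      exact div_nonneg (by linarith) (by positivity)
    have hquad : 0 ≤ ∑ i, (z i - x i) ^ 2 / 2 * (1 / (β * η * x i) - 1) := by
      simp only [Fin.sum_univ_three, hx, Matrix.cons_val_zero, Matrix.cons_val_one,
        Matrix.cons_val]
      rw [show z 2 - (1 - 2 * s) = -((z 0 - s) + (z 1 - s)) by linarith]
      generalize 1 / (β * η * s) - 1 = A at *
      generalize 1 / (β * η * (1 - 2 * s)) - 1 = C at *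
      generalize z 0 - s = a
      generalize z 1 - s = b
      nlinarith [mul_nonneg hA (sq_nonneg (a - b)), mul_nonneg hAC (sq_nonneg (a + b))]
    rw [hlin]
    unfold oneF
    linarith
  refine ⟨?_, ?_⟩
  · rw [mem_Xi2_iff]
    refine ⟨fun i => (hxp i).le, fun i => (hxp i).le, ?_, ?_⟩ <;>
      · simp [syncPoint, Fin.sum_univ_three]; ring
  · have hev : ∀ᶠ p : (Fin 3 → ℝ) × (Fin 3 → ℝ) in nhds (syncPoint s),
        (∀ i, p.1 i < η * x i) ∧ ∀ i, p.2 i < η * x i := by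
      refine (Filter.eventually_all.2 fun i => ?_).and (Filter.eventually_all.2 fun i => ?_)
      · have hc : Continuous fun p : (Fin 3 → ℝ) × (Fin 3 → ℝ) => p.1 i := by fun_prop
        exact hc.continuousAt.eventually_lt_const (show x i < η * x i by nlinarith [hxp i])
      · have hc : Continuous fun p : (Fin 3 → ℝ) × (Fin 3 → ℝ) => p.2 i := by fun_prop
        exact hc.continuousAt.eventually_lt_const (show x i < η * x i by nlinarith [hxp i])
    filter_upwards [mem_nhdsWithin_of_mem_nhds hev, self_mem_nhdsWithin] with p hp hpX
    obtain ⟨k1, k2, k3, k4⟩ := mem_Xi2_iff.1 hpX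
    have a1 := hone p.1 k1 k3 fun i => (hp.1 i).le
    have a2 := hone p.2 k2 k4 fun i => (hp.2 i).le
    rw [F_eq_oneF, F_eq_oneF]
    have e : ∑ i, ((syncPoint s).1 i - (syncPoint s).2 i) ^ 2 = 0 := by simp [syncPoint]
    have e2 : 0 ≤ J / 2 * ∑ i, (p.1 i - p.2 i) ^ 2 :=
      mul_nonneg (by linarith) (Finset.sum_nonneg fun i _ => sq_nonneg _)
    rw [e]
    have : (1 + J) * (oneF β x + oneF β x) ≤ (1 + J) * (oneF β p.1 + oneF β p.2) :=
      mul_le_mul_of_nonneg_left (by linarith) (by linarith)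
    have e3 : (1 + J) * (oneF β (syncPoint s).1 + oneF β (syncPoint s).2) =
      (1 + J) * (oneF β x + oneF β x) := rfl
    rw [e3]
    linarith

/-! ### Synchronization of the critical points -/

theorem mul_lt_of_ratio_lt {β J r : ℝ} (hβ : 0 < β) (hr : 0 < r)
    (h : (β - r) / (β + r) < J) : β * (1 - J) < (1 + J) * r := by
  rw [div_lt_iff₀ (by positivity)] at h
  linarith

theorem div_mul_lt_of_lt_ratio {β J r : ℝ} (hβ : 0 < β) (hr : 0 < r)
    (h : J < (β - r) / (β + r)) : (1 + J) / β * r < 1 - J := by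
  rw [lt_div_iff₀ (by positivity)] at h
  rw [div_mul_eq_mul_div, div_lt_iff₀ hβ]
  linarith

/-- When its discriminant is nonnegative, ψ₃ is the larger root in J of (1+J)(2+J) - β(1+3J)(1-2J).
Beyond ψ₃ this is positive, which bounds β; the bound yields m ≤ 2 because 2(1+J)(1+3J)(1-2J) -
(1-J)(1+J)(2+J) = J(1+J)(3-11J). -/
theorem mul_one_sub_le_of_psi3_lt {β J : ℝ} (hβ : 0 < β) (hJ : 0 < J) (h : psi3 β < J)
    (hJ' : J ≤ 3 / 11) : β * (1 - J) ≤ 2 * (1 + J) := by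
  rw [psi3, div_lt_iff₀ (by positivity)] at h
  have hs := Real.sqrt_nonneg (25 * β ^ 2 - 50 * β + 1)
  have hD : 25 * β ^ 2 - 50 * β + 1 < (J * (2 * (1 + 6 * β)) - (β - 3)) ^ 2 :=
    (Real.sqrt_lt' (by linarith)).1 (by linarith)
  have hQ : 0 < (1 + 6 * β) * ((1 + J) * (2 + J) - β * ((1 + 3 * J) * (1 - 2 * J))) := by
    linarith
  have hQ := (mul_pos_iff_of_pos_left (by positivity)).1 hQ
  have hu : 0 < (1 + 3 * J) * (1 - 2 * J) := mul_pos (by linarith) (by linarith)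
  have h1 : β * (1 - J) * ((1 + 3 * J) * (1 - 2 * J)) ≤ (1 - J) * ((1 + J) * (2 + J)) := by
    nlinarith
  have h2 : (1 - J) * ((1 + J) * (2 + J)) ≤ 2 * (1 + J) * ((1 + 3 * J) * (1 - 2 * J)) := by
    nlinarith [mul_nonneg (mul_nonneg hJ.le (by linarith : (0 : ℝ) ≤ 1 + J))
      (by linarith : (0 : ℝ) ≤ 3 - 11 * J)]
  exact le_of_mul_le_mul_right (h1.trans h2) hu

theorem log_sub_two_add_neg {k m : ℝ} (h2 : 2 < m) (h3 : m < 3) (hxi : k * m < xi (1 / m)) :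
    Real.log (m - 2) + k * (3 - m) < 0 := by
  have hm : 0 < m := by linarith
  have h := one_sub_mul_xi (x := 1 / m)
    ⟨by positivity, by rw [div_lt_div_iff₀ hm (by norm_num)]; linarith⟩
  rw [show 1 - 2 * (1 / m) = (m - 2) / m by field_simp, Real.log_div (by linarith) hm.ne',
    Real.log_div one_ne_zero hm.ne', Real.log_one,
    show 1 - 3 * (1 / m) = -((3 - m) / m) by field_simp; ring] at h
  have h4 := mul_lt_mul_of_pos_left hxi (div_pos (sub_pos.2 h3) hm)
  rw [show (3 - m) / m * (k * m) = k * (3 - m) by field_simp] at h4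
  linarith

/-- The concave function log u + k(1-u) vanishes at 1; if positive at v, it stays positive between v
and 1. -/
theorem le_of_log_add_mul {k v w : ℝ} (hv : 0 < v) (hw : 0 < w) (hw1 : w < 1)
    (h1 : 0 < Real.log v + k * (1 - v)) (h2 : Real.log w + k * (1 - w) < 0) : w ≤ v := by
  by_contra! hlt
  have h := strictConcaveOn_log_Ioi.slope_anti_adjacent (Set.mem_Ioi.2 hv)
    (Set.mem_Ioi.2 one_pos) hlt hw1
  rw [Real.log_one, div_lt_div_iff₀ (by linarith) (by linarith)] at h
  nlinarith [mul_pos (sub_pos.2 hlt) (sub_pos.2 hw1)]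

/-- For β ≥ 3, J > ψ₁ means 1/m > x_l, hence ξ(1/m) > β; for β < 3, m < 3 gives ξ(1/m) > 3 > β. This
is the logarithmic condition of `Coupled`. -/
theorem coupled_of_lt {β J : ℝ} (h1 : beta1 < β) (hJ : 0 < J) (hJ1 : J < 1) (hp : psi1 β < J)
    (hc : 0 < jcFun J) (hm : 2 < β * (1 - J) / (1 + J)) :
    Coupled ((1 + J) / (1 - J)) (β * (1 - J) / (1 + J)) := by
  have hβ : 0 < β := beta1_pos.trans h1
  have hJ2 : 0 < 1 - J := by linarith
  have hkm : (1 + J) / (1 - J) * (β * (1 - J) / (1 + J)) = β := by field_simp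
  set m := β * (1 - J) / (1 + J) with hmdef
  have hm0 : 0 < m := by linarith
  have hhalf : 1 / m < 1 / 2 := one_div_lt_one_div_of_lt two_pos hm
  have key : m < 3 ∧ β < xi (1 / m) := by
    by_cases h3 : 3 ≤ β
    · have hl := one_third_le_xl h3
      have hl0 : 0 < xl β := by linarith
      rw [psi1, beta3, if_pos h3] at hp
      have h := mul_lt_of_ratio_lt hβ (one_div_pos.2 hl0) hp
      have hmx : m < 1 / xl β := by
        rw [hmdef, div_lt_iff₀ (by linarith)]; linarith
      have hx3 : 1 / xl β ≤ 3 := by rw [div_le_iff₀ hl0]; linarith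
      refine ⟨hmx.trans_le hx3, lt_xi_of_xl_lt ?_ ⟨by positivity, hhalf⟩⟩
      rwa [lt_div_iff₀ hm0, mul_comm, ← lt_div_iff₀ hl0]
    · push Not at h3
      have hmβ : m < β := by
        rw [hmdef, div_lt_iff₀ (by linarith)]
        nlinarith
      refine ⟨hmβ.trans h3, h3.trans (three_lt_xi ⟨?_, hhalf⟩)⟩
      exact one_div_lt_one_div_of_lt hm0 (hmβ.trans h3)
  have hE := log_sub_two_add_neg hm key.1 (by rw [hkm]; exact key.2)
  refine ⟨by rw [lt_div_iff₀ hJ2]; linarith, hm, ?_, hE⟩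
  refine le_of_log_add_mul (k := (1 + J) / (1 - J)) (by positivity) (by linarith)
    (by linarith [key.1]) ?_ (by rwa [show 1 - (m - 2) = 3 - m by ring])
  -- At v = 2/(3k+1) the quantity log v + k(1-v) is exactly `jcFun J`; this is where J_c enters.
  have hv : 2 / (3 * ((1 + J) / (1 - J)) + 1) = ((2 + J) / (1 - J))⁻¹ := by
    rw [inv_div, div_eq_div_iff (by positivity) (by positivity)]
    field_simp
    ring
  rw [hv, Real.log_inv, inv_div]
  rw [jcFun] at hc
  have e : (1 + J) / (1 - J) * (1 - (1 - J) / (2 + J)) =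
      (1 + J) * (1 / (1 - J) - 1 / (2 + J)) := by
    field_simp
  rw [e]
  linarith

theorem fst_eq_snd_of_psiS_lt {β J : ℝ} (h1 : beta1 < β) (hJ : 0 < J) (h : psiS β < J)
    {p : (Fin 3 → ℝ) × (Fin 3 → ℝ)} (hp : IsCriticalPoint β J p) : p.1 = p.2 := by
  have hβ : 0 < β := beta1_pos.trans h1
  have hJ1 : 0 < 1 + J := by linarith
  obtain ⟨⟨c, hc⟩, d, hd⟩ := exists_log_eq_of_isCriticalPoint hβ hJ hp
  obtain ⟨hX, hx, hy, -⟩ := hp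
  obtain ⟨-, -, sx, sy⟩ := mem_Xi2_iff.1 hX
  have hsub : ∀ i, Real.log (p.1 i) - Real.log (p.2 i) =
      β * (1 - J) / (1 + J) * (p.1 i - p.2 i) + (c - d) := by
    intro i
    rw [hc i, hd i]
    ring
  by_cases hm : β * (1 - J) / (1 + J) ≤ 2
  · exact eq_of_log_eq_of_le_two hm hx hy sx sy hsub
  rw [not_le] at hm
  have hJlt : J < 1 := by
    by_contra! hge
    have : β * (1 - J) / (1 + J) ≤ 0 :=
      div_nonpos_of_nonpos_of_nonneg (mul_nonpos_of_nonneg_of_nonpos hβ.le (by linarith)) hJ1.le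
    linarith
  rw [psiS, if_neg (not_le.2 h1), max_lt_iff, min_lt_iff] at h
  have hjc : 0 < jcFun J := by
    refine jcFun_pos_of_Jc_lt ⟨hJ, hJlt⟩ (h.2.imp_right fun h3 => ?_)
    by_contra! hle
    have := mul_one_sub_le_of_psi3_lt hβ hJ h3 hle
    rw [lt_div_iff₀ hJ1] at hm
    linarith
  refine eq_of_log_eq_of_coupled (b := (c - d) / 2) (c := (c + d) / 2)
    (coupled_of_lt h1 hJ hJlt h.1 hjc hm) hx hy sx sy (fun i => ?_) (fun i => ?_)
  · rw [hsub i]; ring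
  · have : 1 - J ≠ 0 := by linarith
    rw [hc i, hd i]
    field_simp
    ring

/-- Insert the critical equations into the gradient inequality for x and for y and add: what is left
is βJ/(1+J)·|x - y|² ≤ 0. -/
theorem fst_eq_snd_of_le_beta1 {β J : ℝ} (hβ : 0 < β) (h1 : β ≤ beta1) (hJ : 0 < J)
    {p : (Fin 3 → ℝ) × (Fin 3 → ℝ)} (hp : IsCriticalPoint β J p) : p.1 = p.2 := by
  obtain ⟨⟨c, hc⟩, d, hd⟩ := exists_log_eq_of_isCriticalPoint hβ hJ hp
  obtain ⟨hX, hx, hy, -⟩ := hp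
  obtain ⟨-, -, sx, sy⟩ := mem_Xi2_iff.1 hX
  have kx := beta1_mul_sq_le hx sx
  have ky := beta1_mul_sq_le hy sy
  simp only [hc] at kx
  simp only [hd] at ky
  rw [Fin.sum_univ_three] at sx sy
  simp only [Fin.sum_univ_three] at kx ky
  have ex : p.1 2 = 1 - p.1 0 - p.1 1 := by linarith
  have ey : p.2 2 = 1 - p.2 0 - p.2 1 := by linarith
  have hb : ∀ {A : ℝ}, 0 ≤ A → β * A ≤ beta1 * A := fun hA => mul_le_mul_of_nonneg_right h1 hA
  have bx := (hb (show 0 ≤ (p.1 0 - 1 / 3) ^ 2 + (p.1 1 - 1 / 3) ^ 2 + (p.1 2 - 1 / 3) ^ 2 by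
    positivity)).trans kx
  have bY := (hb (show 0 ≤ (p.2 0 - 1 / 3) ^ 2 + (p.2 1 - 1 / 3) ^ 2 + (p.2 2 - 1 / 3) ^ 2 by
    positivity)).trans ky
  have hsum : β * J / (1 + J) *
      ((p.1 0 - p.2 0) ^ 2 + (p.1 1 - p.2 1) ^ 2 + (p.1 2 - p.2 2) ^ 2) ≤ 0 := by
    have h2 := add_le_add bx bY
    rw [ex, ey] at h2 ⊢
    have e : β = β / (1 + J) * (1 + J) := by field_simp
    rw [mul_div_right_comm]
    generalize β / (1 + J) = κ at *
    rw [e] at h2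
    linarith
  have hpos : 0 < β * J / (1 + J) := by positivity
  have hle : (p.1 0 - p.2 0) ^ 2 + (p.1 1 - p.2 1) ^ 2 + (p.1 2 - p.2 2) ^ 2 ≤ 0 := by
    by_contra! hgt
    linarith [mul_pos hpos hgt]
  have hz : ∀ i, (p.1 i - p.2 i) ^ 2 ≤ 0 := by
    intro i
    have a0 := sq_nonneg (p.1 0 - p.2 0)
    have a1 := sq_nonneg (p.1 1 - p.2 1)
    have a2 := sq_nonneg (p.1 2 - p.2 2)
    fin_cases i <;> simp only [Fin.zero_eta, Fin.mk_one, Fin.reduceFinMk] <;> linarith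
  funext i
  have := pow_eq_zero_iff (two_ne_zero) |>.1 (le_antisymm (hz i) (sq_nonneg _))
  linarith

/-- The tangency point `ξ(s) = β₁` is not a local minimum at `β = β₁`. -/
theorem not_isLocalMinimum_of_xi_eq_beta1 {J s : ℝ} (hJ : 0 < J) (hs : s ∈ xiSolutions beta1)
    (σ : Equiv.Perm (Fin 3)) : ¬ IsLocalMinimum beta1 J (permute σ (syncPoint s)) := by
  intro hmin
  have hmin := hmin.permute σ⁻¹
  rw [permute_inv_permute] at hmin
  have hs3 := lt_one_third_of_mem beta1_lt_three hs
  have hs0 := hs.1.1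
  have hb := beta1_pos
  set w : (Fin 3 → ℝ) × (Fin 3 → ℝ) := (![1, 1, -2], ![1, 1, -2]) with hw
  have hline : ∀ t, syncPoint t = syncPoint 0 + t • w := by
    intro t
    refine Prod.ext ?_ ?_ <;> funext i <;> fin_cases i <;> simp [syncPoint, hw] <;> ring
  have hpos : ∀ t ∈ Set.Ioo (0 : ℝ) (1 / 2), Pos (syncPoint t) := by
    rintro t ⟨h0, h1⟩
    constructor <;> intro i <;> fin_cases i <;> simp [syncPoint] <;> linarith
  have hder : ∀ t ∈ Set.Ioo (0 : ℝ) (1 / 2),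
      HasDerivAt (fun t => F beta1 J (syncPoint t)) (dF beta1 J (syncPoint t) w) t := by
    intro t ht
    have h := hpos t ht
    rw [hline t] at h ⊢
    rw [show (fun t => F beta1 J (syncPoint t)) = fun t => F beta1 J (syncPoint 0 + t • w) from
      funext fun t => by rw [← hline t]]
    exact hasDerivAt_F_line _ _ h
  -- The derivative is 4(1+J)(1-3t)(1 - ξ(t)/β₁), negative since ξ > β₁ away from s.
  have hanti : StrictAntiOn (fun t => F beta1 J (syncPoint t)) (Set.Icc s (1 / 3)) := by
    have hsub : ∀ t ∈ Set.Icc s (1 / 3), t ∈ Set.Ioo (0 : ℝ) (1 / 2) :=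
      fun t ht => ⟨hs0.trans_le ht.1, ht.2.trans_lt (by norm_num)⟩
    apply strictAntiOn_of_deriv_neg (convex_Icc _ _)
    · exact fun t ht => (hder t (hsub t ht)).continuousAt.continuousWithinAt
    · intro t ht
      rw [interior_Icc] at ht
      have ht' := hsub t (Set.Ioo_subset_Icc_self ht)
      rw [(hder t ht').deriv]
      have hxi := one_sub_mul_xi ht'
      have hlt := beta1_lt_xi hs.1 ht' ht.1.ne hs.2
      have e : dF beta1 J (syncPoint t) w =
          4 * (1 + J) * (1 - 3 * t) * (1 - xi t / beta1) := by
        have e1 : dF beta1 J (syncPoint t) w = 4 * (1 + J) * (1 - 3 * t) -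
            4 * ((1 + J) / beta1) * (Real.log (1 - 2 * t) - Real.log t) := by
          simp [dF, syncPoint, hw, Fin.sum_univ_three]
          ring
        rw [e1, ← hxi]
        ring
      rw [e]
      have h3 : 0 < 1 - 3 * t := by linarith [ht.2]
      refine mul_neg_of_pos_of_neg (by positivity) ?_
      rw [sub_neg, lt_div_iff₀ hb]
      linarith
  have hcont : Continuous syncPoint := by
    have : syncPoint = fun t => syncPoint 0 + t • w := funext hline
    rw [this]
    fun_prop
  have hev : ∀ᶠ t in nhdsWithin s (Set.Ioi s), t < 1 / 3 ∧ (syncPoint t ∈ Xi2 3 →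
      F beta1 J (syncPoint s) ≤ F beta1 J (syncPoint t)) :=
    ((eventually_lt_nhds hs3).and (hcont.continuousAt.eventually
      (eventually_nhdsWithin_iff.1 hmin.2))).filter_mono nhdsWithin_le_nhds
  obtain ⟨t, ⟨ht3, htm⟩, hst⟩ := (hev.and self_mem_nhdsWithin).exists
  have hst : s < t := hst
  refine (hanti ⟨le_rfl, hs3.le⟩ ⟨hst.le, ht3.le⟩ hst).not_ge (htm ?_)
  have hp := hpos t ⟨hs0.trans hst, by linarith⟩
  refine mem_Xi2_iff.2 ⟨fun i => (hp.1 i).le, fun i => (hp.2 i).le, ?_, ?_⟩ <;>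
    · simp [syncPoint, Fin.sum_univ_three]; ring

theorem synchronized_of_beta1_lt {β J : ℝ} (h1 : beta1 < β) (hJ : 0 < J) (h : psiS β < J) :
    Synchronized β J := by
  intro p hp
  have hβ : 0 < β := beta1_pos.trans h1
  have hc : IsCriticalPoint β J p := hp.elim (fun h => h.isCriticalPoint hβ hJ) fun h => h.1
  rcases eq_permute_syncPoint_of_isCriticalPoint hβ hJ hc (fst_eq_snd_of_psiS_lt h1 hJ h hc) with
    rfl | ⟨s, hs, σ, rfl⟩
  · exact Or.inr rfl
  · rcases eq_xs_or_eq_xl hs with rfl | rfl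
    · exact Or.inl (Or.inl (mem_S2_iff.2 ⟨h1, σ, rfl⟩))
    · exact Or.inl (Or.inr (mem_L2_iff.2 ⟨h1, σ, rfl⟩))

theorem synchronized_of_le_beta1 {β J : ℝ} (hβ : 0 < β) (h1 : β ≤ beta1) (hJ : 0 < J) :
    Synchronized β J := by
  have hloc : ∀ a, IsLocalMinimum β J a → a = q3 := by
    intro a ha
    have hc := ha.isCriticalPoint hβ hJ
    rcases eq_permute_syncPoint_of_isCriticalPoint hβ hJ hc
      (fst_eq_snd_of_le_beta1 hβ h1 hJ hc) with rfl | ⟨s, hs, σ, rfl⟩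
    · rfl
    · obtain rfl : β = beta1 := le_antisymm h1 (hs.2 ▸ beta1_le_xi hs.1)
      exact (not_isLocalMinimum_of_xi_eq_beta1 hJ hs σ ha).elim
  rintro p (hp | ⟨-, a, b, ha, hb, -, -, hne, -⟩)
  · exact Or.inr (hloc p hp)
  · rw [hloc a ha, hloc b hb] at hne
    exact (hne rfl).elim

/-! ### Desynchronization -/

theorem Synchronized.finite_isLocalMinimum {β J : ℝ} (h : Synchronized β J) :
    {l : (Fin 3 → ℝ) × (Fin 3 → ℝ) | IsLocalMinimum β J l}.Finite := by
  refine Set.Finite.subset (((Set.finite_range fun σ => permute σ (syncPoint (xs β))).union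
    (Set.finite_range fun σ => permute σ (syncPoint (xl β)))).union (Set.finite_singleton q3)) ?_
  intro l hl
  refine (h l (Or.inl hl)).imp_left (Or.imp (fun h => ?_) fun h => ?_)
  · obtain ⟨-, σ, rfl⟩ := mem_S2_iff.1 h; exact ⟨σ, rfl⟩
  · obtain ⟨-, σ, rfl⟩ := mem_L2_iff.1 h; exact ⟨σ, rfl⟩

theorem desynchronized_of_three_lt {β J : ℝ} (h3 : 3 < β) (hJ : 0 < J) (h : J < psi1 β) :
    Desynchronized β J := by
  intro hsync
  have hβ : 0 < β := by linarith
  have hl0 : 0 < xl β := by linarith [one_third_le_xl h3.le]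
  rw [psi1, beta3, if_pos h3.le] at h
  have hr := div_mul_lt_of_lt_ratio hβ (one_div_pos.2 hl0) h
  have hL : ∀ p ∈ L2 β, IsCriticalPoint β J p →
      LocJoined β J (F β J p) p ∧ ¬ IsLocalMinimum β J p := by
    intro p hp hc
    obtain ⟨-, σ, rfl⟩ := mem_L2_iff.1 hp
    refine locJoined_of_neg (w := ![1, -1, 0]) hJ hc (by simp [Fin.sum_univ_three]) ?_
    simp only [Fin.sum_univ_three, syncPoint, Matrix.cons_val_zero, Matrix.cons_val_one,
      Matrix.cons_val]
    linear_combination 2 * hr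
  have hq : ¬ IsLocalMinimum β J q3 := fun hm =>
    (locJoined_q3 hJ h3 (hm.isCriticalPoint hβ hJ)).2 hm
  obtain ⟨a, haX, hamin⟩ := (isCompact_Xi2 (q := 3)).exists_isMinOn ⟨q3, q3_mem_Xi2⟩
    (continuous_F β J).continuousOn
  have ha : IsLocalMinimum β J a :=
    ⟨haX, Filter.mem_of_superset self_mem_nhdsWithin fun z hz => hamin hz⟩
  have hmem : ∃ σ, a = permute σ (syncPoint (xs β)) := by
    rcases hsync a (Or.inl ha) with (hS | hl) | rfl
    · exact (mem_S2_iff.1 hS).2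
    · exact ((hL a hl (ha.isCriticalPoint hβ hJ)).2 ha).elim
    · exact (hq ha).elim
  obtain ⟨σ, rfl⟩ := hmem
  have ha' := ha.permute σ⁻¹
  rw [permute_inv_permute] at ha'
  have hne : syncPoint (xs β) ≠ permute (Equiv.swap 0 2) (syncPoint (xs β)) := by
    intro he
    have h0 := congrFun (congrArg Prod.fst he) 0
    simp only [permute, syncPoint, Function.comp_apply, Equiv.swap_apply_left,
      Matrix.cons_val_zero, Matrix.cons_val] at h0
    rw [show xs β = 1 / 3 by linarith, syncPoint_one_third] at ha'
    exact hq ha'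
  obtain ⟨p, hp⟩ := exists_isLowestSaddle hβ hJ hsync.finite_isLocalMinimum ha'
    (ha'.permute (Equiv.swap 0 2)) hne
  rcases hsync p (Or.inr hp) with (hS | hl) | rfl
  -- All points of 𝔖² share the global minimum value, but a lowest saddle lies strictly above some
  -- local minimum.
  · obtain ⟨-, τ, rfl⟩ := mem_S2_iff.1 hS
    obtain ⟨-, b, -, hb, -, hlt, -⟩ := hp
    have hle : F β J (permute σ (syncPoint (xs β))) ≤ F β J b := hamin hb.1
    rw [F_permute] at hlt hle
    linarith
  · exact not_isLowestSaddle_of_locJoined (hL p hl hp.1).1 hp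
  · exact not_isLowestSaddle_of_locJoined (locJoined_q3 hJ h3 hp.1).1 hp

theorem desynchronized_of_lt_three {β J : ℝ} (h1 : beta1 < β) (h3 : β < 3) (hJ : 0 < J)
    (h : J < psi2 β) : Desynchronized β J := by
  intro hsync
  have hβ : 0 < β := beta1_pos.trans h1
  have hne := xiSolutions_nonempty h1.le
  have hl := xl_mem hne
  have hs := xs_mem hne
  have hs3 := lt_one_third_of_mem h3 hs
  have hl0 := hl.1.1
  have hl1 : 0 < 1 - 2 * xl β := by linarith [hl.1.2]
  rw [psi2, beta3, if_pos ⟨h1.le, h3.le⟩] at h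
  have hr := div_mul_lt_of_lt_ratio hβ (by positivity) h
  have hL : ∀ p ∈ L2 β, IsCriticalPoint β J p → LocJoined β J (F β J p) p := by
    intro p hp hc
    obtain ⟨-, σ, rfl⟩ := mem_L2_iff.1 hp
    refine (locJoined_of_neg (w := ![1, 1, -2]) hJ hc
      (by simp [Fin.sum_univ_three]; norm_num) ?_).1
    simp only [Fin.sum_univ_three, syncPoint, Matrix.cons_val_zero, Matrix.cons_val_one,
      Matrix.cons_val]
    -- The direction (1, 1, -2), of squared length 6, turns the negativity criterion into J < ψ₂;
    -- for β > 3 the direction (1, -1, 0) gives ψ₁.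
    have e : (1 : ℝ) ^ 2 / xl β + 1 ^ 2 / xl β + (-2) ^ 2 / (1 - 2 * xl β) =
        6 * (1 / (3 * xl β * (1 - 2 * xl β))) := by
      generalize hu : 1 - 2 * xl β = u at *
      field_simp
      linarith
    rw [e]
    linarith
  have hq : IsLocalMinimum β J q3 := by
    rw [← syncPoint_one_third]
    refine isLocalMinimum_syncPoint hβ hJ ⟨by norm_num, by norm_num⟩ ?_ (by linarith) ?_
    · norm_num
    · norm_num; exact h3
  have hx : IsLocalMinimum β J (syncPoint (xs β)) := by
    refine isLocalMinimum_syncPoint hβ hJ hs.1 ?_ ?_ (lt_one_div_xs h1 h3)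
    · rw [← one_sub_mul_xi hs.1, hs.2]; ring
    · have := mul_xi_lt_one ⟨hs.1.1, hs3⟩
      rwa [hs.2] at this
  have hqx : q3 ≠ syncPoint (xs β) := by
    intro he
    have h0 := congrFun (congrArg Prod.fst he) 0
    simp only [q3, syncPoint, Matrix.cons_val_zero] at h0
    linarith
  obtain ⟨p, hp⟩ := exists_isLowestSaddle hβ hJ hsync.finite_isLocalMinimum hq hx hqx
  have hnot : ¬ IsLocalMinimum β J p := by
    intro hm
    obtain ⟨-, a, -, -, -, -, -, -, hcl, -⟩ := hp
    exact hm.not_mem_closure hcl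
  rcases hsync p (Or.inr hp) with (hS | hl) | rfl
  · obtain ⟨-, τ, rfl⟩ := mem_S2_iff.1 hS
    exact hnot (hx.permute τ)
  · exact not_isLowestSaddle_of_locJoined (hL p hl hp.1) hp
  · exact hnot hq

theorem desynchronized_of_lt_psiD {β J : ℝ} (hJ : 0 < J) (h : J < psiD β) :
    Desynchronized β J := by
  have h13 := beta1_lt_three
  rcases lt_trichotomy β 3 with h3 | rfl | h3
  · have e1 : psi1 β = 0 := if_neg (not_le.2 h3)
    rw [psiD, e1, zero_add] at h
    rcases lt_trichotomy beta1 β with h1 | rfl | h1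
    · exact desynchronized_of_lt_three h1 h3 hJ h
    · rw [psi2, beta3, if_pos ⟨le_rfl, h3.le⟩, ← xi_xl_beta1.2, sub_self, zero_div] at h
      linarith
    · rw [psi2, if_neg fun hc => (not_lt.2 hc.1) h1] at h
      linarith
  -- At β = 3 both indicators are on, but x_l = 1/3 makes ψ₁ and ψ₂ vanish.
  · rw [psiD, psi1, psi2, beta3, if_pos le_rfl, if_pos ⟨h13.le, le_rfl⟩, xl_three] at h
    norm_num at h
    linarith
  · rw [psiD, psi2, if_neg fun hc => (not_lt.2 hc.2) h3, add_zero] at h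
    exact desynchronized_of_three_lt h3 hJ h

end CWP

theorem mainTheorem1 (β J : ℝ) (hβ : 0 < β) (hJ : 0 < J) :
    (CWP.psiS β < J → CWP.Synchronized β J) ∧
      (J < CWP.psiD β → CWP.Desynchronized β J) := by
  refine ⟨fun h => ?_, CWP.desynchronized_of_lt_psiD hJ⟩
  rcases lt_or_ge CWP.beta1 β with h1 | h1
  · exact CWP.synchronized_of_beta1_lt h1 hJ h
  · exact CWP.synchronized_of_le_beta1 hβ h1 hJ
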